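/- **Setting.** A *polygon* is a bounded connected open subset of $\mathbb R^2$ which is the interior of its closure and whose boundary is a finite union of line segments. Let $\Omega$ be a polygon. A *polygonal mesh* of $\Omega$ consists of a finite set $\mathcal T_h$ of pairwise disjoint polygons (elements) with $\overline\Omega=\bigcup_{T\in\mathcal T_h}\overline T$ and a finite set $\mathcal F_h$ of pairwise disjoint open segments of nonzero length contained in $\overline\Omega$ (faces), such that each face is contained either in $\partial T_1\cap\partial T_2$ for two distinct elements $T_1,T_2$ or in $\partial T\cap\partial\Omega$ for an element $T$, and $\bigcup_{T\in\mathcal T_h}\partial T=\bigcup_{F\in\mathcal F_h}\overline F$. Write $h_X$ for the diameter of $X$. The mesh has *regularity parameter* $\varrho>0$ if there is a conforming triangulation of $\Omega$ decomposing each element into triangles and each face into edges, such that every triangle $S$ of it, with inradius $r_S$, satisfies $\varrho h_S\le r_S$, and $\varrho h_T\le h_S$ whenever $S$ is contained in the element $T$ (up to boundary). Let $\mathbb A$ be a field of fourth-order tensors on $\Omega$ that is constant on each member of a finite polygonal partition $P_\Omega$ of $\Omega$, whose values are symmetric ($\mathbb A_{ijkl}=\mathbb A_{klij}=\mathbb A_{jikl}$)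 and, as endomorphisms of the symmetric $2\times2$ matrices, have all eigenvalues in $[\alpha,\beta]$ with $\alpha>0$. The mesh is *compliant* with $P_\Omega$ if each element is contained in a unique member of $P_\Omega$; then $\mathbb A_T:=\mathbb A_{|T}$ is constant. For an element $T$ let $\mathbb P^l(T)$ be the space of restrictions to $T$ of polynomials of total degree at most $l$, let $(\cdot,\cdot)_T$ be the $L^2(T)$ inner product, and set $$|\varphi|_{H^m(T)}=\sum_{\kappa_1+\kappa_2=m}\|\partial_1^{\kappa_1}\partial_2^{\kappa_2}\varphi\|_{L^2(T)},\qquad |\varphi|_{H^m(\partial T)}=\sum_{\kappa_1+\kappa_2=m}\|\partial_1^{\kappa_1}\partial_2^{\kappa_2}\varphi\|_{L^2(\partial T)},$$ with weak derivatives, and with their boundary traces in the second definition. For $l\ge2$ and $v\in H^2(T)$ the *local energy projection* $\varpi_T^lv\in\mathbb P^l(T)$ is defined by $$(\mathbb A_T\nabla^2(\varpi_T^lv-v),\nabla^2w)_T=0\quad\forall w\in\mathbb P^l(T),\qquad \pi_T^1(\varpi_T^lv-v)=0,$$ where $\pi_T^1$ is the $L^2(T)$-orthogonal projector onto $\mathbb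 P^1(T)$. **Theorem 2.1.** Let $l\ge2$ be an integer, $\varrho>0$ and $\alpha,\beta$ real with $\alpha>0$. There is a real number $C>0$, depending only on $l$, $\varrho$, $\alpha$, $\beta$, such that for all $\Omega$, $P_\Omega$, $\mathbb A$ as above, all polygonal meshes of $\Omega$ with regularity parameter $\varrho$ that are compliant with $P_\Omega$, and all elements $T$ of the mesh, $\varpi_T^lv$ exists and is unique for every $v\in H^2(T)$, and for all $s\in\{2,\dots,l+1\}$ and all $v\in H^s(T)$ one has $v-\varpi_T^lv\in H^s(T)$, $$|v-\varpi_T^lv|_{H^m(T)}\le C\,h_T^{s-m}\,|v|_{H^s(T)}\qquad\forall m\in\{0,\dots,s\},$$ and, the boundary traces of the derivatives of order $m$ of $v-\varpi_T^lv$ being well defined in $L^2(\partial T)$ for $m\le s-1$, $$|v-\varpi_T^lv|_{H^m(\partial T)}\le C\,h_T^{s-m-\frac12}\,|v|_{H^s(T)}\qquad\forall m\in\{0,\dots,s-1\}.$$ -/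

import Mathlib

open MeasureTheory
open scoped ContDiff

noncomputable section

namespace EnergyProj

/-- The Euclidean plane. -/
abbrev Plane : Type := EuclideanSpace ℝ (Fin 2)

/-! ### Polygons, polygonal meshes, regularity -/

/-- Open polygons: bounded connected (hence nonempty) open sets of the plane that lie locally on
one side of their boundary (no slits: the set is the interior of its closure), and whose boundary
is a finite union of line segments. -/
structure IsPolygon (U : Set Plane) : Prop where
  isOpen : IsOpen U
  isConnected : IsConnected U
  isBounded : Bornology.IsBounded U
  interior_closure : interior (closure U) = U
  frontier_eq : ∃ S : Finset (Plane × Plane), frontier U = ⋃ p ∈ S, segment ℝ p.1 p.2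

/-- A finite polygonal partition `P` of `Ω`. -/
structure IsPolygonalPartition (Ω : Set Plane) {n : ℕ} (P : Fin n → Set Plane) : Prop where
  isPolygon : ∀ i, IsPolygon (P i)
  disjoint : ∀ i j, i ≠ j → Disjoint (P i) (P j)
  closure_eq : closure Ω = ⋃ i, closure (P i)

/-- A polygonal mesh of `Ω`: a finite set of elements (open disjoint polygons) together with a
finite set of faces (open disjoint segments of nonzero length), each of which is an interface or a
boundary face, and which partition the mesh skeleton. -/
structure PolygonalMesh (Ω : Set Plane) where
  elements : Finset (Set Plane)
  faces : Finset (Set Plane)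
  isPolygon : ∀ T ∈ elements, IsPolygon T
  elements_disjoint : ∀ T ∈ elements, ∀ T' ∈ elements, T ≠ T' → Disjoint T T'
  closure_eq : closure Ω = ⋃ T ∈ elements, closure T
  face_segment : ∀ F ∈ faces, ∃ a b : Plane, a ≠ b ∧ F = openSegment ℝ a b
  face_subset : ∀ F ∈ faces, F ⊆ closure Ω
  faces_disjoint : ∀ F ∈ faces, ∀ F' ∈ faces, F ≠ F' → Disjoint F F'
  face_type : ∀ F ∈ faces,
    (∃ T₁ ∈ elements, ∃ T₂ ∈ elements, T₁ ≠ T₂ ∧ F ⊆ frontier T₁ ∩ frontier T₂) ∨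
      (∃ T ∈ elements, F ⊆ frontier T ∩ frontier Ω)
  skeleton : (⋃ T ∈ elements, frontier T) = ⋃ F ∈ faces, closure F

/-- The inradius of a plane set: the supremum of the radii of the closed discs contained in it. -/
def inradius (S : Set Plane) : ℝ :=
  sSup {r : ℝ | 0 ≤ r ∧ ∃ c : Plane, Metric.closedBall c r ⊆ S}

/-- The (closed) triangles of a planar simplicial complex. -/
def triangles (K : Geometry.SimplicialComplex ℝ Plane) : Set (Set Plane) :=
  {S | ∃ s ∈ K.faces, s.card = 3 ∧ S = convexHull ℝ (s : Set Plane)}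

/-- The (closed) edges of a planar simplicial complex. -/
def edges (K : Geometry.SimplicialComplex ℝ Plane) : Set (Set Plane) :=
  {e | ∃ s ∈ K.faces, s.card = 2 ∧ e = convexHull ℝ (s : Set Plane)}

/-- `K` is a matching simplicial submesh of the mesh `M`: a conforming triangulation of `Ω` (a
finite simplicial complex, all of whose simplices are triangles or subsimplices of triangles, with
underlying space the closure of `Ω`) such that each element of `M` is decomposed into triangles of
`K` and each face of `M` into edges of `K`. -/
structure IsMatchingSubmesh {Ω : Set Plane} (M : PolygonalMesh Ω)
    (K : Geometry.SimplicialComplex ℝ Plane) : Prop where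
  finite : K.faces.Finite
  pure : ∀ s ∈ K.faces, ∃ t ∈ K.faces, s ⊆ t ∧ t.card = 3
  space_eq : K.space = closure Ω
  element_eq : ∀ T ∈ M.elements, closure T = ⋃₀ {S ∈ triangles K | S ⊆ closure T}
  face_eq : ∀ F ∈ M.faces, closure F = ⋃₀ {e ∈ edges K | e ⊆ closure F}

/-- The mesh `M` admits a matching simplicial submesh with regularity parameter `ϱ`. -/
def PolygonalMesh.IsRegular {Ω : Set Plane} (M : PolygonalMesh Ω) (ϱ : ℝ) : Prop :=
  ∃ K : Geometry.SimplicialComplex ℝ Plane, IsMatchingSubmesh M K ∧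
    (∀ S ∈ triangles K, ϱ * Metric.diam S ≤ inradius S) ∧
    (∀ T ∈ M.elements, ∀ S ∈ triangles K, S ⊆ closure T → ϱ * Metric.diam T ≤ Metric.diam S)

/-- The mesh `M` is compliant with the partition `P`. -/
def PolygonalMesh.IsCompliant {Ω : Set Plane} (M : PolygonalMesh Ω) {n : ℕ}
    (P : Fin n → Set Plane) : Prop :=
  ∀ T ∈ M.elements, ∃! i, T ⊆ P i

/-! ### The material tensor -/

/-- Fourth-order tensors on the plane. -/
abbrev Tensor4 : Type := Fin 2 → Fin 2 → Fin 2 → Fin 2 → ℝ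

/-- `A` is symmetric (so that it acts as a self-adjoint endomorphism of the symmetric `2 × 2`
matrices), and all the eigenvalues of this endomorphism lie in `[α, β]`. -/
structure IsElastic (α β : ℝ) (A : Tensor4) : Prop where
  symm_major : ∀ i j k l, A i j k l = A k l i j
  symm_minor : ∀ i j k l, A i j k l = A j i k l
  lower : ∀ τ : Matrix (Fin 2) (Fin 2) ℝ, τ.IsSymm →
    α * ∑ i, ∑ j, τ i j ^ 2 ≤ ∑ i, ∑ j, ∑ k, ∑ l, A i j k l * τ k l * τ i j
  upper : ∀ τ : Matrix (Fin 2) (Fin 2) ℝ, τ.IsSymm →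
    ∑ i, ∑ j, ∑ k, ∑ l, A i j k l * τ k l * τ i j ≤ β * ∑ i, ∑ j, τ i j ^ 2

/-- The tensor field `A` is constant on each member of the partition `P`, with a symmetric value
whose eigenvalues lie in `[α, β]`. -/
structure IsMaterialField (α β : ℝ) {n : ℕ} (P : Fin n → Set Plane) (A : Plane → Tensor4) :
    Prop where
  const : ∀ i, ∀ x ∈ P i, ∀ y ∈ P i, A x = A y
  elastic : ∀ i, ∀ x ∈ P i, IsElastic α β (A x)

/-! ### Weak derivatives and Sobolev spaces on an open set -/

/-- The classical partial derivative `∂ᵢ f`. -/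
def partialDeriv (i : Fin 2) (f : Plane → ℝ) : Plane → ℝ :=
  fun x => fderiv ℝ f x (EuclideanSpace.single i 1)

/-- The classical derivative `∂₁^κ₁ ∂₂^κ₂ f`. -/
def multiDeriv (κ : ℕ × ℕ) (f : Plane → ℝ) : Plane → ℝ :=
  (partialDeriv 0)^[κ.1] ((partialDeriv 1)^[κ.2] f)

/-- `w` is the weak derivative `∂^κ v` on the open set `T`. -/
def IsWeakDeriv (T : Set Plane) (κ : ℕ × ℕ) (v w : Plane → ℝ) : Prop :=
  LocallyIntegrableOn v T volume ∧ LocallyIntegrableOn w T volume ∧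
    ∀ φ : Plane → ℝ, ContDiff ℝ ∞ φ → HasCompactSupport φ → tsupport φ ⊆ T →
      ∫ x in T, v x * multiDeriv κ φ x = (-1) ^ (κ.1 + κ.2) * ∫ x in T, w x * φ x

open Classical in
/-- The weak derivative `∂^κ v` on `T` (unique almost everywhere on `T` if it exists). -/
def weakDeriv (T : Set Plane) (κ : ℕ × ℕ) (v : Plane → ℝ) : Plane → ℝ :=
  if h : ∃ w, IsWeakDeriv T κ v w then h.choose else 0

/-- `v ∈ H^s(T)`: every weak derivative of order at most `s` (order `0` included) exists and is
square-integrable on `T`. -/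
def MemSobolev (T : Set Plane) (s : ℕ) (v : Plane → ℝ) : Prop :=
  MemLp v 2 (volume.restrict T) ∧
    ∀ κ : ℕ × ℕ, κ.1 + κ.2 ≤ s → ∃ w, IsWeakDeriv T κ v w ∧ MemLp w 2 (volume.restrict T)

/-- The seminorm `|v|_{H^m(T)}`: the sum of the `L²(T)` norms of the derivatives of order `m`. -/
def sobolevSeminorm (T : Set Plane) (m : ℕ) (v : Plane → ℝ) : ℝ :=
  ∑ κ ∈ Finset.HasAntidiagonal.antidiagonal m, lpNorm (weakDeriv T κ v) 2 (volume.restrict T)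

/-! ### Boundary traces -/

/-- `n` is the outward unit normal to `T` at `x`: near `x`, the set `T` is the half-plane with
boundary through `x` and outward unit normal `n`. -/
def IsOutwardNormal (T : Set Plane) (x n : Plane) : Prop :=
  ‖n‖ = 1 ∧ ∃ r > 0, ∀ y ∈ Metric.ball x r, y ∈ T ↔ inner ℝ (y - x) n < 0

open Classical in
/-- The outward unit normal to `T` at `x`; for a polygon it exists (and is unique) at all boundary
points except finitely many. -/
def outwardNormal (T : Set Plane) (x : Plane) : Plane :=
  if h : ∃ n, IsOutwardNormal T x n then h.choose else 0

/-- The arc length measure on the boundary of `T`. -/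
def boundaryMeasure (T : Set Plane) : Measure Plane :=
  (Measure.hausdorffMeasure 1 : Measure Plane).restrict (frontier T)

/-- `g ∈ L²(∂T)` is the boundary trace of `w ∈ H¹(T)`, characterized by the integration by parts
formula against all smooth test functions on the plane. -/
def IsTrace (T : Set Plane) (w g : Plane → ℝ) : Prop :=
  MemSobolev T 1 w ∧ MemLp g 2 (boundaryMeasure T) ∧
    ∀ φ : Plane → ℝ, ContDiff ℝ ∞ φ → HasCompactSupport φ →
      (∫ x in T, w x * partialDeriv 0 φ x) + (∫ x in T, weakDeriv T (1, 0) w x * φ x) =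
          ∫ x, g x * φ x * outwardNormal T x 0 ∂(boundaryMeasure T) ∧
      (∫ x in T, w x * partialDeriv 1 φ x) + (∫ x in T, weakDeriv T (0, 1) w x * φ x) =
          ∫ x, g x * φ x * outwardNormal T x 1 ∂(boundaryMeasure T)

/-- `w` has a boundary trace on `∂T`. -/
def HasTrace (T : Set Plane) (w : Plane → ℝ) : Prop := ∃ g, IsTrace T w g

open Classical in
/-- The boundary trace of `w` on `∂T` (unique almost everywhere on `∂T` if it exists). -/
def trace (T : Set Plane) (w : Plane → ℝ) : Plane → ℝ :=
  if h : HasTrace T w then h.choose else 0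

/-- The seminorm `|v|_{H^m(∂T)}`: the sum of the `L²(∂T)` norms of the boundary traces of the
derivatives of order `m`. -/
def boundarySeminorm (T : Set Plane) (m : ℕ) (v : Plane → ℝ) : ℝ :=
  ∑ κ ∈ Finset.HasAntidiagonal.antidiagonal m, lpNorm (trace T (weakDeriv T κ v)) 2 (boundaryMeasure T)

/-! ### Projectors on local polynomial spaces -/

/-- The polynomial function on the plane defined by `p`. -/
def polyFun (p : MvPolynomial (Fin 2) ℝ) : Plane → ℝ :=
  fun x => MvPolynomial.eval (fun i => x i) p

/-- `p` is the `L²(T)`-orthogonal projection of `v` on the polynomials of total degree `≤ l`. -/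
def IsL2Projection (T : Set Plane) (l : ℕ) (v : Plane → ℝ) (p : MvPolynomial (Fin 2) ℝ) : Prop :=
  p.totalDegree ≤ l ∧ ∀ q : MvPolynomial (Fin 2) ℝ, q.totalDegree ≤ l →
    ∫ x in T, (polyFun p x - v x) * polyFun q x = 0

/-- The multi-index of the second derivative `∂ᵢ∂ⱼ`. -/
def hessIndex (i j : Fin 2) : ℕ × ℕ :=
  ((if i = 0 then 1 else 0) + (if j = 0 then 1 else 0),
    (if i = 1 then 1 else 0) + (if j = 1 then 1 else 0))

/-- The (weak) Hessian of `v` on `T`. -/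
def hessian (T : Set Plane) (v : Plane → ℝ) (x : Plane) : Matrix (Fin 2) (Fin 2) ℝ :=
  Matrix.of fun i j => weakDeriv T (hessIndex i j) v x

/-- The local energy bilinear form `a_{|T}(u, v) = (A ∇²u, ∇²v)_T`. -/
def energyForm (A : Plane → Tensor4) (T : Set Plane) (u v : Plane → ℝ) : ℝ :=
  ∫ x in T, ∑ i, ∑ j, ∑ k, ∑ l, A x i j k l * hessian T u x k l * hessian T v x i j

/-- `p` is the local energy projection of `v` on the polynomials of total degree `≤ l`:
`a_{|T}(p - v, q) = 0` for all polynomials `q` of total degree `≤ l`, and the `L²(T)`-orthogonal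
projection of `p - v` on the polynomials of total degree `≤ 1` vanishes. -/
def IsEnergyProjection (A : Plane → Tensor4) (T : Set Plane) (l : ℕ) (v : Plane → ℝ)
    (p : MvPolynomial (Fin 2) ℝ) : Prop :=
  p.totalDegree ≤ l ∧
    (∀ q : MvPolynomial (Fin 2) ℝ, q.totalDegree ≤ l →
      energyForm A T (fun x => polyFun p x - v x) (polyFun q) = 0) ∧
    IsL2Projection T 1 (fun x => polyFun p x - v x) 0

end EnergyProj

end

/-! Every constant is controlled by the shape of the element `T`. The element is a finite union of
triangles of the submesh. Regularity makes each of them contain a disc of radius comparable to the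
diameter `d` of `T`, so each has area at least a fixed multiple of `d ^ 2`, and comparing areas
bounds their number. Two inequalities on `T` follow with constants depending on `ϱ` only, and are
recorded in `IsAdmissible`: the Poincaré inequality for functions of mean zero, and the scaled trace
inequality.

On one triangle, Poincaré comes from integrating differences over all pairs of points
(`IsSobolevOne.exists_const_lpNorm_le`). For traces, the field `w (x - a)` with `a` a vertex is
tangent to the two sides through `a`, so the divergence theorem sees the opposite edge only
(`IsSobolevOne.integral_radial`). The trace on that edge is therefore an explicit integral along
rays, bounded in `L²` by Cauchy–Schwarz, and the three vertices together give Green's formula.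
Across a common edge the traces from both sides agree, so summing over the triangles produces the
trace on the boundary of `T`. Moreover, constants approximating `w` on two neighbouring triangles
are both close to the mean of the trace over the common edge. Since `T` is connected, any two
triangles are linked by a chain of neighbours of bounded length, and Poincaré passes to `T`
(`IsTriangulated.exists_const_lpNorm_le`).

The rest uses only these two inequalities and a disc of comparable size inside `T`. Subtract from
`v` a polynomial `q` of degree less than `s` with the same mean derivatives up to order `s - 1`;
iterating Poincaré gives the optimal bounds for `v - q` (`IsAdmissible.exists_poly_approx`). If `p`
is the energy projection, Galerkin orthogonality makes the energy of `p - q` at most that of `v - q`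
(`IsAdmissible.energyProjection_stable`). Inverse estimates, scaled from two concentric discs, carry
this from order 2 to higher orders. For orders 0 and 1, orthogonality of `v - p` to the affine
functions reduces matters to order 2 (`IsAdmissible.sobolevSeminorm_le_of_orthogonal`). The boundary
estimates are the trace inequality applied to the derivatives of `v - p`. -/

noncomputable section

namespace EnergyProj

/-! ### Test functions and weak derivatives -/

/-- `φ` is a smooth function with compact support in `U`. -/
structure IsTest (U : Set Plane) (φ : Plane → ℝ) : Prop where
  contDiff : ContDiff ℝ ∞ φ
  hasCompactSupport : HasCompactSupport φ
  tsupport_subset : tsupport φ ⊆ U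

/-- The multi-index of `∂ᵢ`. -/
def unitIndex (i : Fin 2) : ℕ × ℕ := if i = 0 then (1, 0) else (0, 1)

@[simp] lemma unitIndex_zero : unitIndex 0 = (1, 0) := rfl

@[simp] lemma unitIndex_one : unitIndex 1 = (0, 1) := rfl

lemma unitIndex_order (i : Fin 2) : (unitIndex i).1 + (unitIndex i).2 = 1 := by
  fin_cases i <;> simp

lemma order_add_unitIndex (κ : ℕ × ℕ) (i : Fin 2) :
    (κ + unitIndex i).1 + (κ + unitIndex i).2 = κ.1 + κ.2 + 1 := by
  have := unitIndex_order i
  simp only [Prod.fst_add, Prod.snd_add]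
  omega

lemma contDiff_partialDeriv {φ : Plane → ℝ} (h : ContDiff ℝ ∞ φ) (i : Fin 2) :
    ContDiff ℝ ∞ (partialDeriv i φ) := by
  unfold partialDeriv
  exact (h.fderiv_right (m := ∞) le_rfl).clm_apply contDiff_const

lemma tsupport_partialDeriv_subset (φ : Plane → ℝ) (i : Fin 2) :
    tsupport (partialDeriv i φ) ⊆ tsupport φ :=
  tsupport_fderiv_apply_subset ℝ _

lemma IsTest.partialDeriv {U : Set Plane} {φ : Plane → ℝ} (h : IsTest U φ) (i : Fin 2) :
    IsTest U (partialDeriv i φ) :=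
  ⟨contDiff_partialDeriv h.contDiff i,
    h.hasCompactSupport.mono' ((subset_tsupport _).trans (tsupport_partialDeriv_subset φ i)),
    (tsupport_partialDeriv_subset φ i).trans h.tsupport_subset⟩

lemma IsTest.iterate {U : Set Plane} {φ : Plane → ℝ} (h : IsTest U φ) (i : Fin 2) (n : ℕ) :
    IsTest U ((EnergyProj.partialDeriv i)^[n] φ) := by
  induction n with
  | zero => exact h
  | succ n ih => rw [Function.iterate_succ_apply']; exact ih.partialDeriv i

lemma IsTest.multiDeriv {U : Set Plane} {φ : Plane → ℝ} (h : IsTest U φ) (κ : ℕ × ℕ) :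
    IsTest U (multiDeriv κ φ) :=
  (h.iterate 1 κ.2).iterate 0 κ.1

lemma IsTest.mono {U V : Set Plane} {φ : Plane → ℝ} (h : IsTest U φ) (hUV : U ⊆ V) :
    IsTest V φ :=
  ⟨h.contDiff, h.hasCompactSupport, h.tsupport_subset.trans hUV⟩

lemma partialDeriv_comm {φ : Plane → ℝ} (h : ContDiff ℝ ∞ φ) (i j : Fin 2) :
    partialDeriv i (partialDeriv j φ) = partialDeriv j (partialDeriv i φ) := by
  have hd : Differentiable ℝ (fderiv ℝ φ) :=
    (h.fderiv_right (m := ∞) le_rfl).differentiable (by simp)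
  have key (i j : Fin 2) (x : Plane) : partialDeriv i (partialDeriv j φ) x =
      fderiv ℝ (fderiv ℝ φ) x (EuclideanSpace.single i 1) (EuclideanSpace.single j 1) := by
    unfold partialDeriv
    rw [fderiv_clm_apply (hd x) (differentiableAt_const _)]
    simp
  ext x
  rw [key, key]
  exact (h.contDiffAt.isSymmSndFDerivAt (by
    rw [minSmoothness_of_isRCLikeNormedField]; exact WithTop.coe_le_coe.2 le_top)).eq _ _

lemma multiDeriv_partialDeriv {U : Set Plane} {φ : Plane → ℝ} (h : IsTest U φ) (κ : ℕ × ℕ)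
    (i : Fin 2) : multiDeriv κ (partialDeriv i φ) = multiDeriv (κ + unitIndex i) φ := by
  have comm (n : ℕ) : (partialDeriv 1)^[n] (partialDeriv 0 φ) =
      partialDeriv 0 ((partialDeriv 1)^[n] φ) := by
    induction n with
    | zero => rfl
    | succ n ih =>
      rw [Function.iterate_succ_apply', ih, Function.iterate_succ_apply',
        partialDeriv_comm (h.iterate 1 n).contDiff]
  fin_cases i
  · simp only [multiDeriv, Fin.zero_eta, unitIndex_zero, Prod.fst_add, Prod.snd_add, add_zero]
    rw [comm, Function.iterate_succ_apply]
  · simp only [multiDeriv, Fin.mk_one, unitIndex_one, Prod.fst_add, Prod.snd_add, add_zero]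
    rw [Function.iterate_succ_apply]

lemma multiDeriv_unitIndex (φ : Plane → ℝ) (i : Fin 2) :
    multiDeriv (unitIndex i) φ = partialDeriv i φ := by
  fin_cases i <;> rfl

lemma IsTest.integrableOn_mul {U : Set Plane} {φ v : Plane → ℝ} (h : IsTest U φ)
    (hv : LocallyIntegrableOn v U) : IntegrableOn (fun x => v x * φ x) U := by
  have hK : IntegrableOn v (tsupport φ) :=
    hv.integrableOn_compact_subset h.tsupport_subset h.hasCompactSupport
  have h1 : IntegrableOn (fun x => v x * φ x) (tsupport φ) :=
    hK.mul_continuousOn h.contDiff.continuous.continuousOn h.hasCompactSupport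
  refine IntegrableOn.mono_set (t := Set.univ) ?_ (Set.subset_univ _)
  rw [integrableOn_univ]
  refine (integrableOn_iff_integrable_of_support_subset ?_).1 h1
  intro x hx
  exact subset_tsupport _ (right_ne_zero_of_mul hx)

lemma locallyIntegrableOn_of_memLp {U : Set Plane} {v : Plane → ℝ}
    (hv : MemLp v 2 (volume.restrict U)) : LocallyIntegrableOn v U :=
  locallyIntegrableOn_of_locallyIntegrable_restrict (hv.locallyIntegrable (by norm_num))

lemma IsWeakDeriv.integral_eq {U : Set Plane} {κ : ℕ × ℕ} {v w φ : Plane → ℝ}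
    (h : IsWeakDeriv U κ v w) (hφ : IsTest U φ) :
    ∫ x in U, v x * EnergyProj.multiDeriv κ φ x = (-1) ^ (κ.1 + κ.2) * ∫ x in U, w x * φ x :=
  h.2.2 φ hφ.1 hφ.2 hφ.3

/-- The fundamental lemma of the calculus of variations. It makes the choice inside `weakDeriv`
harmless almost everywhere, and later lets identities between functions be proved by testing. -/
lemma ae_eq_of_forall_test {U : Set Plane} (hU : IsOpen U) {f g : Plane → ℝ}
    (hf : LocallyIntegrableOn f U) (hg : LocallyIntegrableOn g U)
    (h : ∀ φ, IsTest U φ → ∫ x in U, f x * φ x = ∫ x in U, g x * φ x) :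
    f =ᵐ[volume.restrict U] g := by
  have := hU.ae_eq_zero_of_integral_contDiff_smul_eq_zero (hf.sub hg) (μ := volume) ?_
  · rw [Filter.EventuallyEq, ae_restrict_iff' hU.measurableSet]
    filter_upwards [this] with x hx hxU
    simpa [sub_eq_zero] using hx hxU
  · intro φ h1 h2 h3
    have hφ : IsTest U φ := ⟨h1, h2, h3⟩
    have e : ∫ x, φ x • (f - g) x = ∫ x in U, φ x • (f - g) x := by
      refine (setIntegral_eq_integral_of_forall_compl_eq_zero fun x hx => ?_).symm
      rw [image_eq_zero_of_notMem_tsupport fun hx' => hx (h3 hx'), zero_smul]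
    rw [e]
    calc ∫ x in U, φ x • (f - g) x = ∫ x in U, (f x * φ x - g x * φ x) := by
          congr 1; ext x; simp only [Pi.sub_apply, smul_eq_mul]; ring
      _ = 0 := by
          rw [integral_sub (hφ.integrableOn_mul hf) (hφ.integrableOn_mul hg), h φ hφ, sub_self]

lemma IsWeakDeriv.ae_eq {U : Set Plane} (hU : IsOpen U) {κ : ℕ × ℕ} {v w w' : Plane → ℝ}
    (h : IsWeakDeriv U κ v w) (h' : IsWeakDeriv U κ v w') : w =ᵐ[volume.restrict U] w' := by
  refine ae_eq_of_forall_test hU h.2.1 h'.2.1 fun φ hφ => ?_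
  have := (h.integral_eq hφ).symm.trans (h'.integral_eq hφ)
  exact mul_left_cancel₀ (pow_ne_zero _ (by norm_num)) this

lemma IsWeakDeriv.sub {U : Set Plane} {κ : ℕ × ℕ} {v w v' w' : Plane → ℝ}
    (h : IsWeakDeriv U κ v w) (h' : IsWeakDeriv U κ v' w') :
    IsWeakDeriv U κ (fun x => v x - v' x) (fun x => w x - w' x) := by
  refine ⟨h.1.sub h'.1, h.2.1.sub h'.2.1, fun φ h1 h2 h3 => ?_⟩
  have hφ : IsTest U φ := ⟨h1, h2, h3⟩
  simp only [sub_mul]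
  rw [integral_sub ((hφ.multiDeriv κ).integrableOn_mul h.1)
      ((hφ.multiDeriv κ).integrableOn_mul h'.1),
    integral_sub (hφ.integrableOn_mul h.2.1) (hφ.integrableOn_mul h'.2.1), h.integral_eq hφ,
    h'.integral_eq hφ, mul_sub]

/-- Successive weak derivatives: if `w = ∂^κ v` and `z = ∂^(κ + eᵢ) v`, then `z = ∂ᵢ w`. -/
lemma IsWeakDeriv.partial {U : Set Plane} {κ : ℕ × ℕ} {i : Fin 2} {v w z : Plane → ℝ}
    (h : IsWeakDeriv U κ v w) (h' : IsWeakDeriv U (κ + unitIndex i) v z) :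
    IsWeakDeriv U (unitIndex i) w z := by
  refine ⟨h.2.1, h'.2.1, fun φ h1 h2 h3 => ?_⟩
  have hφ : IsTest U φ := ⟨h1, h2, h3⟩
  -- The relation for `w` is tested with `∂ᵢφ`, that for `z` with `φ`; the left-hand sides coincide
  -- and the common sign `(-1) ^ |κ|` cancels.
  have e1 := h.integral_eq (hφ.partialDeriv i)
  have e2 := h'.integral_eq hφ
  rw [← multiDeriv_partialDeriv hφ, e1] at e2
  rw [multiDeriv_unitIndex, unitIndex_order]
  rw [order_add_unitIndex, pow_add _ (κ.1 + κ.2) 1, mul_assoc] at e2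
  exact mul_left_cancel₀ (pow_ne_zero _ (by norm_num)) e2

lemma isWeakDeriv_weakDeriv {U : Set Plane} {κ : ℕ × ℕ} {v : Plane → ℝ}
    (h : ∃ w, IsWeakDeriv U κ v w) : IsWeakDeriv U κ v (weakDeriv U κ v) := by
  unfold weakDeriv
  rw [dif_pos h]
  exact h.choose_spec

lemma IsWeakDeriv.weakDeriv_ae_eq {U : Set Plane} (hU : IsOpen U) {κ : ℕ × ℕ} {v w : Plane → ℝ}
    (h : IsWeakDeriv U κ v w) : weakDeriv U κ v =ᵐ[volume.restrict U] w :=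
  (isWeakDeriv_weakDeriv ⟨w, h⟩).ae_eq hU h

lemma MemSobolev.isWeakDeriv {U : Set Plane} {s : ℕ} {v : Plane → ℝ} (h : MemSobolev U s v)
    {κ : ℕ × ℕ} (hκ : κ.1 + κ.2 ≤ s) : IsWeakDeriv U κ v (weakDeriv U κ v) :=
  isWeakDeriv_weakDeriv ((h.2 κ hκ).imp fun _ h => h.1)

lemma MemSobolev.memLp_weakDeriv {U : Set Plane} (hU : IsOpen U) {s : ℕ} {v : Plane → ℝ}
    (h : MemSobolev U s v) {κ : ℕ × ℕ} (hκ : κ.1 + κ.2 ≤ s) :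
    MemLp (weakDeriv U κ v) 2 (volume.restrict U) := by
  obtain ⟨w, hw, hw'⟩ := h.2 κ hκ
  exact hw'.ae_eq (hw.weakDeriv_ae_eq hU).symm

lemma isWeakDeriv_zero {U : Set Plane} {v : Plane → ℝ} (hv : LocallyIntegrableOn v U) :
    IsWeakDeriv U (0, 0) v v :=
  ⟨hv, hv, fun φ _ _ _ => by simp [EnergyProj.multiDeriv]⟩

lemma MemSobolev.mono {U : Set Plane} {s s' : ℕ} {v : Plane → ℝ} (h : MemSobolev U s v)
    (hs : s' ≤ s) : MemSobolev U s' v :=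
  ⟨h.1, fun κ hκ => h.2 κ (hκ.trans hs)⟩

lemma MemSobolev.isWeakDeriv_partial {U : Set Plane} {s : ℕ} {v : Plane → ℝ}
    (h : MemSobolev U s v) {κ : ℕ × ℕ} (hκ : κ.1 + κ.2 < s) (i : Fin 2) :
    IsWeakDeriv U (unitIndex i) (weakDeriv U κ v) (weakDeriv U (κ + unitIndex i) v) :=
  (h.isWeakDeriv hκ.le).partial (h.isWeakDeriv (by rw [order_add_unitIndex]; omega))

lemma MemSobolev.weakDeriv_memSobolev_one {U : Set Plane} (hU : IsOpen U) {s : ℕ}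
    {v : Plane → ℝ} (h : MemSobolev U s v) {κ : ℕ × ℕ} (hκ : κ.1 + κ.2 < s) :
    MemSobolev U 1 (weakDeriv U κ v) := by
  have h0 := h.memLp_weakDeriv hU hκ.le
  refine ⟨h0, fun μ hμ => ?_⟩
  have h3 (i : Fin 2) : ∃ w, IsWeakDeriv U (unitIndex i) (weakDeriv U κ v) w ∧
      MemLp w 2 (volume.restrict U) :=
    ⟨_, h.isWeakDeriv_partial hκ i, h.memLp_weakDeriv hU (by rw [order_add_unitIndex]; omega)⟩
  obtain ⟨a, b⟩ := μ
  simp only at hμ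
  rcases Nat.eq_zero_or_pos a with rfl | ha
  · rcases Nat.eq_zero_or_pos b with rfl | hb
    · exact ⟨_, isWeakDeriv_zero (locallyIntegrableOn_of_memLp h0), h0⟩
    · obtain rfl : b = 1 := by omega
      exact h3 1
  · obtain rfl : a = 1 := by omega
    obtain rfl : b = 0 := by omega
    exact h3 0

/-- `w ∈ H¹(U)`, with weak gradient `D`. -/
structure IsSobolevOne (U : Set Plane) (w : Plane → ℝ) (D : Fin 2 → Plane → ℝ) : Prop where
  memLp : MemLp w 2 (volume.restrict U)
  memLp_deriv : ∀ i, MemLp (D i) 2 (volume.restrict U)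
  integral_eq : ∀ i φ, IsTest U φ →
    ∫ x in U, w x * partialDeriv i φ x = - ∫ x in U, D i x * φ x

lemma MemSobolev.isSobolevOne {U : Set Plane} (hU : IsOpen U) {s : ℕ} {v : Plane → ℝ}
    (h : MemSobolev U s v) {κ : ℕ × ℕ} (hκ : κ.1 + κ.2 < s) :
    IsSobolevOne U (weakDeriv U κ v) (fun i => weakDeriv U (κ + unitIndex i) v) where
  memLp := h.memLp_weakDeriv hU hκ.le
  memLp_deriv i := h.memLp_weakDeriv hU (by rw [order_add_unitIndex]; omega)
  integral_eq i φ hφ := by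
    have := (h.isWeakDeriv_partial hκ i).integral_eq hφ
    rw [multiDeriv_unitIndex, unitIndex_order] at this
    rw [this, pow_one, neg_one_mul]

lemma MemSobolev.isSobolevOne_self {U : Set Plane} (hU : IsOpen U) {v : Plane → ℝ}
    (h : MemSobolev U 1 v) : IsSobolevOne U v (fun i => weakDeriv U (unitIndex i) v) where
  memLp := h.1
  memLp_deriv i := h.memLp_weakDeriv hU (unitIndex_order i).le
  integral_eq i φ hφ := by
    have := (h.isWeakDeriv (unitIndex_order i).le).integral_eq hφ
    rw [multiDeriv_unitIndex, unitIndex_order] at this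
    rw [this, pow_one, neg_one_mul]

lemma IsTest.setIntegral_eq {U V : Set Plane} {φ : Plane → ℝ} (hφ : IsTest V φ) (hVU : V ⊆ U)
    (f : Plane → ℝ) : ∫ x in U, f x * φ x = ∫ x in V, f x * φ x := by
  have h (W : Set Plane) (hW : V ⊆ W) : ∫ x in W, f x * φ x = ∫ x, f x * φ x := by
    refine setIntegral_eq_integral_of_forall_compl_eq_zero fun x hx => ?_
    rw [image_eq_zero_of_notMem_tsupport fun hx' => hx (hW (hφ.tsupport_subset hx')), mul_zero]
  rw [h U hVU, h V subset_rfl]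

lemma IsSobolevOne.mono {U V : Set Plane} {w : Plane → ℝ} {D : Fin 2 → Plane → ℝ}
    (h : IsSobolevOne U w D) (hVU : V ⊆ U) : IsSobolevOne V w D where
  memLp := h.memLp.mono_measure (Measure.restrict_mono hVU le_rfl)
  memLp_deriv i := (h.memLp_deriv i).mono_measure (Measure.restrict_mono hVU le_rfl)
  integral_eq i φ hφ := by
    have := h.integral_eq i φ (hφ.mono hVU)
    rwa [(hφ.partialDeriv i).setIntegral_eq hVU, hφ.setIntegral_eq hVU] at this

/-! ### Translation estimate and Poincaré inequality on convex sets -/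

lemma sq_lintegral_le {α : Type*} [MeasurableSpace α] {μ : Measure α} {f : α → ENNReal}
    (hf : AEMeasurable f μ) : (∫⁻ x, f x ∂μ) ^ 2 ≤ μ Set.univ * ∫⁻ x, f x ^ 2 ∂μ := by
  have h := ENNReal.lintegral_mul_le_Lp_mul_Lq μ Real.HolderConjugate.two_two hf
    (aemeasurable_const (b := 1))
  simp only [Pi.mul_apply, mul_one, ENNReal.rpow_two, one_pow, lintegral_one] at h
  calc (∫⁻ x, f x ∂μ) ^ 2 ≤
        ((∫⁻ x, f x ^ 2 ∂μ) ^ (1 / 2 : ℝ) * μ Set.univ ^ (1 / 2 : ℝ)) ^ 2 := by gcongr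
    _ = _ := by
      rw [mul_pow, ← ENNReal.rpow_two, ← ENNReal.rpow_two, ← ENNReal.rpow_mul,
        ← ENNReal.rpow_mul]
      norm_num [mul_comm]

lemma enorm_integral_sq_le {α : Type*} [MeasurableSpace α] {μ : Measure α} {f : α → ℝ}
    (hf : AEMeasurable f μ) : ‖∫ x, f x ∂μ‖ₑ ^ 2 ≤ μ Set.univ * ∫⁻ x, ‖f x‖ₑ ^ 2 ∂μ :=
  (pow_le_pow_left₀ (zero_le) (enorm_integral_le_lintegral_enorm f) 2).trans
    (sq_lintegral_le hf.enorm)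

/-- The average of `φ` over the segment from `x - c` to `x`. -/
def segAvg (c : Plane) (φ : Plane → ℝ) (x : Plane) : ℝ := ∫ t in Set.Icc (0 : ℝ) 1, φ (x - t • c)

/-- As a convolution with a finite measure carried by a segment, the average inherits the smoothness
of `φ`. -/
lemma segAvg_eq_convolution (c : Plane) {φ : Plane → ℝ} (hφ : Continuous φ) :
    segAvg c φ = convolution (fun _ => (1 : ℝ)) φ (ContinuousLinearMap.lsmul ℝ ℝ)
      ((volume.restrict (Set.Icc (0 : ℝ) 1)).map (fun t : ℝ => t • c)) := by
  ext x
  unfold segAvg convolution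
  rw [integral_map (by fun_prop) (by fun_prop)]
  simp

instance (c : Plane) : IsFiniteMeasure
    ((volume.restrict (Set.Icc (0 : ℝ) 1)).map (fun t : ℝ => t • c)) :=
  Measure.isFiniteMeasure_map _ _

lemma contDiff_segAvg (c : Plane) {φ : Plane → ℝ} (hφ : ContDiff ℝ ∞ φ)
    (hc : HasCompactSupport φ) : ContDiff ℝ ∞ (segAvg c φ) := by
  rw [segAvg_eq_convolution c hφ.continuous]
  exact hc.contDiff_convolution_right _ (locallyIntegrable_const _) hφ

/-- Moving the base point along `c` only shifts the window of integration, so the derivative is the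
difference of the end values. This turns a difference of translates of a test function into a
directional derivative of another test function, which can be moved onto `w`. -/
lemma fderiv_segAvg (c : Plane) {φ : Plane → ℝ} (hφ : ContDiff ℝ ∞ φ)
    (hc : HasCompactSupport φ) (x : Plane) :
    fderiv ℝ (segAvg c φ) x c = φ x - φ (x - c) := by
  have hψ : Continuous (fun u : ℝ => φ (x + u • c)) := by
    have := hφ.continuous
    fun_prop
  set P : ℝ → ℝ := fun s => ∫ u in (0 : ℝ)..s, φ (x + u • c) with hP
  have hPd (s : ℝ) : HasDerivAt P (φ (x + s • c)) s :=
    hψ.integral_hasStrictDerivAt 0 s |>.hasDerivAt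
  have hF : (fun s : ℝ => segAvg c φ (x + s • c)) = fun s => P s - P (s - 1) := by
    ext s
    have h1 := intervalIntegral.integral_comp_sub_left (a := 0) (b := 1)
      (fun u : ℝ => φ (x + u • c)) s
    rw [sub_zero] at h1
    rw [hP, intervalIntegral.integral_interval_sub_left (hψ.intervalIntegrable _ _)
      (hψ.intervalIntegrable _ _), ← h1, intervalIntegral.integral_of_le zero_le_one,
      ← integral_Icc_eq_integral_Ioc]
    unfold segAvg
    simp only [sub_smul, add_sub_assoc]
  have h1 : HasDerivAt (fun s : ℝ => P s - P (s - 1)) (φ x - φ (x - c)) 0 := by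
    have := (hPd 0).sub (HasDerivAt.comp_sub_const 0 1 (hPd (0 - 1)))
    rw [zero_sub, zero_smul, add_zero, neg_one_smul, ← sub_eq_add_neg] at this
    exact this
  have h2 : HasDerivAt (fun s : ℝ => segAvg c φ (x + s • c)) (fderiv ℝ (segAvg c φ) x c) 0 := by
    have hl : HasDerivAt (fun s : ℝ => x + s • c) c 0 := by
      simpa using ((hasDerivAt_id (0 : ℝ)).smul_const c).const_add x
    have hd := ((contDiff_segAvg c hφ hc).differentiable (by simp) (x + (0 : ℝ) • c)).hasFDerivAt
    have := hd.comp_hasDerivAt (0 : ℝ) hl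
    rw [zero_smul, add_zero] at this
    exact this
  rw [hF] at h2
  exact h2.unique h1

/-- The support lies in the union of the segments from `y` to `y + c` with `y` in the compact
support of `φ`. Both ends are in `U`, hence by convexity so is the whole segment. -/
lemma isTest_segAvg {U : Set Plane} (hU : Convex ℝ U) {c : Plane} {φ : Plane → ℝ}
    (hφ : IsTest (U ∩ (fun x => x + c) ⁻¹' U) φ) : IsTest U (segAvg c φ) := by
  have hK : IsCompact ((fun p : ℝ × Plane => p.2 + p.1 • c) '' (Set.Icc (0 : ℝ) 1 ×ˢ tsupport φ)) :=
    (isCompact_Icc.prod hφ.hasCompactSupport).image (by fun_prop)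
  have hsub : Function.support (segAvg c φ) ⊆
      (fun p : ℝ × Plane => p.2 + p.1 • c) '' (Set.Icc (0 : ℝ) 1 ×ˢ tsupport φ) := by
    intro x hx
    by_contra hx'
    refine hx ?_
    unfold segAvg
    rw [setIntegral_congr_fun measurableSet_Icc (g := fun _ => 0), integral_zero]
    intro t ht
    refine image_eq_zero_of_notMem_tsupport fun h => hx' ⟨(t, x - t • c), ⟨ht, h⟩, ?_⟩
    simp
  refine ⟨contDiff_segAvg c hφ.contDiff hφ.hasCompactSupport,
    HasCompactSupport.of_support_subset_isCompact hK hsub, ?_⟩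
  refine (closure_minimal hsub hK.isClosed).trans ?_
  rintro _ ⟨⟨t, x⟩, ⟨ht, hx⟩, rfl⟩
  have h := hφ.tsupport_subset hx
  have := hU.add_smul_sub_mem h.1 h.2 ht
  simpa using this

lemma sum_mul_partialDeriv (f : Plane → ℝ) (c x : Plane) :
    ∑ i, c i * partialDeriv i f x = fderiv ℝ f x c := by
  have hc : c = ∑ i, c i • EuclideanSpace.single i (1 : ℝ) := by
    ext j
    fin_cases j <;> simp
  conv_rhs => rw [hc]
  simp only [map_sum, map_smul, smul_eq_mul, partialDeriv]

lemma memLp_two_of_mul {U : Set Plane} {D : Fin 2 → Plane → ℝ}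
    (h : ∀ i, MemLp (D i) 2 (volume.restrict U)) (c : Plane) :
    MemLp (fun x => ∑ i, D i x * c i) 2 (volume.restrict U) := by
  refine memLp_finsetSum _ fun i _ => ?_
  exact (h i).mul_const _

/-- The fundamental theorem of calculus along a fixed direction for weak derivatives. -/
lemma IsSobolevOne.translate_sub_ae_eq {U : Set Plane} (hUo : IsOpen U) (hUc : Convex ℝ U)
    {w : Plane → ℝ} {D : Fin 2 → Plane → ℝ}
    (h : IsSobolevOne U w D) (c : Plane) {G : Plane → ℝ} (hG : Measurable G) (hGi : Integrable G)
    (hGU : G =ᵐ[volume] U.indicator (fun x => ∑ i, D i x * c i)) :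
    (fun x => w (x + c) - w x) =ᵐ[volume.restrict (U ∩ (fun x => x + c) ⁻¹' U)]
      fun x => ∫ t in Set.Icc (0 : ℝ) 1, G (x + t • c) := by
  set V := U ∩ (fun x => x + c) ⁻¹' U with hV
  have hVo : IsOpen V := hUo.inter (hUo.preimage (by fun_prop))
  have hmp : MeasurePreserving (fun x : Plane => x + c) volume volume :=
    measurePreserving_add_right volume c
  have hw1 : MemLp (fun x => w (x + c)) 2 (volume.restrict V) := by
    have := (h.memLp.comp_measurePreserving (hmp.restrict_preimage hUo.measurableSet))
    exact this.mono_measure (Measure.restrict_mono Set.inter_subset_right le_rfl)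
  have hw0 : MemLp w 2 (volume.restrict V) :=
    h.memLp.mono_measure (Measure.restrict_mono Set.inter_subset_left le_rfl)
  set ν : Measure ℝ := volume.restrict (Set.Icc (0 : ℝ) 1)
  -- All translates of `G` have the same `L¹` norm, so Fubini applies to the integrals along
  -- segments.
  have hGp : Integrable (fun p : Plane × ℝ => G (p.1 + p.2 • c)) (volume.prod ν) := by
    rw [integrable_prod_iff' (Measurable.aestronglyMeasurable (by fun_prop))]
    refine ⟨ae_of_all _ fun t => hGi.comp_add_right (t • c), ?_⟩
    have (t : ℝ) : ∫ x : Plane, ‖G (x + t • c)‖ = ∫ x, ‖G x‖ :=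
      integral_add_right_eq_self (fun x => ‖G x‖) (t • c)
    simp only [this]
    exact integrable_const (μ := ν) _
  have hZi : Integrable (fun x => ∫ t, G (x + t • c) ∂ν) := hGp.integral_prod_left
  refine ae_eq_of_forall_test hVo (locallyIntegrableOn_of_memLp (hw1.sub hw0))
    (hZi.locallyIntegrable.locallyIntegrableOn _) fun φ hφ => ?_
  have hΨ := isTest_segAvg hUc hφ
  obtain ⟨M, hM⟩ := hφ.hasCompactSupport.exists_bound_of_continuous hφ.contDiff.continuous
  -- the left-hand side
  have hφc : IsTest U (fun x => φ (x - c)) := by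
    have hts : tsupport (fun x => φ (x - c)) ⊆ (fun x => x - c) ⁻¹' tsupport φ :=
      tsupport_comp_subset_preimage φ (f := fun x => x - c) (by fun_prop)
    refine ⟨hφ.contDiff.comp (by fun_prop), ?_, ?_⟩
    · exact hφ.hasCompactSupport.comp_homeomorph (Homeomorph.subRight c)
    · intro x hx
      simpa using (hφ.tsupport_subset (hts hx)).2
  have hφU : IsTest U φ := hφ.mono Set.inter_subset_left
  have hwU := locallyIntegrableOn_of_memLp h.memLp
  have e1 : ∫ x in V, (w (x + c) - w x) * φ x =
      ∫ x in U, w x * (φ (x - c) - φ x) := by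
    simp only [sub_mul, mul_sub]
    rw [integral_sub (hφ.integrableOn_mul (locallyIntegrableOn_of_memLp hw1))
      (hφ.integrableOn_mul (locallyIntegrableOn_of_memLp hw0)),
      integral_sub (hφc.integrableOn_mul hwU) (hφU.integrableOn_mul hwU),
      hφ.setIntegral_eq (U := U) Set.inter_subset_left]
    congr 1
    rw [← (hmp.setIntegral_preimage_emb (Homeomorph.addRight c).measurableEmbedding
      (fun x => w x * φ (x - c)) U)]
    simp only [add_sub_cancel_right]
    exact (hφ.setIntegral_eq (U := (fun x => x + c) ⁻¹' U) Set.inter_subset_right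
      (fun x => w (x + c))).symm
  -- By `fderiv_segAvg` the difference of translates is minus the derivative of `segAvg c φ` in the
  -- direction `c`; the weak derivatives of `w` then take over.
  have e2 : ∫ x in U, w x * (φ (x - c) - φ x) =
      ∫ x in U, (∑ i, D i x * c i) * segAvg c φ x := by
    have : ∀ x, w x * (φ (x - c) - φ x) =
        - ∑ i, c i * (w x * partialDeriv i (segAvg c φ) x) := by
      intro x
      have := sum_mul_partialDeriv (segAvg c φ) c x
      rw [fderiv_segAvg c hφ.contDiff hφ.hasCompactSupport] at this
      rw [show φ (x - c) - φ x = -∑ i, c i * partialDeriv i (segAvg c φ) x by rw [this]; ring,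
        mul_neg, Finset.mul_sum]
      congr 1
      refine Finset.sum_congr rfl fun i _ => by ring
    simp only [this]
    rw [integral_neg, integral_finsetSum _ fun i _ =>
      ((hΨ.partialDeriv i).integrableOn_mul hwU).const_mul _]
    simp only [integral_const_mul, h.integral_eq _ _ hΨ, Finset.sum_mul]
    rw [integral_finsetSum]
    · rw [← Finset.sum_neg_distrib]
      refine Finset.sum_congr rfl fun i _ => ?_
      rw [mul_neg, neg_neg, ← integral_const_mul]
      congr 1; ext x; ring
    · intro i _
      have := (hΨ.integrableOn_mul (locallyIntegrableOn_of_memLp (h.memLp_deriv i))).const_mul (c i)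
      refine this.congr (ae_of_all _ fun x => by ring)
  have e3 : ∫ x in U, (∑ i, D i x * c i) * segAvg c φ x = ∫ x, G x * segAvg c φ x := by
    rw [← integral_indicator hUo.measurableSet]
    apply integral_congr_ae
    filter_upwards [hGU] with x hx
    rw [hx]
    by_cases hxU : x ∈ U <;> simp [hxU]
  -- Both this integral and that of `e5` are brought to the same iterated integral: Fubini here,
  -- Fubini and a translation by `t • c` there.
  have e4 : ∫ x, G x * segAvg c φ x =
      ∫ t, (∫ x : Plane, G x * φ (x - t • c)) ∂ν := by
    unfold segAvg
    simp only [← integral_const_mul]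
    rw [integral_integral_swap]
    refine Integrable.mul_bdd (c := M) (f := fun p : Plane × ℝ => G p.1) ?_ ?_ ?_
    · exact hGi.comp_fst _
    · exact (hφ.contDiff.continuous.comp (by fun_prop)).aestronglyMeasurable
    · exact ae_of_all _ fun p => hM _
  have e5 : ∫ x in V, (∫ t, G (x + t • c) ∂ν) * φ x =
      ∫ t, (∫ x : Plane, G x * φ (x - t • c)) ∂ν := by
    have : ∫ x in V, (∫ t, G (x + t • c) ∂ν) * φ x = ∫ x, (∫ t, G (x + t • c) ∂ν) * φ x := by
      have := (hφ.mono (Set.subset_univ V)).setIntegral_eq (U := Set.univ) subset_rfl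
        (fun x => ∫ t, G (x + t • c) ∂ν)
      rw [← hφ.setIntegral_eq (U := Set.univ) (Set.subset_univ V), setIntegral_univ]
    rw [this]
    simp only [← integral_mul_const]
    rw [integral_integral_swap]
    · congr 1; ext t
      rw [← integral_add_right_eq_self (fun x => G x * φ (x - t • c)) (t • c)]
      simp
    · refine Integrable.mul_bdd (c := M) (f := fun p : Plane × ℝ => G (p.1 + p.2 • c)) hGp ?_ ?_
      · exact (hφ.contDiff.continuous.comp (by fun_prop)).aestronglyMeasurable
      · exact ae_of_all _ fun p => hM _
  rw [e1, e2, e3, e4, e5]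

lemma IsSobolevOne.congr {U : Set Plane} {w w' : Plane → ℝ} {D : Fin 2 → Plane → ℝ}
    (h : IsSobolevOne U w D) (hw : w =ᵐ[volume.restrict U] w') : IsSobolevOne U w' D where
  memLp := h.memLp.ae_eq hw
  memLp_deriv := h.memLp_deriv
  integral_eq i φ hφ := by
    rw [← h.integral_eq i φ hφ]
    apply integral_congr_ae
    filter_upwards [hw] with x hx
    rw [hx]

lemma enorm_inner_sq_le (D c : Fin 2 → ℝ) :
    ‖∑ i, D i * c i‖ₑ ^ 2 ≤ (∑ i, ENNReal.ofReal (c i ^ 2)) * ∑ i, ‖D i‖ₑ ^ 2 := by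
  have h (a : ℝ) : ‖a‖ₑ ^ 2 = ENNReal.ofReal (a ^ 2) := by
    rw [Real.enorm_eq_ofReal_abs, ← ENNReal.ofReal_pow (abs_nonneg _), sq_abs]
  simp only [h]
  rw [← ENNReal.ofReal_sum_of_nonneg (fun _ _ => sq_nonneg _),
    ← ENNReal.ofReal_sum_of_nonneg (fun _ _ => sq_nonneg _), ← ENNReal.ofReal_mul (by positivity)]
  refine ENNReal.ofReal_le_ofReal ?_
  rw [mul_comm]
  exact Finset.sum_mul_sq_le_sq_mul_sq _ _ _

/-- The difference is an integral of `c · D` over a segment parametrised by the unit interval.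
Cauchy–Schwarz in `t`, Fubini and translation invariance remove the integration along the segment;
extending `c · D` by zero allows integrating over the whole plane. -/
lemma IsSobolevOne.lintegral_translate_sub_le {U : Set Plane} (hUo : IsOpen U)
    (hUc : Convex ℝ U) (hUb : Bornology.IsBounded U) {w : Plane → ℝ} {D : Fin 2 → Plane → ℝ}
    (h : IsSobolevOne U w D) (c : Plane) :
    ∫⁻ x in U ∩ (fun x => x + c) ⁻¹' U, ‖w (x + c) - w x‖ₑ ^ 2 ≤
      ENNReal.ofReal (‖c‖ ^ 2) * ∫⁻ x in U, ∑ i, ‖D i x‖ₑ ^ 2 := by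
  have : IsFiniteMeasure (volume.restrict U) := ⟨by
    rw [Measure.restrict_apply_univ]; exact hUb.measure_lt_top⟩
  have hL2 := memLp_two_of_mul h.memLp_deriv c
  have hI : Integrable (U.indicator (fun x => ∑ i, D i x * c i)) :=
    by
    rw [integrable_indicator_iff hUo.measurableSet]
    exact hL2.integrable (by norm_num)
  set G := hI.1.mk
  have hGm : Measurable G := hI.1.measurable_mk
  have hGU : G =ᵐ[volume] U.indicator (fun x => ∑ i, D i x * c i) := hI.1.ae_eq_mk.symm
  have key := h.translate_sub_ae_eq hUo hUc c hGm (hI.congr hGU.symm) hGU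
  calc _ = ∫⁻ x in U ∩ (fun x => x + c) ⁻¹' U,
        ‖∫ t in Set.Icc (0 : ℝ) 1, G (x + t • c)‖ₑ ^ 2 := by
        apply lintegral_congr_ae
        filter_upwards [key] with x hx
        rw [hx]
    _ ≤ ∫⁻ x, ‖∫ t in Set.Icc (0 : ℝ) 1, G (x + t • c)‖ₑ ^ 2 := setLIntegral_le_lintegral _ _
    _ ≤ ∫⁻ x, ∫⁻ t in Set.Icc (0 : ℝ) 1, ‖G (x + t • c)‖ₑ ^ 2 := by
        refine lintegral_mono fun x => ?_
        refine (enorm_integral_sq_le (Measurable.aemeasurable (by fun_prop))).trans ?_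
        simp
    _ = ∫⁻ t in Set.Icc (0 : ℝ) 1, ∫⁻ x, ‖G (x + t • c)‖ₑ ^ 2 := by
        rw [lintegral_lintegral_swap]
        exact Measurable.aemeasurable (by fun_prop)
    _ = ∫⁻ t in Set.Icc (0 : ℝ) 1, ∫⁻ x, ‖G x‖ₑ ^ 2 := by
        congr 1; ext t
        exact lintegral_add_right_eq_self (fun x => ‖G x‖ₑ ^ 2) (t • c)
    _ = ∫⁻ x, ‖G x‖ₑ ^ 2 := by simp
    _ = ∫⁻ x in U, ‖∑ i, D i x * c i‖ₑ ^ 2 := by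
        rw [← lintegral_indicator hUo.measurableSet]
        apply lintegral_congr_ae
        filter_upwards [hGU] with x hx
        rw [hx]
        by_cases hxU : x ∈ U <;> simp [hxU]
    _ ≤ ∫⁻ x in U, ENNReal.ofReal (‖c‖ ^ 2) * ∑ i, ‖D i x‖ₑ ^ 2 := by
        refine lintegral_mono fun x => (enorm_inner_sq_le (fun i => D i x) c).trans_eq ?_
        rw [EuclideanSpace.real_norm_sq_eq, ENNReal.ofReal_sum_of_nonneg fun _ _ => sq_nonneg _]
    _ = _ := lintegral_const_mul' _ _ ENNReal.ofReal_ne_top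

/-- The double integral of `|w x - w y| ^ 2` is bounded with the translation estimate. Some `y` has
an inner integral not exceeding the mean one, and its value `w y` serves as the constant. This
avoids any explicit dependence on the shape of `U`. -/
lemma IsSobolevOne.exists_const_lintegral_le {U : Set Plane} (hUo : IsOpen U)
    (hUc : Convex ℝ U) (hUn : U.Nonempty) {d : ℝ}
    (hUd : ∀ x ∈ U, ∀ y ∈ U, dist x y ≤ d) {w : Plane → ℝ} {D : Fin 2 → Plane → ℝ}
    (h : IsSobolevOne U w D) :
    ∃ k : ℝ, volume U * ∫⁻ x in U, ‖w x - k‖ₑ ^ 2 ≤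
      ENNReal.ofReal (d ^ 2) * volume (Metric.closedBall (0 : Plane) d) *
        ∫⁻ x in U, ∑ i, ‖D i x‖ₑ ^ 2 := by
  have hUb : Bornology.IsBounded U := Metric.isBounded_iff.2 ⟨d, fun x hx y hy => hUd x hx y hy⟩
  set W := h.memLp.1.mk
  have hWm : Measurable W := h.memLp.1.measurable_mk
  have hWw : w =ᵐ[volume.restrict U] W := h.memLp.1.ae_eq_mk
  have hW := h.congr hWw
  set M := ∫⁻ x in U, ∑ i, ‖D i x‖ₑ ^ 2
  have hd2 : ∫⁻ y in U, ∫⁻ x in U, ‖W x - W y‖ₑ ^ 2 ≤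
      ENNReal.ofReal (d ^ 2) * volume (Metric.closedBall (0 : Plane) d) * M := by
    have hm : Measurable (fun p : Plane × Plane => (U ∩ (fun x => x + p.2) ⁻¹' U).indicator
        (fun x => ‖W (x + p.2) - W x‖ₑ ^ 2) p.1) := by
      have : (fun p : Plane × Plane => (U ∩ (fun x => x + p.2) ⁻¹' U).indicator
        (fun x => ‖W (x + p.2) - W x‖ₑ ^ 2) p.1) =
        ((fun p : Plane × Plane => p.1) ⁻¹' U ∩ (fun p : Plane × Plane => p.1 + p.2) ⁻¹' U).indicator
          (fun p => ‖W (p.1 + p.2) - W p.1‖ₑ ^ 2) := by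
        ext p; rfl
      rw [this]
      refine Measurable.indicator (by fun_prop) ?_
      exact (measurable_fst hUo.measurableSet).inter
        ((by fun_prop : Measurable (fun p : Plane × Plane => p.1 + p.2)) hUo.measurableSet)
    -- Substituting `x = y + c` and exchanging the integrals leaves a translation estimate for each
    -- `c`; only `c` of norm at most `d` contribute.
    calc ∫⁻ y in U, ∫⁻ x in U, ‖W x - W y‖ₑ ^ 2
        = ∫⁻ y, ∫⁻ c, (U ∩ (fun x => x + c) ⁻¹' U).indicator
            (fun x => ‖W (x + c) - W x‖ₑ ^ 2) y := by
          rw [← lintegral_indicator hUo.measurableSet]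
          congr 1; ext y
          by_cases hy : y ∈ U
          · rw [Set.indicator_of_mem hy, ← lintegral_indicator hUo.measurableSet,
              ← lintegral_add_left_eq_self _ y]
            congr 1; ext c
            by_cases hc : y + c ∈ U <;> simp [hy, hc]
          · simp [hy]
      _ = ∫⁻ c, ∫⁻ y in U ∩ (fun x => x + c) ⁻¹' U, ‖W (y + c) - W y‖ₑ ^ 2 := by
          rw [lintegral_lintegral_swap hm.aemeasurable]
          congr 1; ext c
          rw [lintegral_indicator (hUo.inter (hUo.preimage (by fun_prop))).measurableSet]
      _ ≤ ∫⁻ c, (Metric.closedBall (0 : Plane) d).indicator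
            (fun _ => ENNReal.ofReal (d ^ 2) * M) c := by
          refine lintegral_mono fun c => ?_
          by_cases hc : c ∈ Metric.closedBall (0 : Plane) d
          · rw [Set.indicator_of_mem hc]
            refine (hW.lintegral_translate_sub_le hUo hUc hUb c).trans ?_
            rw [mem_closedBall_zero_iff] at hc
            gcongr
          · have : U ∩ (fun x => x + c) ⁻¹' U = ∅ := by
              rw [Set.eq_empty_iff_forall_notMem]
              rintro x ⟨h1, h2⟩
              refine hc ?_
              have := hUd _ h2 _ h1
              simpa [mem_closedBall_zero_iff] using this
            simp [this]
      _ = _ := by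
          rw [lintegral_indicator measurableSet_closedBall, lintegral_const,
            Measure.restrict_apply_univ]
          ring
  have hU0 : volume U ≠ 0 := (hUo.measure_pos volume hUn).ne'
  have hUt : volume U ≠ ⊤ := hUb.measure_lt_top.ne
  obtain ⟨y, hy, hle⟩ := exists_le_setLAverage (μ := volume) (s := U) hU0 hUt
    (f := fun y => ∫⁻ x in U, ‖W x - W y‖ₑ ^ 2)
    (Measurable.aemeasurable (Measurable.lintegral_prod_left' (f := fun p : Plane × Plane =>
      ‖W p.1 - W p.2‖ₑ ^ 2) (by fun_prop)))
  refine ⟨W y, le_trans ?_ hd2⟩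
  rw [setLAverage_eq, ENNReal.le_div_iff_mul_le (Or.inl hU0) (Or.inl hUt), mul_comm] at hle
  refine le_trans (le_of_eq ?_) hle
  congr 1
  apply lintegral_congr_ae
  filter_upwards [hWw] with x hx
  rw [hx]

/-! ### `L²` norms -/

lemma ofReal_lpNorm_sq {α : Type*} [MeasurableSpace α] {μ : Measure α} {f : α → ℝ}
    (hf : MemLp f 2 μ) : ENNReal.ofReal (lpNorm f 2 μ ^ 2) = ∫⁻ x, ‖f x‖ₑ ^ 2 ∂μ := by
  rw [ENNReal.ofReal_pow lpNorm_nonneg, ofReal_lpNorm hf,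
    eLpNorm_eq_lintegral_rpow_enorm_toReal (by norm_num) (by norm_num), ← ENNReal.rpow_two,
    ← ENNReal.rpow_mul]
  norm_num

lemma lpNorm_sq_eq_integral {α : Type*} [MeasurableSpace α] {μ : Measure α} {f : α → ℝ}
    (hf : MemLp f 2 μ) : lpNorm f 2 μ ^ 2 = ∫ x, f x ^ 2 ∂μ := by
  rw [integral_eq_lintegral_of_nonneg_ae (ae_of_all _ fun x => sq_nonneg _)
    hf.integrable_sq.aestronglyMeasurable]
  have (x : α) : ENNReal.ofReal (f x ^ 2) = ‖f x‖ₑ ^ 2 := by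
    rw [Real.enorm_eq_ofReal_abs, ← ENNReal.ofReal_pow (abs_nonneg _), sq_abs]
  simp only [this]
  rw [← ofReal_lpNorm_sq hf, ENNReal.toReal_ofReal (sq_nonneg _)]

lemma lpNorm_congr_ae {α : Type*} [MeasurableSpace α] {μ : Measure α} {f g : α → ℝ}
    (hfg : f =ᵐ[μ] g) : lpNorm f 2 μ = lpNorm g 2 μ := by
  unfold lpNorm
  rw [eLpNorm_congr_ae hfg]
  have h : AEStronglyMeasurable f μ ↔ AEStronglyMeasurable g μ := aestronglyMeasurable_congr hfg
  by_cases hg : AEStronglyMeasurable g μ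
  · rw [if_pos hg, if_pos (h.2 hg)]
  · rw [if_neg hg, if_neg (fun hf => hg (h.1 hf))]

lemma abs_integral_mul_le {α : Type*} [MeasurableSpace α] {μ : Measure α} {f g : α → ℝ}
    (hf : MemLp f 2 μ) (hg : MemLp g 2 μ) :
    |∫ x, f x * g x ∂μ| ≤ lpNorm f 2 μ * lpNorm g 2 μ := by
  have h1 : ‖∫ x, f x * g x ∂μ‖ₑ ≤ eLpNorm f 2 μ * eLpNorm g 2 μ := by
    refine (enorm_integral_le_lintegral_enorm _).trans ?_
    rw [← eLpNorm_one_eq_lintegral_enorm]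
    exact eLpNorm_smul_le_mul_eLpNorm (φ := f) hg.1 hf.1
  rw [← ofReal_lpNorm hf, ← ofReal_lpNorm hg, ← ENNReal.ofReal_mul lpNorm_nonneg,
    Real.enorm_eq_ofReal_abs] at h1
  exact (ENNReal.ofReal_le_ofReal_iff (mul_nonneg lpNorm_nonneg lpNorm_nonneg)).1 h1

lemma lpNorm_restrict_le {α : Type*} [MeasurableSpace α] {μ ν : Measure α} {f : α → ℝ}
    (hf : MemLp f 2 ν) (h : μ ≤ ν) : lpNorm f 2 μ ≤ lpNorm f 2 ν := by
  rw [← toReal_eLpNorm hf.1, ← toReal_eLpNorm (hf.1.mono_measure h)]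
  exact ENNReal.toReal_mono hf.2.ne (eLpNorm_mono_measure f h)

/-- The area of the unit disc. -/
def discArea : ℝ := volume.real (Metric.closedBall (0 : Plane) 1)

lemma discArea_pos : 0 < discArea :=
  ENNReal.toReal_pos (Metric.measure_closedBall_pos _ _ one_pos).ne'
    measure_closedBall_lt_top.ne

lemma volume_closedBall (c : Plane) {r : ℝ} (hr : 0 ≤ r) :
    volume (Metric.closedBall c r) = ENNReal.ofReal (r ^ 2 * discArea) := by
  rw [Measure.addHaar_closedBall' volume c hr, ENNReal.ofReal_mul (by positivity), discArea,
    ofReal_measureReal measure_closedBall_lt_top.ne]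
  simp

/-- The Poincaré inequality on convex sets, up to a constant function. -/
lemma IsSobolevOne.exists_const_lpNorm_le {U : Set Plane} (hUo : IsOpen U)
    (hUc : Convex ℝ U) (hUn : U.Nonempty) {d : ℝ} (hd : 0 ≤ d)
    (hUd : ∀ x ∈ U, ∀ y ∈ U, dist x y ≤ d) {w : Plane → ℝ} {D : Fin 2 → Plane → ℝ}
    (h : IsSobolevOne U w D) :
    ∃ k : ℝ, volume.real U * lpNorm (fun x => w x - k) 2 (volume.restrict U) ^ 2 ≤
      d ^ 4 * discArea * ∑ i, lpNorm (D i) 2 (volume.restrict U) ^ 2 := by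
  have hUb : Bornology.IsBounded U := Metric.isBounded_iff.2 ⟨d, fun x hx y hy => hUd x hx y hy⟩
  have : IsFiniteMeasure (volume.restrict U) := ⟨by
    rw [Measure.restrict_apply_univ]; exact hUb.measure_lt_top⟩
  obtain ⟨k, hk⟩ := h.exists_const_lintegral_le hUo hUc hUn hUd
  refine ⟨k, ?_⟩
  have e : ∫⁻ x in U, ∑ i, ‖D i x‖ₑ ^ 2 =
      ENNReal.ofReal (∑ i, lpNorm (D i) 2 (volume.restrict U) ^ 2) := by
    rw [lintegral_finsetSum' _ fun i _ => (h.memLp_deriv i).1.enorm.pow_const 2,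
      ENNReal.ofReal_sum_of_nonneg fun _ _ => sq_nonneg _]
    exact Finset.sum_congr rfl fun i _ => (ofReal_lpNorm_sq (h.memLp_deriv i)).symm
  have hwk : MemLp (fun x => w x - k) 2 (volume.restrict U) := h.memLp.sub (memLp_const k)
  rw [e, volume_closedBall _ hd, ← ofReal_lpNorm_sq hwk,
    ← ofReal_measureReal hUb.measure_lt_top.ne, ← ENNReal.ofReal_mul (by positivity),
    ← ENNReal.ofReal_mul (by positivity), ← ENNReal.ofReal_mul
      (by have := discArea_pos; positivity), ENNReal.ofReal_le_ofReal_iff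
      (by have := discArea_pos; positivity)] at hk
  refine hk.trans_eq ?_
  ring

/-! ### Radial coordinates on a triangle -/

/-- The planar cross product. -/
def cross (u v : Plane) : ℝ := u 0 * v 1 - u 1 * v 0

/-- Radial coordinates with respect to an apex `a` and the segment from `p` to `q`. -/
def radial (a p q : Plane) (t σ : ℝ) : Plane := a + t • (AffineMap.lineMap p q σ - a)

lemma continuous_radial (a p q : Plane) : Continuous (fun z : ℝ × ℝ => radial a p q z.1 z.2) := by
  unfold radial
  simp only [AffineMap.lineMap_apply_module]
  fun_prop

/-- The derivative of the radial coordinates, in the plane. -/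
def radialDeriv (a p q : Plane) (x : Plane) : Plane →L[ℝ] Plane :=
  (EuclideanSpace.proj 0 : Plane →L[ℝ] ℝ).smulRight (AffineMap.lineMap p q (x 1) - a) +
    (x 0 • (EuclideanSpace.proj 1 : Plane →L[ℝ] ℝ)).smulRight (q - p)

lemma hasFDerivAt_radial (a p q x : Plane) :
    HasFDerivAt (fun x : Plane => radial a p q (x 0) (x 1)) (radialDeriv a p q x) x := by
  have h0 : HasFDerivAt (fun x : Plane => x 0) (EuclideanSpace.proj 0 : Plane →L[ℝ] ℝ) x :=
    (EuclideanSpace.proj 0 : Plane →L[ℝ] ℝ).hasFDerivAt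
  have h1 : HasFDerivAt (fun x : Plane => x 1) (EuclideanSpace.proj 1 : Plane →L[ℝ] ℝ) x :=
    (EuclideanSpace.proj 1 : Plane →L[ℝ] ℝ).hasFDerivAt
  have h2 : HasFDerivAt (fun x : Plane => p + x 1 • (q - p) - a)
      ((EuclideanSpace.proj 1 : Plane →L[ℝ] ℝ).smulRight (q - p)) x :=
    ((h1.smul_const (q - p)).const_add p).sub_const a
  have h3 := (h0.smul h2).const_add a
  have e : (fun x : Plane => radial a p q (x 0) (x 1)) =
      fun x : Plane => a + x 0 • (p + x 1 • (q - p) - a) := by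
    ext1 x
    simp only [radial, AffineMap.lineMap_apply, vsub_eq_sub, vadd_eq_add, add_comm]
  rw [e]
  refine h3.congr_fderiv ?_
  ext z j
  simp [radialDeriv, AffineMap.lineMap_apply]
  ring

lemma det_radialDeriv (a p q x : Plane) :
    (radialDeriv a p q x).det = x 0 * cross (p - a) (q - p) := by
  rw [ContinuousLinearMap.det, ← LinearMap.det_toMatrix (EuclideanSpace.basisFun (Fin 2) ℝ).toBasis,
    Matrix.det_fin_two]
  simp [LinearMap.toMatrix_apply, radialDeriv, cross, AffineMap.lineMap_apply]
  ring

/-- The cross product of the image point, relative to `a`, with `q - p` determines `t`; then, `t`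
being nonzero, the cross product with `p - a` determines `σ`. -/
lemma injOn_radial {a p q : Plane} (hδ : cross (p - a) (q - p) ≠ 0) :
    Set.InjOn (fun x : Plane => radial a p q (x 0) (x 1)) {x | x 0 ∈ Set.Ioo (0 : ℝ) 1 ∧
      x 1 ∈ Set.Ioo (0 : ℝ) 1} := by
  rintro x ⟨hx0, hx1⟩ y ⟨hy0, hy1⟩ h
  have e (j : Fin 2) := congrArg (fun z : Plane => z j) h
  have e0 := e 0
  have e1 := e 1
  simp only [radial, AffineMap.lineMap_apply, vsub_eq_sub, vadd_eq_add, PiLp.add_apply,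
    PiLp.smul_apply, PiLp.sub_apply, smul_eq_mul] at e0 e1
  simp only [cross, PiLp.sub_apply] at hδ
  have h0 : (x 0 - y 0) * ((p 0 - a 0) * (q 1 - p 1) - (p 1 - a 1) * (q 0 - p 0)) = 0 := by
    linear_combination (q 1 - p 1) * e0 - (q 0 - p 0) * e1
  have h0' : x 0 = y 0 := by
    have := (mul_eq_zero.1 h0).resolve_right hδ
    linarith
  have h1 : x 0 * (x 1 - y 1) * ((p 0 - a 0) * (q 1 - p 1) - (p 1 - a 1) * (q 0 - p 0)) = 0 := by
    rw [← h0'] at e0 e1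
    linear_combination -(p 1 - a 1) * e0 + (p 0 - a 0) * e1
  have h1' : x 1 = y 1 := by
    have := (mul_eq_zero.1 ((mul_eq_zero.1 h1).resolve_right hδ)).resolve_left hx0.1.ne'
    linarith
  ext j
  fin_cases j
  · exact h0'
  · exact h1'

/-- The plane as a product. -/
def planeEquiv : Plane ≃ᵐ ℝ × ℝ :=
  (MeasurableEquiv.toLp 2 (Fin 2 → ℝ)).symm.trans MeasurableEquiv.finTwoArrow

lemma measurePreserving_planeEquiv : MeasurePreserving planeEquiv volume volume :=
  (volume_preserving_finTwoArrow ℝ).comp (PiLp.volume_preserving_ofLp (Fin 2))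

/-- The measure `t dt` on the unit interval. -/
def radialMeasure : Measure ℝ :=
  (volume.restrict (Set.Ioo (0 : ℝ) 1)).withDensity (fun t => ENNReal.ofReal t)

/-- The Lebesgue measure on the unit interval. -/
def unitMeasure : Measure ℝ := volume.restrict (Set.Ioo (0 : ℝ) 1)

lemma radialMeasure_univ : radialMeasure Set.univ = ENNReal.ofReal (1 / 2) := by
  unfold radialMeasure
  rw [withDensity_apply _ MeasurableSet.univ, Measure.restrict_univ,
    ← ofReal_integral_eq_lintegral_ofReal]
  · rw [← integral_Ioc_eq_integral_Ioo, ← intervalIntegral.integral_of_le zero_le_one]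
    simp
  · exact (continuous_id.integrableOn_Icc (a := (0 : ℝ)) (b := 1)).mono_set Set.Ioo_subset_Icc_self
  · filter_upwards [ae_restrict_mem measurableSet_Ioo] with t ht using ht.1.le

lemma unitMeasure_univ : unitMeasure Set.univ = 1 := by
  simp [unitMeasure]

instance : IsFiniteMeasure radialMeasure :=
  ⟨by rw [radialMeasure_univ]; exact ENNReal.ofReal_lt_top⟩

instance : IsProbabilityMeasure unitMeasure := ⟨unitMeasure_univ⟩

/-- Change of variables: the Jacobian is `t` times a constant cross product, and the factor `t` is
absorbed in `radialMeasure`. -/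
lemma restrict_image_radial {a p q : Plane} (hδ : cross (p - a) (q - p) ≠ 0) :
    volume.restrict ((fun x : Plane => radial a p q (x 0) (x 1)) ''
      {x | x 0 ∈ Set.Ioo (0 : ℝ) 1 ∧ x 1 ∈ Set.Ioo (0 : ℝ) 1}) =
    ENNReal.ofReal |cross (p - a) (q - p)| •
      (radialMeasure.prod unitMeasure).map (fun z => radial a p q z.1 z.2) := by
  have hr := (continuous_radial a p q).measurable
  refine Measure.ext_of_lintegral _ fun F hF => ?_
  have hFr : Measurable (fun z : ℝ × ℝ => F (radial a p q z.1 z.2)) := hF.comp hr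
  have hQ : MeasurableSet {x : Plane | x 0 ∈ Set.Ioo (0 : ℝ) 1 ∧ x 1 ∈ Set.Ioo (0 : ℝ) 1} :=
    planeEquiv.measurable (measurableSet_Ioo.prod measurableSet_Ioo)
  rw [lintegral_image_eq_lintegral_abs_det_fderiv_mul volume hQ
    (fun x _ => (hasFDerivAt_radial a p q x).hasFDerivWithinAt) (injOn_radial hδ)]
  simp only [det_radialDeriv]
  rw [lintegral_smul_measure, lintegral_map hF hr, lintegral_prod _ hFr.aemeasurable]
  have e := measurePreserving_planeEquiv.setLIntegral_comp_preimage_emb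
    planeEquiv.measurableEmbedding (fun z : ℝ × ℝ => ENNReal.ofReal |z.1 * cross (p - a) (q - p)| *
      F (radial a p q z.1 z.2)) (Set.Ioo 0 1 ×ˢ Set.Ioo 0 1)
  refine Eq.trans e ?_
  rw [Measure.volume_eq_prod, ← Measure.prod_restrict,
    lintegral_prod _ (Measurable.aemeasurable (by fun_prop))]
  unfold radialMeasure
  rw [lintegral_withDensity_eq_lintegral_mul _ (by fun_prop)
    (Measurable.lintegral_prod_right' hFr), smul_eq_mul,
    ← lintegral_const_mul _ (by
      refine Measurable.mul (by fun_prop) ?_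
      exact Measurable.lintegral_prod_right' (ν := unitMeasure) hFr)]
  refine setLIntegral_congr_fun measurableSet_Ioo fun t ht => ?_
  simp only [Pi.mul_apply]
  rw [lintegral_const_mul _ (by fun_prop), abs_mul, abs_of_pos ht.1,
    ENNReal.ofReal_mul ht.1.le, ← mul_assoc, mul_comm (ENNReal.ofReal |_|)]
  rfl

/-! ### Triangles -/

/-- Nondegenerate triangles, given by their vertices. -/
abbrev Tri : Type := AffineBasis (Fin 3) ℝ Plane

/-- The closed triangle. -/
def Tri.hull (b : Tri) : Set Plane := convexHull ℝ (Set.range b)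

/-- The area of a triangle. -/
def Tri.area (b : Tri) : ℝ := volume.real (interior b.hull)

lemma Tri.sum_eq (i : Fin 3) (f : Fin 3 → ℝ) : ∑ j, f j = f i + f (i + 1) + f (i + 2) := by
  fin_cases i <;> simp [Fin.sum_univ_three] <;> ring

lemma Tri.cases (i j : Fin 3) : j = i ∨ j = i + 1 ∨ j = i + 2 := by
  fin_cases i <;> fin_cases j <;> simp

lemma Tri.ne_add_one (i : Fin 3) : i ≠ i + 1 := by fin_cases i <;> simp

lemma Tri.ne_add_two (i : Fin 3) : i ≠ i + 2 := by fin_cases i <;> simp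

lemma Tri.add_one_ne_add_two (i : Fin 3) : i + 1 ≠ i + 2 := by fin_cases i <;> simp

lemma Tri.mem_hull {b : Tri} {x : Plane} : x ∈ b.hull ↔ ∀ i, 0 ≤ b.coord i x := by
  unfold Tri.hull
  rw [b.convexHull_eq_nonneg_coord]
  rfl

lemma Tri.mem_interior_hull {b : Tri} {x : Plane} : x ∈ interior b.hull ↔ ∀ i, 0 < b.coord i x := by
  unfold Tri.hull
  rw [AffineBasis.interior_convexHull b]
  rfl

lemma Tri.isCompact_hull (b : Tri) : IsCompact b.hull := (Set.finite_range b).isCompact_convexHull ℝ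

lemma Tri.convex_hull (b : Tri) : Convex ℝ b.hull := convex_convexHull ℝ _

lemma Tri.vertex_mem (b : Tri) (i : Fin 3) : b i ∈ b.hull := subset_convexHull ℝ _ ⟨i, rfl⟩

lemma Tri.interior_nonempty (b : Tri) : (interior b.hull).Nonempty :=
  ⟨_, b.centroid_mem_interior_convexHull⟩

lemma Tri.volume_hull_diff (b : Tri) : volume (b.hull \ interior b.hull) = 0 := by
  have := b.convex_hull.addHaar_frontier volume
  rwa [b.isCompact_hull.isClosed.frontier_eq] at this

lemma Tri.restrict_hull (b : Tri) : volume.restrict b.hull = volume.restrict (interior b.hull) := by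
  refine (Measure.restrict_congr_set ?_).symm
  rw [ae_eq_set]
  exact ⟨by rw [Set.sdiff_eq_empty.2 interior_subset, measure_empty], b.volume_hull_diff⟩

lemma Tri.volume_ne_top (b : Tri) : volume (interior b.hull) ≠ ⊤ :=
  (b.isCompact_hull.isBounded.subset interior_subset).measure_lt_top.ne

lemma Tri.area_pos (b : Tri) : 0 < b.area :=
  ENNReal.toReal_pos (isOpen_interior.measure_pos volume b.interior_nonempty).ne' b.volume_ne_top

instance (b : Tri) : IsFiniteMeasure (volume.restrict (interior b.hull)) :=
  ⟨by rw [Measure.restrict_apply_univ]; exact b.volume_ne_top.lt_top⟩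

lemma Tri.continuous_coord (b : Tri) (i : Fin 3) : Continuous (b.coord i) :=
  continuous_barycentric_coord b i

/-- The gradient of a barycentric coordinate. -/
def Tri.grad (b : Tri) (i : Fin 3) : Plane :=
  WithLp.toLp 2 fun k => (b.coord i).linear (EuclideanSpace.single k 1)

lemma Tri.coord_linear (b : Tri) (i : Fin 3) (v : Plane) :
    (b.coord i).linear v = ∑ k, b.grad i k * v k := by
  have hv : v = ∑ k, v k • EuclideanSpace.single k (1 : ℝ) := by
    ext j
    fin_cases j <;> simp
  conv_lhs => rw [hv]
  rw [map_sum]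
  refine Finset.sum_congr rfl fun k _ => ?_
  rw [map_smul, smul_eq_mul, mul_comm]
  rfl

lemma Tri.coord_sub (b : Tri) (i : Fin 3) (x y : Plane) :
    b.coord i x - b.coord i y = ∑ k, b.grad i k * (x k - y k) := by
  have h := (b.coord i).linearMap_vsub x y
  rw [vsub_eq_sub, vsub_eq_sub, b.coord_linear] at h
  rw [← h]
  simp

lemma Tri.coord_eq (b : Tri) (i : Fin 3) (x y : Plane) :
    b.coord i x = b.coord i y + ∑ k, b.grad i k * (x k - y k) := by
  rw [← b.coord_sub]; ring

lemma Tri.contDiff_coord (b : Tri) (i : Fin 3) : ContDiff ℝ ∞ (b.coord i) := by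
  have : (b.coord i : Plane → ℝ) =
      fun x => b.coord i 0 + ∑ k, b.grad i k * (x k - (0 : Plane) k) := by
    ext x; exact b.coord_eq i x 0
  rw [this]
  fun_prop

lemma Tri.hasFDerivAt_coord (b : Tri) (i : Fin 3) (x : Plane) :
    HasFDerivAt (b.coord i) (LinearMap.toContinuousLinearMap (b.coord i).linear) x := by
  have : (b.coord i : Plane → ℝ) = fun x => (LinearMap.toContinuousLinearMap (b.coord i).linear) x +
      b.coord i 0 := by
    ext x
    have := congrFun (b.coord i).decomp x
    simpa using this
  rw [this]
  exact (LinearMap.toContinuousLinearMap (b.coord i).linear).hasFDerivAt.add_const _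

lemma Tri.sum_grad (b : Tri) (k : Fin 2) : ∑ i, b.grad i k = 0 := by
  have h1 := b.sum_coord_apply_eq_one (EuclideanSpace.single k 1)
  have h0 := b.sum_coord_apply_eq_one 0
  have : ∑ i, (b.coord i (EuclideanSpace.single k 1) - b.coord i 0) = 0 := by
    rw [Finset.sum_sub_distrib, h1, h0, sub_self]
  rw [← this]
  refine Finset.sum_congr rfl fun i _ => ?_
  have h := (b.coord i).linearMap_vsub (EuclideanSpace.single k 1) 0
  simp only [vsub_eq_sub, sub_zero] at h
  rw [← h]
  rfl

/-- The derivative of the identity `∑ λᵢ(x) bᵢ = x`, with `λᵢ` the barycentric coordinates. Together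
with `Tri.sum_grad` it recombines the radial identities of the three vertices into Green's formula.
-/
lemma Tri.sum_grad_mul_vertex (b : Tri) (k k' : Fin 2) :
    ∑ i, b.grad i k * b i k' = if k = k' then 1 else 0 := by
  have h (x : Plane) : ∑ i, b.coord i x * b i k' = x k' := by
    conv_rhs => rw [← b.linear_combination_coord_eq_self x]
    simp only [WithLp.ofLp_sum, Finset.sum_apply, PiLp.smul_apply, smul_eq_mul]
  have h1 := h (EuclideanSpace.single k 1)
  have h0 := h 0
  have : ∑ i, (b.coord i (EuclideanSpace.single k 1) - b.coord i 0) * b i k' =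
      if k = k' then 1 else 0 := by
    simp only [sub_mul, Finset.sum_sub_distrib, h1, h0]
    simp [eq_comm]
  rw [← this]
  refine Finset.sum_congr rfl fun i _ => ?_
  have h := (b.coord i).linearMap_vsub (EuclideanSpace.single k 1) 0
  simp only [vsub_eq_sub, sub_zero] at h
  rw [← h]
  rfl

/-- The cross product of two sides of a triangle. -/
def Tri.crossAt (b : Tri) (i : Fin 3) : ℝ := cross (b (i + 1) - b i) (b (i + 2) - b (i + 1))

lemma Tri.grad_side (b : Tri) (i j k : Fin 3) :
    b.grad i 0 * (b j 0 - b k 0) + b.grad i 1 * (b j 1 - b k 1) =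
      (if i = j then 1 else 0) - (if i = k then 1 else 0) := by
  have := b.coord_sub i (b j) (b k)
  rw [b.coord_apply, b.coord_apply, Fin.sum_univ_two] at this
  exact this.symm

/-- The product of the cross product of two gradients with that of two sides is the determinant of
their pairings, which are known to be `-1, 0, 1, -1`; hence it equals 1. -/
lemma Tri.crossAt_ne_zero (b : Tri) (i : Fin 3) : b.crossAt i ≠ 0 := by
  intro h
  have h1 := b.grad_side i (i + 1) i
  have h2 := b.grad_side i (i + 2) (i + 1)
  have h3 := b.grad_side (i + 1) (i + 1) i
  have h4 := b.grad_side (i + 1) (i + 2) (i + 1)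
  simp only [Tri.ne_add_one, Tri.ne_add_two, Tri.add_one_ne_add_two, if_true, if_false,
    (Tri.ne_add_one i).symm] at h1 h2 h3 h4
  simp only [Tri.crossAt, cross, PiLp.sub_apply] at h
  have : (b.grad i 0 * b.grad (i + 1) 1 - b.grad i 1 * b.grad (i + 1) 0) *
      ((b (i + 1) 0 - b i 0) * (b (i + 2) 1 - b (i + 1) 1) -
        (b (i + 1) 1 - b i 1) * (b (i + 2) 0 - b (i + 1) 0)) = 1 := by
    linear_combination (b.grad (i + 1) 0 * (b (i + 2) 0 - b (i + 1) 0) +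
      b.grad (i + 1) 1 * (b (i + 2) 1 - b (i + 1) 1)) * h1 -
      (b.grad (i + 1) 0 * (b (i + 1) 0 - b i 0) +
      b.grad (i + 1) 1 * (b (i + 1) 1 - b i 1)) * h2 - h4
  rw [h, mul_zero] at this
  exact zero_ne_one this

/-- By Cramer's rule, the gradient multiplied by the cross product of the sides is the opposite side
turned by a right angle. -/
lemma Tri.dist_eq (b : Tri) (i : Fin 3) :
    dist (b (i + 1)) (b (i + 2)) = |b.crossAt i| * ‖b.grad i‖ := by
  have h1 := b.grad_side i (i + 1) i
  have h2 := b.grad_side i (i + 2) (i + 1)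
  simp only [Tri.ne_add_one, Tri.ne_add_two, if_true, if_false] at h1 h2
  rw [EuclideanSpace.dist_eq, EuclideanSpace.norm_eq, ← Real.sqrt_sq_eq_abs,
    ← Real.sqrt_mul (sq_nonneg _)]
  congr 1
  simp only [Fin.sum_univ_two, Real.dist_eq, Real.norm_eq_abs, sq_abs, Tri.crossAt, cross,
    PiLp.sub_apply]
  have e0 : b.grad i 0 * ((b (i + 1) 0 - b i 0) * (b (i + 2) 1 - b (i + 1) 1) -
        (b (i + 1) 1 - b i 1) * (b (i + 2) 0 - b (i + 1) 0)) = -(b (i + 2) 1 - b (i + 1) 1) := by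
    linear_combination (b (i + 2) 1 - b (i + 1) 1) * h1 - (b (i + 1) 1 - b i 1) * h2
  have e1 : b.grad i 1 * ((b (i + 1) 0 - b i 0) * (b (i + 2) 1 - b (i + 1) 1) -
        (b (i + 1) 1 - b i 1) * (b (i + 2) 0 - b (i + 1) 0)) = b (i + 2) 0 - b (i + 1) 0 := by
    linear_combination -(b (i + 2) 0 - b (i + 1) 0) * h1 + (b (i + 1) 0 - b i 0) * h2
  rw [mul_add, ← mul_pow, ← mul_pow, mul_comm _ (b.grad i 0), mul_comm _ (b.grad i 1), e0, e1]
  ring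

lemma Tri.grad_ne_zero (b : Tri) (i : Fin 3) : b.grad i ≠ 0 := by
  intro h
  have := b.grad_side i i (i + 1)
  simp [h] at this

/-- The point with parameter `σ` of the edge opposite to the vertex `i`. -/
def Tri.edgePt (b : Tri) (i : Fin 3) (σ : ℝ) : Plane := AffineMap.lineMap (b (i + 1)) (b (i + 2)) σ

/-- The radial coordinates with apex the vertex `i`. -/
def Tri.rad (b : Tri) (i : Fin 3) (z : ℝ × ℝ) : Plane :=
  radial (b i) (b (i + 1)) (b (i + 2)) z.1 z.2

lemma Tri.rad_eq (b : Tri) (i : Fin 3) (z : ℝ × ℝ) :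
    b.rad i z = b i + z.1 • (b.edgePt i z.2 - b i) := rfl

lemma Tri.rad_eq_lineMap (b : Tri) (i : Fin 3) (z : ℝ × ℝ) :
    b.rad i z = AffineMap.lineMap (b i) (b.edgePt i z.2) z.1 := by
  rw [Tri.rad_eq, AffineMap.lineMap_apply, vsub_eq_sub, vadd_eq_add, add_comm]

lemma Tri.continuous_rad (b : Tri) (i : Fin 3) : Continuous (b.rad i) := continuous_radial _ _ _

lemma Tri.continuous_edgePt (b : Tri) (i : Fin 3) : Continuous (b.edgePt i) := by
  unfold Tri.edgePt
  simp only [AffineMap.lineMap_apply_module]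
  fun_prop

lemma Tri.coord_edgePt (b : Tri) (i : Fin 3) (σ : ℝ) : b.coord i (b.edgePt i σ) = 0 := by
  rw [Tri.edgePt, AffineMap.apply_lineMap, b.coord_apply, b.coord_apply,
    if_neg (Tri.ne_add_one i), if_neg (Tri.ne_add_two i)]
  simp

lemma Tri.coord_edgePt_one (b : Tri) (i : Fin 3) (σ : ℝ) :
    b.coord (i + 1) (b.edgePt i σ) = 1 - σ := by
  rw [Tri.edgePt, AffineMap.apply_lineMap, b.coord_apply, b.coord_apply, if_pos rfl,
    if_neg (Tri.add_one_ne_add_two i), AffineMap.lineMap_apply]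
  simp; ring

lemma Tri.coord_edgePt_two (b : Tri) (i : Fin 3) (σ : ℝ) :
    b.coord (i + 2) (b.edgePt i σ) = σ := by
  rw [Tri.edgePt, AffineMap.apply_lineMap, b.coord_apply, b.coord_apply, if_pos rfl,
    if_neg (Tri.add_one_ne_add_two i).symm, AffineMap.lineMap_apply]
  simp

lemma Tri.coord_rad (b : Tri) (i : Fin 3) (z : ℝ × ℝ) : b.coord i (b.rad i z) = 1 - z.1 := by
  rw [Tri.rad_eq_lineMap, AffineMap.apply_lineMap, b.coord_edgePt, b.coord_apply, if_pos rfl,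
    AffineMap.lineMap_apply]
  simp; ring

lemma Tri.coord_rad_one (b : Tri) (i : Fin 3) (z : ℝ × ℝ) :
    b.coord (i + 1) (b.rad i z) = z.1 * (1 - z.2) := by
  rw [Tri.rad_eq_lineMap, AffineMap.apply_lineMap, b.coord_edgePt_one, b.coord_apply,
    if_neg (Tri.ne_add_one i).symm, AffineMap.lineMap_apply]
  simp

lemma Tri.coord_rad_two (b : Tri) (i : Fin 3) (z : ℝ × ℝ) :
    b.coord (i + 2) (b.rad i z) = z.1 * z.2 := by
  rw [Tri.rad_eq_lineMap, AffineMap.apply_lineMap, b.coord_edgePt_two, b.coord_apply,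
    if_neg (Tri.ne_add_two i).symm, AffineMap.lineMap_apply]
  simp

lemma Tri.ext_coord (b : Tri) (i : Fin 3) {x y : Plane} (h0 : b.coord i x = b.coord i y)
    (h1 : b.coord (i + 1) x = b.coord (i + 1) y) (h2 : b.coord (i + 2) x = b.coord (i + 2) y) :
    x = y := by
  refine b.ext_elem fun j => ?_
  rcases Tri.cases i j with rfl | rfl | rfl <;> assumption

lemma Tri.coord_sum (b : Tri) (i : Fin 3) (x : Plane) :
    b.coord i x + b.coord (i + 1) x + b.coord (i + 2) x = 1 := by
  rw [← Tri.sum_eq i (fun j => b.coord j x), b.sum_coord_apply_eq_one]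

lemma Tri.mem_interior_iff_exists (b : Tri) (i : Fin 3) {x : Plane} :
    x ∈ interior b.hull ↔ ∃ t ∈ Set.Ioo (0 : ℝ) 1, ∃ σ ∈ Set.Ioo (0 : ℝ) 1, b.rad i (t, σ) = x := by
  rw [Tri.mem_interior_hull]
  constructor
  · intro h
    have hs := b.coord_sum i x
    have h0 := h i
    have h1 := h (i + 1)
    have h2 := h (i + 2)
    have ht : 0 < 1 - b.coord i x := by linarith
    refine ⟨1 - b.coord i x, ⟨ht, by linarith⟩, b.coord (i + 2) x / (1 - b.coord i x),
      ⟨by positivity, (div_lt_one ht).2 (by linarith)⟩, ?_⟩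
    refine b.ext_coord i ?_ ?_ ?_
    · rw [b.coord_rad]; ring
    · rw [b.coord_rad_one]; field_simp; linarith
    · rw [b.coord_rad_two]; field_simp
  · rintro ⟨t, ht, σ, hσ, rfl⟩ j
    rcases Tri.cases i j with rfl | rfl | rfl
    · rw [b.coord_rad]; linarith [ht.2]
    · rw [b.coord_rad_one]; exact mul_pos ht.1 (by linarith [hσ.2])
    · rw [b.coord_rad_two]; exact mul_pos ht.1 hσ.1

lemma Tri.image_rad (b : Tri) (i : Fin 3) :
    (fun x : Plane => radial (b i) (b (i + 1)) (b (i + 2)) (x 0) (x 1)) ''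
      {x | x 0 ∈ Set.Ioo (0 : ℝ) 1 ∧ x 1 ∈ Set.Ioo (0 : ℝ) 1} = interior b.hull := by
  ext x
  rw [b.mem_interior_iff_exists i]
  constructor
  · rintro ⟨z, ⟨h0, h1⟩, rfl⟩
    exact ⟨_, h0, _, h1, rfl⟩
  · rintro ⟨t, ht, σ, hσ, rfl⟩
    exact ⟨!₂[t, σ], ⟨ht, hσ⟩, rfl⟩

/-- Total masses in the radial change of variables: `radialMeasure` has mass one half and
`unitMeasure` mass 1. -/
lemma Tri.abs_crossAt (b : Tri) (i : Fin 3) : |b.crossAt i| = 2 * b.area := by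
  have h := restrict_image_radial (b.crossAt_ne_zero i)
  rw [b.image_rad] at h
  have h1 := congrArg (fun μ : Measure Plane => (μ Set.univ).toReal) h
  simp only [Measure.restrict_apply_univ, Measure.smul_apply, smul_eq_mul] at h1
  rw [Measure.map_apply (continuous_radial _ _ _).measurable MeasurableSet.univ, Set.preimage_univ,
    ← Set.univ_prod_univ, Measure.prod_prod, radialMeasure_univ, unitMeasure_univ] at h1
  have h2 : b.area = |b.crossAt i| * (1 / 2) := by
    unfold Tri.area Measure.real
    rw [h1, ENNReal.toReal_mul, ENNReal.toReal_ofReal (abs_nonneg _), mul_one,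
      ENNReal.toReal_ofReal (by norm_num)]
    rfl
  rw [h2]; ring

lemma Tri.restrict_eq_map (b : Tri) (i : Fin 3) : volume.restrict (interior b.hull) =
    ENNReal.ofReal (2 * b.area) • (radialMeasure.prod unitMeasure).map (b.rad i) := by
  rw [← b.abs_crossAt i, ← b.image_rad i]
  exact restrict_image_radial (b.crossAt_ne_zero i)

lemma Tri.length_eq (b : Tri) (i : Fin 3) :
    dist (b (i + 1)) (b (i + 2)) = 2 * b.area * ‖b.grad i‖ := by
  rw [b.dist_eq, b.abs_crossAt]

/-! ### Traces on the edges of a triangle -/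

/-- The integral of `F` along the ray from `a` to `y`, in radial coordinates. -/
def rayIntegral (a : Plane) (F : Plane → ℝ) (y : Plane) : ℝ :=
  ∫ t, F (a + t • (y - a)) ∂radialMeasure

lemma rayIntegral_edgePt (b : Tri) (i : Fin 3) (F : Plane → ℝ) (σ : ℝ) :
    rayIntegral (b i) F (b.edgePt i σ) = ∫ t, F (b.rad i (t, σ)) ∂radialMeasure := rfl

lemma Tri.memLp_comp_rad (b : Tri) (i : Fin 3) {F : Plane → ℝ}
    (hF : MemLp F 2 (volume.restrict (interior b.hull))) :
    MemLp (fun z => F (b.rad i z)) 2 (radialMeasure.prod unitMeasure) := by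
  have h1 : (radialMeasure.prod unitMeasure).map (b.rad i) =
      (ENNReal.ofReal (2 * b.area))⁻¹ • volume.restrict (interior b.hull) := by
    rw [b.restrict_eq_map i, smul_smul, ENNReal.inv_mul_cancel, one_smul]
    · have := b.area_pos
      simp; positivity
    · exact ENNReal.ofReal_ne_top
  have h2 : MemLp F 2 ((radialMeasure.prod unitMeasure).map (b.rad i)) := by
    rw [h1]
    refine hF.smul_measure ?_
    have := b.area_pos
    simp; positivity
  exact h2.comp_measurePreserving ((b.continuous_rad i).measurable.measurePreserving _)

lemma Tri.setIntegral_eq (b : Tri) (i : Fin 3) {F : Plane → ℝ}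
    (hF : AEStronglyMeasurable F (volume.restrict (interior b.hull))) :
    ∫ x in interior b.hull, F x =
      2 * b.area * ∫ z, F (b.rad i z) ∂(radialMeasure.prod unitMeasure) := by
  have hF' : AEStronglyMeasurable F ((radialMeasure.prod unitMeasure).map (b.rad i)) := by
    rw [b.restrict_eq_map i] at hF
    refine hF.mono_ac (Measure.absolutelyContinuous_smul ?_)
    have := b.area_pos
    simp; positivity
  rw [b.restrict_eq_map i, integral_smul_measure,
    integral_map (b.continuous_rad i).aemeasurable hF',
    ENNReal.toReal_ofReal (by have := b.area_pos; positivity), smul_eq_mul]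

lemma Tri.setLIntegral_eq (b : Tri) (i : Fin 3) {F : Plane → ENNReal}
    (hF : AEMeasurable F (volume.restrict (interior b.hull))) :
    ∫⁻ x in interior b.hull, F x =
      ENNReal.ofReal (2 * b.area) * ∫⁻ z, F (b.rad i z) ∂(radialMeasure.prod unitMeasure) := by
  have hF' : AEMeasurable F ((radialMeasure.prod unitMeasure).map (b.rad i)) := by
    rw [b.restrict_eq_map i] at hF
    refine hF.mono_ac (Measure.absolutelyContinuous_smul ?_)
    have := b.area_pos
    simp; positivity
  rw [b.restrict_eq_map i, lintegral_smul_measure,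
    lintegral_map' hF' (b.continuous_rad i).aemeasurable, smul_eq_mul]

/-- Integration in radial coordinates against a function of the edge point. -/
lemma Tri.setIntegral_mul_eq (b : Tri) (i : Fin 3) {F ψ Φ : Plane → ℝ}
    (hF : MemLp F 2 (volume.restrict (interior b.hull))) (hΦ : Continuous Φ)
    (hψ : ContinuousOn ψ (interior b.hull))
    (h : ∀ t ∈ Set.Ioo (0 : ℝ) 1, ∀ σ ∈ Set.Ioo (0 : ℝ) 1, ψ (b.rad i (t, σ)) = Φ (b.edgePt i σ)) :
    ∫ x in interior b.hull, F x * ψ x = 2 * b.area *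
      ∫ σ, rayIntegral (b i) F (b.edgePt i σ) * Φ (b.edgePt i σ) ∂unitMeasure := by
  have hF1 : Integrable (fun z => F (b.rad i z)) (radialMeasure.prod unitMeasure) :=
    (b.memLp_comp_rad i hF).integrable (by norm_num)
  have hm : AEStronglyMeasurable (fun x => F x * ψ x) (volume.restrict (interior b.hull)) :=
    hF.1.mul (hψ.aestronglyMeasurable isOpen_interior.measurableSet)
  rw [b.setIntegral_eq i hm]
  congr 1
  have hE := b.continuous_edgePt i
  obtain ⟨M, hM⟩ : ∃ M, ∀ σ ∈ Set.Icc (0 : ℝ) 1, ‖Φ (b.edgePt i σ)‖ ≤ M :=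
    isCompact_Icc.exists_bound_of_continuousOn (by fun_prop)
  have hu : ∀ᵐ σ ∂unitMeasure, σ ∈ Set.Ioo (0 : ℝ) 1 := ae_restrict_mem measurableSet_Ioo
  have hr : ∀ᵐ t ∂radialMeasure, t ∈ Set.Ioo (0 : ℝ) 1 :=
    (withDensity_absolutelyContinuous _ _) (ae_restrict_mem measurableSet_Ioo)
  have hz1 : ∀ᵐ z ∂(radialMeasure.prod unitMeasure), z.1 ∈ Set.Ioo (0 : ℝ) 1 :=
    Measure.quasiMeasurePreserving_fst.ae hr
  have hz2 : ∀ᵐ z ∂(radialMeasure.prod unitMeasure), z.2 ∈ Set.Ioo (0 : ℝ) 1 :=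
    Measure.quasiMeasurePreserving_snd.ae hu
  calc ∫ z, F (b.rad i z) * ψ (b.rad i z) ∂(radialMeasure.prod unitMeasure)
      = ∫ z, F (b.rad i z) * Φ (b.edgePt i z.2) ∂(radialMeasure.prod unitMeasure) := by
        apply integral_congr_ae
        filter_upwards [hz1, hz2] with z h1 h2
        rw [h z.1 h1 z.2 h2]
    _ = _ := by
        rw [integral_prod_symm]
        · simp only [rayIntegral_edgePt, ← integral_mul_const]
        · refine hF1.mul_bdd (c := M) ?_ ?_
          · exact Continuous.aestronglyMeasurable (by fun_prop)
          · filter_upwards [hz2] with z hz using hM _ ⟨hz.1.le, hz.2.le⟩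

/-- Cauchy–Schwarz on each ray. The factor 4 is the Jacobian factor 2 divided by the mass one half
of `radialMeasure`. -/
lemma Tri.memLp_rayIntegral (b : Tri) (i : Fin 3) {F : Plane → ℝ}
    (hF : MemLp F 2 (volume.restrict (interior b.hull))) :
    MemLp (fun σ => rayIntegral (b i) F (b.edgePt i σ)) 2 unitMeasure ∧
      4 * b.area * lpNorm (fun σ => rayIntegral (b i) F (b.edgePt i σ)) 2 unitMeasure ^ 2 ≤
        lpNorm F 2 (volume.restrict (interior b.hull)) ^ 2 := by
  have hA := b.area_pos
  have hF2 := b.memLp_comp_rad i hF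
  have hF1 : Integrable (fun z => F (b.rad i z)) (radialMeasure.prod unitMeasure) :=
    hF2.integrable (by norm_num)
  have hm : AEStronglyMeasurable (fun σ => rayIntegral (b i) F (b.edgePt i σ)) unitMeasure :=
    hF1.integral_prod_right.aestronglyMeasurable
  have hae : ∀ᵐ σ ∂unitMeasure, AEMeasurable (fun t => F (b.rad i (t, σ))) radialMeasure := by
    filter_upwards [hF1.prod_left_ae] with σ hσ using hσ.1.aemeasurable
  have key : ∫⁻ σ, ‖rayIntegral (b i) F (b.edgePt i σ)‖ₑ ^ 2 ∂unitMeasure ≤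
      ENNReal.ofReal (1 / 2) * ∫⁻ z, ‖F (b.rad i z)‖ₑ ^ 2 ∂(radialMeasure.prod unitMeasure) := by
    rw [lintegral_prod_symm _ (hF1.1.enorm.pow_const 2),
      ← lintegral_const_mul' _ _ ENNReal.ofReal_ne_top]
    apply lintegral_mono_ae
    filter_upwards [hae] with σ hσ
    rw [rayIntegral_edgePt, ← radialMeasure_univ]
    exact enorm_integral_sq_le hσ
  have e : ENNReal.ofReal (2 * b.area) *
      ∫⁻ z, ‖F (b.rad i z)‖ₑ ^ 2 ∂(radialMeasure.prod unitMeasure) =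
      ENNReal.ofReal (lpNorm F 2 (volume.restrict (interior b.hull)) ^ 2) := by
    rw [ofReal_lpNorm_sq hF, b.setLIntegral_eq i (hF.1.enorm.pow_const 2)]
  have key2 : ENNReal.ofReal (4 * b.area) *
      ∫⁻ σ, ‖rayIntegral (b i) F (b.edgePt i σ)‖ₑ ^ 2 ∂unitMeasure ≤
      ENNReal.ofReal (lpNorm F 2 (volume.restrict (interior b.hull)) ^ 2) := by
    rw [← e]
    calc _ ≤ ENNReal.ofReal (4 * b.area) * (ENNReal.ofReal (1 / 2) *
        ∫⁻ z, ‖F (b.rad i z)‖ₑ ^ 2 ∂(radialMeasure.prod unitMeasure)) := by gcongr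
      _ = _ := by
        rw [← mul_assoc, ← ENNReal.ofReal_mul (by positivity)]
        congr 2; ring
  have hL : MemLp (fun σ => rayIntegral (b i) F (b.edgePt i σ)) 2 unitMeasure := by
    refine ⟨hm, ?_⟩
    rw [eLpNorm_lt_top_iff_lintegral_rpow_enorm_lt_top (by norm_num) (by norm_num)]
    simp only [ENNReal.toReal_ofNat, ENNReal.rpow_two]
    by_contra htop
    rw [not_lt, top_le_iff] at htop
    rw [htop, ENNReal.mul_top (by simp; positivity)] at key2
    exact absurd key2 (by simp)
  refine ⟨hL, ?_⟩
  rw [← ofReal_lpNorm_sq hL, ← ENNReal.ofReal_mul (by positivity)] at key2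
  exact (ENNReal.ofReal_le_ofReal_iff (sq_nonneg _)).1 key2

/-! ### Cutoff functions -/

/-- A smooth step from `0` (on `s ≤ 1`) to `1` (on `2 ≤ s`). -/
def cutoff (s : ℝ) : ℝ := Real.smoothTransition (s - 1)

lemma cutoff_of_le_one {s : ℝ} (h : s ≤ 1) : cutoff s = 0 :=
  Real.smoothTransition.zero_of_nonpos (by linarith)

lemma cutoff_of_two_le {s : ℝ} (h : 2 ≤ s) : cutoff s = 1 :=
  Real.smoothTransition.one_of_one_le (by linarith)

lemma contDiff_cutoff : ContDiff ℝ ∞ cutoff :=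
  Real.smoothTransition.contDiff.comp (contDiff_id.sub contDiff_const)

lemma abs_cutoff_le_one (s : ℝ) : |cutoff s| ≤ 1 := by
  rw [cutoff, abs_of_nonneg (Real.smoothTransition.nonneg _)]
  exact Real.smoothTransition.le_one _

lemma deriv_cutoff_of_lt_one {s : ℝ} (h : s < 1) : deriv cutoff s = 0 := by
  have : cutoff =ᶠ[nhds s] fun _ => 0 := by
    filter_upwards [Iio_mem_nhds h] with u hu using cutoff_of_le_one hu.le
  rw [this.deriv_eq, deriv_const]

lemma deriv_cutoff_of_two_lt {s : ℝ} (h : 2 < s) : deriv cutoff s = 0 := by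
  have : cutoff =ᶠ[nhds s] fun _ => 1 := by
    filter_upwards [Ioi_mem_nhds h] with u hu using cutoff_of_two_le (le_of_lt hu)
  rw [this.deriv_eq, deriv_const]

/-- With `s = n λ` it bounds `n λ χ'(n λ)` uniformly in `n`, where `χ` is the cutoff: the gradient
of the cutoff blows up like `n`, but only where `λ` is of order `1 / n`. -/
lemma exists_bound_deriv_cutoff : ∃ C : ℝ, 0 ≤ C ∧ ∀ s, |s * deriv cutoff s| ≤ C := by
  have hc : Continuous (deriv cutoff) := contDiff_cutoff.continuous_deriv (by simp)
  obtain ⟨C, hC⟩ := isCompact_Icc.exists_bound_of_continuousOn (s := Set.Icc (1 : ℝ) 2)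
    (f := fun s => s * deriv cutoff s) (by fun_prop)
  refine ⟨max C 0, le_max_right _ _, fun s => ?_⟩
  by_cases h1 : s < 1
  · rw [deriv_cutoff_of_lt_one h1, mul_zero, abs_zero]; exact le_max_right _ _
  by_cases h2 : 2 < s
  · rw [deriv_cutoff_of_two_lt h2, mul_zero, abs_zero]; exact le_max_right _ _
  · exact (hC s ⟨not_lt.1 h1, not_lt.1 h2⟩).trans (le_max_left _ _)

/-- A cutoff function supported in the interior of a triangle. -/
def Tri.cut (b : Tri) (n : ℝ) (x : Plane) : ℝ := ∏ j, cutoff (n * b.coord j x)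

lemma Tri.contDiff_cut (b : Tri) (n : ℝ) : ContDiff ℝ ∞ (b.cut n) := by
  unfold Tri.cut
  refine contDiff_prod fun j _ => ?_
  exact contDiff_cutoff.comp (contDiff_const.mul (b.contDiff_coord j))

lemma Tri.abs_cut_le_one (b : Tri) (n : ℝ) (x : Plane) : |b.cut n x| ≤ 1 := by
  unfold Tri.cut
  rw [Finset.abs_prod]
  exact Finset.prod_le_one (fun _ _ => abs_nonneg _) fun _ _ => abs_cutoff_le_one _

lemma Tri.tsupport_cut_subset (b : Tri) {n : ℝ} (hn : 0 < n) :
    tsupport (b.cut n) ⊆ {x | ∀ j, 1 / n ≤ b.coord j x} := by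
  have hcl : IsClosed {x | ∀ j, 1 / n ≤ b.coord j x} := by
    simp only [Set.ofPred_forall]
    exact isClosed_iInter fun j => isClosed_le continuous_const (b.continuous_coord j)
  refine closure_minimal (fun x hx j => ?_) hcl
  by_contra hj
  refine hx (Finset.prod_eq_zero (Finset.mem_univ j) (cutoff_of_le_one ?_))
  rw [not_le, lt_div_iff₀ hn] at hj
  linarith

lemma Tri.isTest_mul_cut (b : Tri) {n : ℝ} (hn : 0 < n) {ψ : Plane → ℝ}
    (hψ : ContDiffOn ℝ ∞ ψ (interior b.hull)) :
    IsTest (interior b.hull) (fun x => b.cut n x * ψ x) := by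
  have hsub : tsupport (fun x => b.cut n x * ψ x) ⊆ {x | ∀ j, 1 / n ≤ b.coord j x} := by
    refine (closure_mono ?_).trans (b.tsupport_cut_subset hn)
    intro x hx
    exact left_ne_zero_of_mul hx
  have hint : {x | ∀ j, 1 / n ≤ b.coord j x} ⊆ interior b.hull := fun x hx =>
    Tri.mem_interior_hull.2 fun j => lt_of_lt_of_le (by positivity) (hx j)
  refine ⟨contDiff_iff_contDiffAt.2 fun x => ?_, ?_, hsub.trans hint⟩
  · by_cases hx : x ∈ tsupport (fun x => b.cut n x * ψ x)
    swap
    · exact contDiffAt_const.congr_of_eventuallyEq (notMem_tsupport_iff_eventuallyEq.1 hx)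
    refine (b.contDiff_cut n).contDiffAt.mul ?_
    exact hψ.contDiffAt (isOpen_interior.mem_nhds (hint (hsub hx)))
  · exact b.isCompact_hull.of_isClosed_subset (isClosed_tsupport _)
      ((hsub.trans hint).trans interior_subset)

lemma Tri.hasFDerivAt_cut (b : Tri) (n : ℝ) (x : Plane) :
    HasFDerivAt (b.cut n) (∑ j, (∏ k ∈ Finset.univ.erase j, cutoff (n * b.coord k x)) •
      ((deriv cutoff (n * b.coord j x)) •
        (n • LinearMap.toContinuousLinearMap (b.coord j).linear))) x := by
  unfold Tri.cut
  refine HasFDerivAt.finsetProd (u := Finset.univ) fun j _ => ?_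
  have h1 := (b.hasFDerivAt_coord j x).const_mul n
  have h2 := (contDiff_cutoff.differentiable (by simp) (n * b.coord j x)).hasDerivAt
  have h3 := h2.comp_hasFDerivAt x h1
  exact h3

/-- In the radial direction the coordinates `j ≠ i` change at the rate `λⱼ`, which compensates the
factor `n` near the edge `j`. Only the edge opposite to `b i` is crossed transversally, so only
there must the function multiplied by the cutoff vanish. -/
lemma Tri.fderiv_cut_apply (b : Tri) (n : ℝ) (x : Plane) (i : Fin 3) :
    fderiv ℝ (b.cut n) x (x - b i) = ∑ j, (∏ k ∈ Finset.univ.erase j, cutoff (n * b.coord k x)) *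
      (deriv cutoff (n * b.coord j x) * (n * (b.coord j x - if j = i then 1 else 0))) := by
  rw [(b.hasFDerivAt_cut n x).fderiv]
  simp only [_root_.sum_apply, _root_.smul_apply, smul_eq_mul]
  refine Finset.sum_congr rfl fun j _ => ?_
  have h := (b.coord j).linearMap_vsub x (b i)
  rw [vsub_eq_sub, vsub_eq_sub, b.coord_apply] at h
  rw [← h]
  rfl

lemma lpNorm_const_mul {α : Type*} [MeasurableSpace α] {μ : Measure α} (c : ℝ) (f : α → ℝ) :
    lpNorm (fun x => c * f x) 2 μ = |c| * lpNorm f 2 μ := by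
  have h : lpNorm (c • f) 2 μ = |c| * lpNorm f 2 μ := by
    simpa using lpNorm_const_smul c f μ (p := 2)
  exact h

lemma lpNorm_fun_sum_le {α ι : Type*} [MeasurableSpace α] {μ : Measure α} {s : Finset ι}
    {f : ι → α → ℝ} (hf : ∀ i ∈ s, MemLp (f i) 2 μ) :
    lpNorm (fun x => ∑ i ∈ s, f i x) 2 μ ≤ ∑ i ∈ s, lpNorm (f i) 2 μ := by
  have h := lpNorm_sum_le hf (by norm_num)
  have e : (fun x => ∑ i ∈ s, f i x) = ∑ i ∈ s, f i := by ext x; simp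
  rwa [e]

/-! ### The radial divergence identity -/

/-- The divergence of `w (x - a)`, for a function `w` with weak gradient `D`. -/
def radialDiv (w : Plane → ℝ) (D : Fin 2 → Plane → ℝ) (a : Plane) (x : Plane) : ℝ :=
  2 * w x + ∑ k, D k x * (x k - a k)

lemma IsTest.fderiv_mul_coord {U : Set Plane} {f : Plane → ℝ} (hf : IsTest U f) (a : Plane)
    (k : Fin 2) : IsTest U (fun x => f x * (x k - a k)) ∧
      ∀ x, EnergyProj.partialDeriv k (fun x => f x * (x k - a k)) x =
        f x + (x k - a k) * EnergyProj.partialDeriv k f x := by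
  have hd (x : Plane) : HasFDerivAt (fun x : Plane => x k - a k)
      (EuclideanSpace.proj k : Plane →L[ℝ] ℝ) x :=
    (EuclideanSpace.proj k : Plane →L[ℝ] ℝ).hasFDerivAt.sub_const _
  refine ⟨⟨hf.contDiff.mul (by fun_prop), hf.hasCompactSupport.mul_right, ?_⟩, fun x => ?_⟩
  · exact (closure_mono fun x hx => left_ne_zero_of_mul hx).trans hf.tsupport_subset
  · have h := ((hf.contDiff.differentiable (by simp) x).hasFDerivAt.mul (hd x)).fderiv
    unfold EnergyProj.partialDeriv
    have h' : fderiv ℝ (fun x => f x * (x k - a k)) x = _ := h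
    rw [h']
    simp

/-- The definition of the weak derivatives tested with `f (x k - a k)` and summed over `k`; the term
`2 w` in `radialDiv` is the divergence of `x - a` in the plane. -/
lemma IsSobolevOne.integral_radial_test {U : Set Plane} {w : Plane → ℝ}
    {D : Fin 2 → Plane → ℝ} (h : IsSobolevOne U w D) {f : Plane → ℝ} (hf : IsTest U f)
    (a : Plane) : ∫ x in U, (radialDiv w D a x * f x + w x * fderiv ℝ f x (x - a)) = 0 := by
  have hw := locallyIntegrableOn_of_memLp h.memLp
  have hD (k : Fin 2) := locallyIntegrableOn_of_memLp (h.memLp_deriv k)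
  have e (x : Plane) : radialDiv w D a x * f x + w x * fderiv ℝ f x (x - a) =
      ∑ k, (w x * partialDeriv k (fun x => f x * (x k - a k)) x + D k x * (f x * (x k - a k))) := by
    rw [← sum_mul_partialDeriv]
    simp only [(hf.fderiv_mul_coord a _).2, radialDiv, Fin.sum_univ_two, PiLp.sub_apply]
    ring
  simp only [e]
  rw [integral_finsetSum]
  · refine Finset.sum_eq_zero fun k _ => ?_
    have ht := (hf.fderiv_mul_coord a k).1
    rw [integral_add ((ht.partialDeriv k).integrableOn_mul hw) (ht.integrableOn_mul (hD k)),
      h.integral_eq k _ ht]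
    ring
  · intro k _
    have ht := (hf.fderiv_mul_coord a k).1
    exact ((ht.partialDeriv k).integrableOn_mul hw).add (ht.integrableOn_mul (hD k))

lemma Tri.norm_sub_vertex_le (b : Tri) (i : Fin 3) {x : Plane} (hx : x ∈ b.hull) :
    ‖x - b i‖ ≤ Metric.diam b.hull := by
  rw [← dist_eq_norm]
  exact Metric.dist_le_diam_of_mem b.isCompact_hull.isBounded hx (b.vertex_mem i)

lemma Tri.abs_sub_vertex_le (b : Tri) (i : Fin 3) (k : Fin 2) {x : Plane} (hx : x ∈ b.hull) :
    |x k - b i k| ≤ Metric.diam b.hull :=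
  (PiLp.norm_apply_le (x - b i) k).trans (b.norm_sub_vertex_le i hx)

lemma memLp_of_bound_mul {U : Set Plane} (hU : MeasurableSet U) {f c : Plane → ℝ}
    (hf : MemLp f 2 (volume.restrict U)) (hc : Continuous c) {M : ℝ} (hM : ∀ x ∈ U, |c x| ≤ M) :
    MemLp (fun x => f x * c x) 2 (volume.restrict U) ∧
      lpNorm (fun x => f x * c x) 2 (volume.restrict U) ≤ M * lpNorm f 2 (volume.restrict U) := by
  have hb : ∀ᵐ x ∂(volume.restrict U), ‖f x * c x‖ ≤ M * ‖f x‖ := by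
    filter_upwards [ae_restrict_mem hU] with x hx
    rw [norm_mul, mul_comm]
    exact mul_le_mul_of_nonneg_right (hM x hx) (norm_nonneg _)
  have h1 : MemLp (fun x => f x * c x) 2 (volume.restrict U) :=
    hf.of_le_mul (hf.1.mul hc.aestronglyMeasurable) hb
  refine ⟨h1, ?_⟩
  rcases U.eq_empty_or_nonempty with rfl | ⟨x, hx⟩
  · simp
  have hM0 : 0 ≤ M := (abs_nonneg _).trans (hM x hx)
  have h2 := eLpNorm_le_mul_eLpNorm_of_ae_le_mul hb 2
  rw [← ofReal_lpNorm hf, ← ofReal_lpNorm h1, ← ENNReal.ofReal_mul hM0] at h2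
  exact (ENNReal.ofReal_le_ofReal_iff (mul_nonneg hM0 lpNorm_nonneg)).1 h2

lemma IsSobolevOne.memLp_radialDiv {b : Tri} {w : Plane → ℝ} {D : Fin 2 → Plane → ℝ}
    (h : IsSobolevOne (interior b.hull) w D) (i : Fin 3) :
    MemLp (radialDiv w D (b i)) 2 (volume.restrict (interior b.hull)) ∧
      lpNorm (radialDiv w D (b i)) 2 (volume.restrict (interior b.hull)) ≤
        2 * lpNorm w 2 (volume.restrict (interior b.hull)) + Metric.diam b.hull *
          ∑ k, lpNorm (D k) 2 (volume.restrict (interior b.hull)) := by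
  have h1 (k : Fin 2) := memLp_of_bound_mul isOpen_interior.measurableSet (h.memLp_deriv k)
    (c := fun x => x k - b i k) (by fun_prop)
    fun x hx => b.abs_sub_vertex_le i k (interior_subset hx)
  have h2 := memLp_finsetSum Finset.univ fun k _ => (h1 k).1
  have h0 : MemLp (fun x => 2 * w x) 2 (volume.restrict (interior b.hull)) := h.memLp.const_mul 2
  refine ⟨h0.add h2, (lpNorm_add_le h0 (by norm_num)).trans ?_⟩
  refine add_le_add (le_of_eq ?_) ?_
  · rw [lpNorm_const_mul, abs_of_pos two_pos]
  · refine (lpNorm_fun_sum_le fun k _ => (h1 k).1).trans ?_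
    rw [Finset.mul_sum]
    exact Finset.sum_le_sum fun k _ => (h1 k).2

/-- The radial projection from the vertex `i` to the opposite edge. -/
def Tri.proj (b : Tri) (i : Fin 3) (x : Plane) : Plane := b i + (1 - b.coord i x)⁻¹ • (x - b i)

lemma Tri.proj_rad (b : Tri) (i : Fin 3) {t : ℝ} (ht : 0 < t) (σ : ℝ) :
    b.proj i (b.rad i (t, σ)) = b.edgePt i σ := by
  unfold Tri.proj
  rw [b.coord_rad, b.rad_eq]
  simp only [sub_sub_cancel, add_sub_cancel_left, smul_smul]
  rw [inv_mul_cancel₀ ht.ne', one_smul, add_sub_cancel]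

lemma Tri.one_sub_coord_pos (b : Tri) (i : Fin 3) {x : Plane} (hx : x ∈ interior b.hull) :
    0 < 1 - b.coord i x := by
  have h := Tri.mem_interior_hull.1 hx
  have := b.coord_sum i x
  have := h (i + 1)
  have := h (i + 2)
  linarith

lemma Tri.contDiffOn_proj (b : Tri) (i : Fin 3) :
    ContDiffOn ℝ ∞ (b.proj i) (interior b.hull) := by
  unfold Tri.proj
  have h1 : ContDiffOn ℝ ∞ (fun x => (1 - b.coord i x)⁻¹) (interior b.hull) :=
    (contDiff_const.sub (b.contDiff_coord i)).contDiffOn.inv fun x hx =>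
      (b.one_sub_coord_pos i hx).ne'
  have h2 : ContDiffOn ℝ ∞ (fun x => x - b i) (interior b.hull) := by fun_prop
  exact contDiffOn_const.add (h1.smul h2)

lemma Tri.coord_lineMap_vertex (b : Tri) (i : Fin 3) (x : Plane) (s : ℝ) :
    b.coord i (b i + s • (x - b i)) = 1 + s * (b.coord i x - 1) := by
  have : b i + s • (x - b i) = AffineMap.lineMap (b i) x s := by
    rw [AffineMap.lineMap_apply, vsub_eq_sub, vadd_eq_add, add_comm]
  rw [this, AffineMap.apply_lineMap, b.coord_apply, if_pos rfl, AffineMap.lineMap_apply]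
  simp; ring

lemma Tri.proj_lineMap (b : Tri) (i : Fin 3) {x : Plane} {s : ℝ} (hs : 0 < s) :
    b.proj i (b i + s • (x - b i)) = b.proj i x := by
  unfold Tri.proj
  rw [b.coord_lineMap_vertex]
  congr 1
  rw [add_sub_cancel_left, smul_smul]
  congr 1
  rw [show 1 - (1 + s * (b.coord i x - 1)) = s * (1 - b.coord i x) by ring, mul_inv, mul_comm s⁻¹,
    mul_assoc, inv_mul_cancel₀ hs.ne', mul_one]

/-- Along each ray from the vertex the radial projection is constant. -/
lemma Tri.fderiv_proj_eq_zero (b : Tri) (i : Fin 3) {φ : Plane → ℝ} (hφ : ContDiff ℝ ∞ φ)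
    {x : Plane} (hx : x ∈ interior b.hull) :
    fderiv ℝ (fun y => φ (b.proj i y)) x (x - b i) = 0 := by
  have hd : DifferentiableAt ℝ (fun y => φ (b.proj i y)) x := by
    have h1 := ((b.contDiffOn_proj i).contDiffAt (isOpen_interior.mem_nhds hx)).differentiableAt
      (by simp)
    exact (hφ.differentiable (by simp) _).comp x h1
  have hl : HasDerivAt (fun s : ℝ => b i + s • (x - b i)) (x - b i) 1 := by
    simpa using ((hasDerivAt_id (1 : ℝ)).smul_const (x - b i)).const_add (b i)
  have e1 : b i + (1 : ℝ) • (x - b i) = x := by rw [one_smul, add_sub_cancel]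
  have h0 : HasFDerivAt (fun y => φ (b.proj i y))
      (fderiv ℝ (fun y => φ (b.proj i y)) x) (b i + (1 : ℝ) • (x - b i)) := by
    rw [e1]; exact hd.hasFDerivAt
  have h1 := h0.comp_hasDerivAt (1 : ℝ) hl
  have h2 : HasDerivAt (fun s : ℝ => φ (b.proj i (b i + s • (x - b i)))) 0 1 := by
    refine (hasDerivAt_const (1 : ℝ) (φ (b.proj i x))).congr_of_eventuallyEq ?_
    filter_upwards [Ioi_mem_nhds (zero_lt_one (α := ℝ))] with s hs
    rw [b.proj_lineMap i hs]
  exact h1.unique h2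

/-- A point and its projection are at a distance proportional to the barycentric coordinate `i`.
Hence the difference vanishes linearly on the opposite edge, as the cutoff argument requires. -/
lemma Tri.abs_sub_proj_le (b : Tri) (i : Fin 3) {φ : Plane → ℝ} {L : NNReal}
    (hφ : LipschitzWith L φ) {x : Plane} (hx : x ∈ interior b.hull) :
    |φ x - φ (b.proj i x)| ≤ L * Metric.diam b.hull * b.coord i x := by
  obtain ⟨t, ht, σ, hσ, rfl⟩ := (b.mem_interior_iff_exists i).1 hx
  rw [b.proj_rad i ht.1, b.coord_rad]
  have hE : b.edgePt i σ ∈ b.hull := by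
    refine Tri.mem_hull.2 fun j => ?_
    rcases Tri.cases i j with rfl | rfl | rfl
    · rw [b.coord_edgePt]
    · rw [b.coord_edgePt_one]; linarith [hσ.2]
    · rw [b.coord_edgePt_two]; exact hσ.1.le
  have h1 := hφ.dist_le_mul (b.rad i (t, σ)) (b.edgePt i σ)
  rw [Real.dist_eq] at h1
  refine h1.trans ?_
  have h2 : dist (b.rad i (t, σ)) (b.edgePt i σ) = (1 - t) * ‖b.edgePt i σ - b i‖ := by
    rw [b.rad_eq, dist_eq_norm, show b i + (t, σ).1 • (b.edgePt i (t, σ).2 - b i) - b.edgePt i σ =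
      (t - 1) • (b.edgePt i σ - b i) by module, norm_smul, Real.norm_eq_abs, abs_sub_comm,
      abs_of_pos (by linarith [ht.2])]
  rw [h2, mul_assoc]
  refine mul_le_mul_of_nonneg_left ?_ L.2
  rw [mul_comm]
  exact mul_le_mul_of_nonneg_right (b.norm_sub_vertex_le i hE) (by linarith [ht.2])

/-- A bound independent of `n`, needed as a majorant in dominated convergence. For `j ≠ i` the
radial derivative of the cutoff is bounded by itself and the bound `M` of `r` suffices; for `j = i`
the linear decay of `r` with slope `K` compensates. -/
lemma Tri.abs_fderiv_cut_mul_le (b : Tri) (i : Fin 3) {C : ℝ} (hC0 : 0 ≤ C)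
    (hC : ∀ s, |s * deriv cutoff s| ≤ C) {M K : ℝ} {n : ℝ} (hn : 0 ≤ n) {x : Plane}
    (hx : x ∈ interior b.hull) {r : ℝ} (hr : |r| ≤ M) (hr' : |r| ≤ K * b.coord i x) :
    |r * fderiv ℝ (b.cut n) x (x - b i)| ≤ 3 * (C * (M + K)) := by
  have hpos := Tri.mem_interior_hull.1 hx
  have hM : 0 ≤ M := (abs_nonneg _).trans hr
  have hK : 0 ≤ K := by
    by_contra h
    have := mul_neg_of_neg_of_pos (not_le.1 h) (hpos i)
    linarith [abs_nonneg r]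
  rw [b.fderiv_cut_apply, Finset.mul_sum]
  refine (Finset.abs_sum_le_sum_abs _ _).trans ?_
  have hj : ∀ j ∈ (Finset.univ : Finset (Fin 3)),
      |r * ((∏ k ∈ Finset.univ.erase j, cutoff (n * b.coord k x)) *
      (deriv cutoff (n * b.coord j x) * (n * (b.coord j x - if j = i then 1 else 0))))| ≤
        C * (M + K) := by
    intro j _
    have hP : |∏ k ∈ Finset.univ.erase j, cutoff (n * b.coord k x)| ≤ 1 := by
      rw [Finset.abs_prod]
      exact Finset.prod_le_one (fun _ _ => abs_nonneg _) fun _ _ => abs_cutoff_le_one _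
    set P := ∏ k ∈ Finset.univ.erase j, cutoff (n * b.coord k x)
    have hCj := hC (n * b.coord j x)
    set d := deriv cutoff (n * b.coord j x)
    have main : |r * (d * (n * (b.coord j x - if j = i then 1 else 0)))| ≤ C * (M + K) := by
      by_cases hji : j = i
      · subst hji
        rw [if_pos rfl]
        have h1 : |b.coord j x - 1| ≤ 1 := by
          have := b.one_sub_coord_pos j hx
          rw [abs_sub_comm, abs_of_pos this]
          linarith [hpos j]
        calc |r * (d * (n * (b.coord j x - 1)))| = |r| * (|d| * n) * |b.coord j x - 1| := by
              rw [abs_mul, abs_mul, abs_mul, abs_of_nonneg hn]; ring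
          _ ≤ (K * b.coord j x) * (|d| * n) * 1 := by
              have := hpos j
              gcongr
          _ = K * |n * b.coord j x * d| := by
              rw [abs_mul, abs_mul, abs_of_nonneg hn, abs_of_pos (hpos j)]; ring
          _ ≤ K * C := by gcongr
          _ ≤ C * (M + K) := by nlinarith
      · rw [if_neg hji, sub_zero, mul_comm d, abs_mul]
        calc _ ≤ M * C := by gcongr
          _ ≤ C * (M + K) := by nlinarith
    calc _ = |P| * |r * (d * (n * (b.coord j x - if j = i then 1 else 0)))| := by
          rw [← abs_mul]; congr 1; ring
      _ ≤ 1 * (C * (M + K)) := by gcongr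
      _ = _ := one_mul _
  refine (Finset.sum_le_sum hj).trans ?_
  simp

lemma Tri.eventually_cut_eq (b : Tri) {x : Plane} (hx : x ∈ interior b.hull) :
    ∀ᶠ n : ℕ in Filter.atTop, b.cut (n : ℝ) x = 1 ∧ ∀ i, fderiv ℝ (b.cut n) x (x - b i) = 0 := by
  have hpos := Tri.mem_interior_hull.1 hx
  have h (j : Fin 3) : ∀ᶠ n : ℕ in Filter.atTop, 2 < (n : ℝ) * b.coord j x :=
    (tendsto_natCast_atTop_atTop.atTop_mul_const (hpos j)).eventually_gt_atTop 2
  filter_upwards [Filter.eventually_all.2 h] with n hn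
  refine ⟨Finset.prod_eq_one fun j _ => cutoff_of_two_le (hn j).le, fun i => ?_⟩
  rw [b.fderiv_cut_apply]
  refine Finset.sum_eq_zero fun j _ => ?_
  rw [deriv_cutoff_of_two_lt (hn j), zero_mul, mul_zero]

/-- The divergence theorem on a triangle for `φ w (x - a)`, with `a` a vertex: only the edge
opposite to `a` contributes. -/
lemma IsSobolevOne.integral_radial {b : Tri} {w : Plane → ℝ} {D : Fin 2 → Plane → ℝ}
    (h : IsSobolevOne (interior b.hull) w D) (i : Fin 3) {φ : Plane → ℝ}
    (hφ : IsTest Set.univ φ) :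
    ∫ x in interior b.hull, (radialDiv w D (b i) x * φ x + w x * fderiv ℝ φ x (x - b i)) =
      2 * b.area * ∫ σ, rayIntegral (b i) (radialDiv w D (b i)) (b.edgePt i σ) *
        φ (b.edgePt i σ) ∂unitMeasure := by
  have hm : MeasurableSet (interior b.hull) := isOpen_interior.measurableSet
  have hF := (h.memLp_radialDiv i).1
  have hproj : ContDiffOn ℝ ∞ (fun x => φ (b.proj i x)) (interior b.hull) :=
    hφ.contDiff.comp_contDiffOn (b.contDiffOn_proj i)
  rw [← b.setIntegral_mul_eq i hF hφ.contDiff.continuous hproj.continuousOn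
    (fun t ht σ _ => by rw [b.proj_rad i ht.1])]
  obtain ⟨M, hM⟩ := hφ.hasCompactSupport.exists_bound_of_continuous hφ.contDiff.continuous
  obtain ⟨L, hL⟩ := hφ.contDiff.lipschitzWith_of_hasCompactSupport hφ.hasCompactSupport (by simp)
  obtain ⟨C, hC0, hC⟩ := exists_bound_deriv_cutoff
  -- The extension of the edge values of `φ` along rays is subtracted. The remainder vanishes on the
  -- opposite edge, so it can be cut off at a bounded cost, while the subtracted part has no radial
  -- derivative and yields exactly the edge integral.
  set ψ : Plane → ℝ := fun x => φ x - φ (b.proj i x) with hψ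
  have hψs : ContDiffOn ℝ ∞ ψ (interior b.hull) := hφ.contDiff.contDiffOn.sub hproj
  have hψM (x : Plane) : |ψ x| ≤ 2 * M := by
    have h1 := hM x
    have h2 := hM (b.proj i x)
    have := abs_sub (φ x) (φ (b.proj i x))
    simp only [Real.norm_eq_abs] at h1 h2
    linarith
  have hfd (x : Plane) : |fderiv ℝ φ x (x - b i)| ≤ L * ‖x - b i‖ :=
    ((fderiv ℝ φ x).le_opNorm _).trans
      (mul_le_mul_of_nonneg_right (norm_fderiv_le_of_lipschitz ℝ hL) (norm_nonneg _))
  have hfd' : ∀ x ∈ interior b.hull, |fderiv ℝ φ x (x - b i)| ≤ L * Metric.diam b.hull :=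
    fun x hx => (hfd x).trans (mul_le_mul_of_nonneg_left
      (b.norm_sub_vertex_le i (interior_subset hx)) L.2)
  have hcf : Continuous (fun x => fderiv ℝ φ x (x - b i)) :=
    (hφ.contDiff.continuous_fderiv (by simp)).clm_apply (by fun_prop)
  -- integrability
  have i1 : Integrable (fun x => radialDiv w D (b i) x * φ x) (volume.restrict (interior b.hull)) :=
    ((memLp_of_bound_mul hm hF hφ.contDiff.continuous fun x _ => hM x).1).integrable (by norm_num)
  have i2 : Integrable (fun x => w x * fderiv ℝ φ x (x - b i))
      (volume.restrict (interior b.hull)) :=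
    ((memLp_of_bound_mul hm h.memLp hcf hfd').1).integrable (by norm_num)
  have i3 : Integrable (fun x => radialDiv w D (b i) x * φ (b.proj i x))
      (volume.restrict (interior b.hull)) := by
    refine Integrable.mul_bdd (c := M) (hF.integrable (by norm_num)) ?_ ?_
    · exact hproj.continuousOn.aestronglyMeasurable hm
    · exact ae_of_all _ fun x => hM _
  have i12 : Integrable (fun x => radialDiv w D (b i) x * φ x + w x * fderiv ℝ φ x (x - b i))
      (volume.restrict (interior b.hull)) := i1.add i2
  rw [← sub_eq_zero, ← integral_sub i12 i3]
  -- test functions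
  set f : ℕ → Plane → ℝ := fun n x => b.cut n x * ψ x with hf
  have hft (n : ℕ) (hn : 0 < n) : IsTest (interior b.hull) (f n) :=
    b.isTest_mul_cut (by exact_mod_cast hn) hψs
  have hfderiv (n : ℕ) {x : Plane} (hx : x ∈ interior b.hull) : fderiv ℝ (f n) x (x - b i) =
      b.cut n x * fderiv ℝ φ x (x - b i) + ψ x * fderiv ℝ (b.cut n) x (x - b i) := by
    have d1 : DifferentiableAt ℝ (b.cut n) x := (b.contDiff_cut n).differentiable (by simp) x
    have d2 : DifferentiableAt ℝ φ x := hφ.contDiff.differentiable (by simp) x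
    have d3 : DifferentiableAt ℝ (fun y => φ (b.proj i y)) x :=
      (hproj.contDiffAt (isOpen_interior.mem_nhds hx)).differentiableAt (by simp)
    have e1 : fderiv ℝ (f n) x = b.cut n x • fderiv ℝ ψ x + ψ x • fderiv ℝ (b.cut n) x :=
      (d1.hasFDerivAt.mul (d2.sub d3).hasFDerivAt).fderiv
    have e2 : fderiv ℝ ψ x = fderiv ℝ φ x - fderiv ℝ (fun y => φ (b.proj i y)) x :=
      (d2.hasFDerivAt.sub d3.hasFDerivAt).fderiv
    rw [e1, e2]
    simp [b.fderiv_proj_eq_zero i hφ.contDiff hx]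
  -- For `n > 0` these integrals vanish, since `f n` is a test function. Their limit by dominated
  -- convergence is the required difference, which is therefore zero.
  have key : Filter.Tendsto (fun n : ℕ => ∫ x in interior b.hull,
      (radialDiv w D (b i) x * f n x + w x * fderiv ℝ (f n) x (x - b i))) Filter.atTop
      (nhds (∫ x in interior b.hull, (radialDiv w D (b i) x * φ x + w x * fderiv ℝ φ x (x - b i) -
        radialDiv w D (b i) x * φ (b.proj i x)))) := by
    refine tendsto_integral_filter_of_dominated_convergence
      (fun x => 2 * M * |radialDiv w D (b i) x| + (L * Metric.diam b.hull +
        3 * (C * (2 * M + L * Metric.diam b.hull))) * |w x|) ?_ ?_ ?_ ?_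
    · filter_upwards [Filter.eventually_gt_atTop 0] with n hn
      have h1 := (hft n hn).contDiff
      refine (hF.1.mul h1.continuous.aestronglyMeasurable).add (h.memLp.1.mul ?_)
      exact ((h1.continuous_fderiv (by simp)).clm_apply (by fun_prop)).aestronglyMeasurable
    · refine Filter.Eventually.of_forall fun n => ?_
      filter_upwards [ae_restrict_mem hm] with x hx
      have hc := b.abs_cut_le_one n x
      have h1 : |f n x| ≤ 2 * M := by
        rw [hf, abs_mul]
        exact (mul_le_mul hc (hψM x) (abs_nonneg _) zero_le_one).trans_eq (one_mul _)
      have h2 : |fderiv ℝ (f n) x (x - b i)| ≤ L * Metric.diam b.hull +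
          3 * (C * (2 * M + L * Metric.diam b.hull)) := by
        rw [hfderiv n hx]
        refine (abs_add_le _ _).trans (add_le_add ?_ ?_)
        · rw [abs_mul]
          exact (mul_le_mul hc (hfd' x hx) (abs_nonneg _) zero_le_one).trans_eq (one_mul _)
        · exact b.abs_fderiv_cut_mul_le i hC0 hC n.cast_nonneg hx (hψM x)
            (b.abs_sub_proj_le i hL hx)
      rw [Real.norm_eq_abs]
      refine (abs_add_le _ _).trans ?_
      rw [abs_mul (radialDiv w D (b i) x), abs_mul (w x)]
      exact add_le_add
        ((mul_comm _ _).trans_le (mul_le_mul_of_nonneg_right h1 (abs_nonneg _)))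
        ((mul_comm _ _).trans_le (mul_le_mul_of_nonneg_right h2 (abs_nonneg _)))
    · exact ((hF.integrable (by norm_num)).abs.const_mul _).add
        ((h.memLp.integrable (by norm_num)).abs.const_mul _)
    · filter_upwards [ae_restrict_mem hm] with x hx
      refine tendsto_const_nhds.congr' ?_
      filter_upwards [b.eventually_cut_eq hx] with n hn
      rw [hfderiv n hx, hn.1, hn.2 i]
      simp only [hf, hψ, hn.1]
      ring
  refine tendsto_nhds_unique key (tendsto_const_nhds.congr' ?_)
  filter_upwards [Filter.eventually_gt_atTop 0] with n hn
  exact (h.integral_radial_test (hft n hn) (b i)).symm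

/-! ### Green's formula on a triangle -/

/-- The edge opposite to the vertex `i`. -/
def Tri.edge (b : Tri) (i : Fin 3) : Set Plane := segment ℝ (b (i + 1)) (b (i + 2))

/-- The outward unit normal on the edge opposite to the vertex `i`. -/
def Tri.normal (b : Tri) (i : Fin 3) : Plane := -(‖b.grad i‖⁻¹ • b.grad i)

/-- The arc length measure on an edge. -/
def Tri.edgeMeasure (b : Tri) (i : Fin 3) : Measure Plane :=
  (Measure.hausdorffMeasure 1 : Measure Plane).restrict (b.edge i)

/-- The trace of `w` on the edge opposite to the vertex `i`. -/
def Tri.edgeTrace (b : Tri) (i : Fin 3) (w : Plane → ℝ) (D : Fin 2 → Plane → ℝ) : Plane → ℝ :=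
  rayIntegral (b i) (radialDiv w D (b i))

lemma Tri.norm_normal (b : Tri) (i : Fin 3) : ‖b.normal i‖ = 1 := by
  have := norm_pos_iff.2 (b.grad_ne_zero i)
  rw [Tri.normal, norm_neg, norm_smul, norm_inv, norm_norm, inv_mul_cancel₀ this.ne']

lemma Tri.edge_endpoints_ne (b : Tri) (i : Fin 3) : b (i + 1) ≠ b (i + 2) := fun h =>
  Tri.add_one_ne_add_two i (b.ind.injective h)

lemma Tri.edge_eq_image (b : Tri) (i : Fin 3) : b.edge i = b.edgePt i '' Set.Icc 0 1 := by
  unfold Tri.edge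
  rw [segment_eq_image_lineMap]
  rfl

lemma Tri.measurableEmbedding_edgePt (b : Tri) (i : Fin 3) : MeasurableEmbedding (b.edgePt i) := by
  have h1 : AntilipschitzWith (nndist (b (i + 1)) (b (i + 2)))⁻¹ (b.edgePt i) :=
    antilipschitzWith_lineMap (b.edge_endpoints_ne i)
  have h2 : UniformContinuous (b.edgePt i) := (lipschitzWith_lineMap _ _).uniformContinuous
  exact (h1.isClosedEmbedding h2).measurableEmbedding

lemma Tri.isClosed_edge (b : Tri) (i : Fin 3) : IsClosed (b.edge i) := by
  rw [b.edge_eq_image]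
  exact (isCompact_Icc.image (b.continuous_edgePt i)).isClosed

lemma Tri.measurableSet_edge (b : Tri) (i : Fin 3) : MeasurableSet (b.edge i) :=
  (b.isClosed_edge i).measurableSet

/-- The length of the edge opposite to the vertex `i`. -/
def Tri.length (b : Tri) (i : Fin 3) : ℝ := dist (b (i + 1)) (b (i + 2))

lemma Tri.length_pos (b : Tri) (i : Fin 3) : 0 < b.length i := dist_pos.2 (b.edge_endpoints_ne i)

lemma Tri.edgeMeasure_eq (b : Tri) (i : Fin 3) :
    b.edgeMeasure i = ENNReal.ofReal (b.length i) • unitMeasure.map (b.edgePt i) := by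
  have hE := b.measurableEmbedding_edgePt i
  have hu : unitMeasure = volume.restrict (Set.Icc 0 1) := by
    unfold unitMeasure
    exact restrict_Ioo_eq_restrict_Icc
  ext A hA
  unfold Tri.edgeMeasure
  rw [Measure.restrict_apply hA, Measure.smul_apply, hE.map_apply, hu,
    Measure.restrict_apply (hE.measurable hA), b.edge_eq_image, ← Set.image_preimage_inter]
  have h := hausdorffMeasure_lineMap_image (b (i + 1)) (b (i + 2))
    (b.edgePt i ⁻¹' A ∩ Set.Icc 0 1)
  rw [hausdorffMeasure_real] at h
  refine h.trans ?_
  rw [Tri.length, ← coe_nndist, ENNReal.ofReal_coe_nnreal]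
  rfl

instance (b : Tri) (i : Fin 3) : IsFiniteMeasure (b.edgeMeasure i) := by
  have : IsFiniteMeasure (unitMeasure.map (b.edgePt i)) := Measure.isFiniteMeasure_map _ _
  rw [b.edgeMeasure_eq]
  exact Measure.smul_finite _ ENNReal.ofReal_ne_top

lemma Tri.integral_edge (b : Tri) (i : Fin 3) (f : Plane → ℝ) :
    ∫ x, f x ∂(b.edgeMeasure i) = b.length i * ∫ σ, f (b.edgePt i σ) ∂unitMeasure := by
  rw [b.edgeMeasure_eq, integral_smul_measure, (b.measurableEmbedding_edgePt i).integral_map,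
    ENNReal.toReal_ofReal (b.length_pos i).le, smul_eq_mul]

lemma Tri.memLp_edge (b : Tri) (i : Fin 3) {f : Plane → ℝ}
    (hf : MemLp (fun σ => f (b.edgePt i σ)) 2 unitMeasure) : MemLp f 2 (b.edgeMeasure i) ∧
      lpNorm f 2 (b.edgeMeasure i) ^ 2 =
        b.length i * lpNorm (fun σ => f (b.edgePt i σ)) 2 unitMeasure ^ 2 := by
  have h : MemLp f 2 (b.edgeMeasure i) := by
    rw [b.edgeMeasure_eq]
    refine MemLp.smul_measure ?_ ENNReal.ofReal_ne_top
    exact (b.measurableEmbedding_edgePt i).memLp_map_measure_iff.2 hf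
  refine ⟨h, ?_⟩
  rw [lpNorm_sq_eq_integral h, lpNorm_sq_eq_integral hf, b.integral_edge]

lemma Tri.length_le_diam (b : Tri) (i : Fin 3) : b.length i ≤ Metric.diam b.hull :=
  Metric.dist_le_diam_of_mem b.isCompact_hull.isBounded (b.vertex_mem _) (b.vertex_mem _)

/-- The trace inequality on an edge of a triangle. -/
lemma IsSobolevOne.memLp_edgeTrace {b : Tri} {w : Plane → ℝ} {D : Fin 2 → Plane → ℝ}
    (h : IsSobolevOne (interior b.hull) w D) (i : Fin 3) :
    MemLp (b.edgeTrace i w D) 2 (b.edgeMeasure i) ∧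
      4 * b.area * lpNorm (b.edgeTrace i w D) 2 (b.edgeMeasure i) ^ 2 ≤ Metric.diam b.hull *
        (2 * lpNorm w 2 (volume.restrict (interior b.hull)) + Metric.diam b.hull *
          ∑ k, lpNorm (D k) 2 (volume.restrict (interior b.hull))) ^ 2 := by
  obtain ⟨h1, h2⟩ := h.memLp_radialDiv i
  obtain ⟨h3, h4⟩ := b.memLp_rayIntegral i h1
  obtain ⟨h5, h6⟩ := b.memLp_edge i h3
  refine ⟨h5, ?_⟩
  unfold Tri.edgeTrace
  rw [h6]
  calc _ = b.length i * (4 * b.area * lpNorm (fun σ =>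
        rayIntegral (b i) (radialDiv w D (b i)) (b.edgePt i σ)) 2 unitMeasure ^ 2) := by ring
    _ ≤ Metric.diam b.hull * lpNorm (radialDiv w D (b i)) 2
          (volume.restrict (interior b.hull)) ^ 2 :=
        mul_le_mul (b.length_le_diam i) h4
          (mul_nonneg (mul_nonneg (by norm_num) b.area_pos.le) (sq_nonneg _)) Metric.diam_nonneg
    _ ≤ _ := by
        refine mul_le_mul_of_nonneg_left ?_ Metric.diam_nonneg
        exact pow_le_pow_left₀ lpNorm_nonneg h2 2

/-- Green's formula on a triangle. -/
lemma IsSobolevOne.green {b : Tri} {w : Plane → ℝ} {D : Fin 2 → Plane → ℝ}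
    (h : IsSobolevOne (interior b.hull) w D) (k : Fin 2) {φ : Plane → ℝ}
    (hφ : IsTest Set.univ φ) :
    ∫ x in interior b.hull, (w x * partialDeriv k φ x + D k x * φ x) =
      ∑ i, ∫ x, b.normal i k * b.edgeTrace i w D x * φ x ∂(b.edgeMeasure i) := by
  have hm : MeasurableSet (interior b.hull) := isOpen_interior.measurableSet
  have hI {f g : Plane → ℝ} (hf : MemLp f 2 (volume.restrict (interior b.hull)))
      (hg : Continuous g) : Integrable (fun x => f x * g x)
      (volume.restrict (interior b.hull)) := by
    obtain ⟨M, hM⟩ := b.isCompact_hull.exists_bound_of_continuousOn hg.continuousOn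
    exact ((memLp_of_bound_mul hm hf hg fun x hx => hM x (interior_subset hx)).1).integrable
      (by norm_num)
  have hφc := hφ.contDiff.continuous
  have hφk (k : Fin 2) := (hφ.partialDeriv k).contDiff.continuous
  set I : Fin 2 → ℝ := fun k => ∫ x in interior b.hull, (w x * partialDeriv k φ x + D k x * φ x)
  have hIi (k : Fin 2) : Integrable (fun x => w x * partialDeriv k φ x + D k x * φ x)
      (volume.restrict (interior b.hull)) :=
    (hI h.memLp (hφk k)).add (hI (h.memLp_deriv k) hφc)
  have hJi (k : Fin 2) : Integrable
      (fun x : Plane => (w x * partialDeriv k φ x + D k x * φ x) * x k)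
      (volume.restrict (interior b.hull)) := by
    have h1 := (hI h.memLp (g := fun x => partialDeriv k φ x * x k) ((hφk k).mul (by fun_prop))).add
      (hI (h.memLp_deriv k) (g := fun x => φ x * x k) (hφc.mul (by fun_prop)))
    refine h1.congr (ae_of_all _ fun x => ?_)
    simp only [Pi.add_apply]; ring
  -- The part of the radial identity that does not depend on the vertex.
  set R : ℝ := ∫ x in interior b.hull, (2 * (w x * φ x) +
    ∑ k, (w x * partialDeriv k φ x + D k x * φ x) * x k)
  have hRi : Integrable (fun x => 2 * (w x * φ x) +
      ∑ k, (w x * partialDeriv k φ x + D k x * φ x) * x k) (volume.restrict (interior b.hull)) :=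
    ((hI h.memLp hφc).const_mul 2).add (integrable_finsetSum _ fun k _ => hJi k)
  have hR (i : Fin 3) : 2 * b.area * ∫ σ, b.edgeTrace i w D (b.edgePt i σ) *
      φ (b.edgePt i σ) ∂unitMeasure = R - ∑ k, I k * b i k := by
    unfold Tri.edgeTrace
    rw [← h.integral_radial i hφ]
    simp only [I, ← integral_mul_const]
    rw [← integral_finsetSum _ fun k _ => (hIi k).mul_const _, ← integral_sub hRi
      (integrable_finsetSum _ fun k _ => (hIi k).mul_const _)]
    congr 1; ext x
    rw [← sum_mul_partialDeriv]
    simp only [radialDiv, Fin.sum_univ_two, PiLp.sub_apply]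
    ring
  -- The edge length is `2 * b.area * ‖b.grad i‖`, so length times unit normal is `-(2 * b.area) •
  -- b.grad i`.
  have hE (i : Fin 3) : ∫ x, b.normal i k * b.edgeTrace i w D x * φ x ∂(b.edgeMeasure i) =
      -(b.grad i k * (R - ∑ k, I k * b i k)) := by
    have hg := norm_pos_iff.2 (b.grad_ne_zero i)
    rw [b.integral_edge, Tri.length, b.length_eq, ← hR]
    simp only [mul_assoc, integral_const_mul, Tri.normal, PiLp.neg_apply, PiLp.smul_apply,
      smul_eq_mul]
    field_simp
  simp only [hE]
  rw [Finset.sum_neg_distrib]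
  -- Since the gradients sum to zero the term `R` drops out, and the gradients paired with the
  -- vertices give the identity matrix, which selects `I k`.
  have s1 : ∑ i, b.grad i k * (R - ∑ k', I k' * b i k') =
      R * ∑ i, b.grad i k - ∑ k', I k' * ∑ i, b.grad i k * b i k' := by
    simp only [mul_sub, Finset.sum_sub_distrib, Finset.mul_sum]
    rw [Finset.sum_comm (s := (Finset.univ : Finset (Fin 2)))]
    congr 1
    · exact Finset.sum_congr rfl fun i _ => mul_comm _ _
    · exact Finset.sum_congr rfl fun i _ => Finset.sum_congr rfl fun k' _ => by ring
  rw [s1, b.sum_grad]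
  simp only [b.sum_grad_mul_vertex]
  simp [I]

/-- The mean value of the trace over an edge. -/
lemma IsSobolevOne.edge_mean {b : Tri} {w : Plane → ℝ} {D : Fin 2 → Plane → ℝ}
    (h : IsSobolevOne (interior b.hull) w D) (i : Fin 3) :
    ∫ x in interior b.hull, radialDiv w D (b i) x =
      2 * b.area * ((b.length i)⁻¹ * ∫ x, b.edgeTrace i w D x ∂(b.edgeMeasure i)) := by
  have := b.setIntegral_mul_eq i (h.memLp_radialDiv i).1 (ψ := fun _ => 1) (Φ := fun _ => 1)
    continuous_const continuousOn_const (fun _ _ _ _ => rfl)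
  simp only [mul_one] at this
  rw [this, b.integral_edge, inv_mul_cancel_left₀ (b.length_pos i).ne']
  rfl

/-! ### Geometry of triangulated domains -/

lemma Tri.affine_eq (b : Tri) (f : Plane →ᵃ[ℝ] ℝ) (y : Plane) :
    f y = ∑ i, b.coord i y * f (b i) := by
  have h := Finset.univ.map_affineCombination b (fun i => b.coord i y)
    (b.sum_coord_apply_eq_one y) f
  rw [b.affineCombination_coord_eq_self,
    Finset.affineCombination_eq_linear_combination _ _ _ (b.sum_coord_apply_eq_one y)] at h
  simpa using h

/-- `x` lies in the relative interior of the edge opposite to the vertex `i`. -/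
def Tri.InEdge (b : Tri) (i : Fin 3) (x : Plane) : Prop :=
  b.coord i x = 0 ∧ 0 < b.coord (i + 1) x ∧ 0 < b.coord (i + 2) x

lemma Tri.mem_edge_iff (b : Tri) (i : Fin 3) {x : Plane} :
    x ∈ b.edge i ↔ b.coord i x = 0 ∧ x ∈ b.hull := by
  rw [b.edge_eq_image]
  constructor
  · rintro ⟨σ, hσ, rfl⟩
    refine ⟨b.coord_edgePt i σ, Tri.mem_hull.2 fun j => ?_⟩
    rcases Tri.cases i j with rfl | rfl | rfl
    · rw [b.coord_edgePt]
    · rw [b.coord_edgePt_one]; linarith [hσ.2]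
    · rw [b.coord_edgePt_two]; exact hσ.1
  · rintro ⟨h0, hx⟩
    rw [Tri.mem_hull] at hx
    have hs := b.coord_sum i x
    have h1 := hx (i + 1)
    refine ⟨b.coord (i + 2) x, ⟨hx _, by linarith⟩, b.ext_coord i ?_ ?_ ?_⟩
    · rw [b.coord_edgePt, h0]
    · rw [b.coord_edgePt_one]; linarith
    · rw [b.coord_edgePt_two]

lemma Tri.InEdge.mem_edge {b : Tri} {i : Fin 3} {x : Plane} (h : b.InEdge i x) : x ∈ b.edge i := by
  refine (b.mem_edge_iff i).2 ⟨h.1, Tri.mem_hull.2 fun j => ?_⟩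
  rcases Tri.cases i j with rfl | rfl | rfl
  · exact h.1.ge
  · exact h.2.1.le
  · exact h.2.2.le

lemma Tri.edge_subset_hull (b : Tri) (i : Fin 3) : b.edge i ⊆ b.hull := fun _ hx =>
  ((b.mem_edge_iff i).1 hx).2

lemma Tri.inEdge_of_coord_eq_zero {b : Tri} {i : Fin 3} {x : Plane} (hx : x ∈ b.hull)
    (h0 : b.coord i x = 0) (hv : ∀ i, x ≠ b i) : b.InEdge i x := by
  have h := Tri.mem_hull.1 hx
  have hs := b.coord_sum i x
  refine ⟨h0, lt_of_le_of_ne (h _) fun h1 => hv (i + 2) ?_, lt_of_le_of_ne (h _) fun h2 =>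
    hv (i + 1) ?_⟩
  · refine b.ext_coord i ?_ ?_ ?_
    · rw [h0, b.coord_apply, if_neg (Tri.ne_add_two i)]
    · rw [← h1, b.coord_apply, if_neg (Tri.add_one_ne_add_two i)]
    · rw [b.coord_apply, if_pos rfl]; linarith
  · refine b.ext_coord i ?_ ?_ ?_
    · rw [h0, b.coord_apply, if_neg (Tri.ne_add_one i)]
    · rw [b.coord_apply, if_pos rfl]; linarith
    · rw [← h2, b.coord_apply, if_neg (Tri.add_one_ne_add_two i).symm]

lemma Tri.InEdge.eq_of_coord_eq_zero {b : Tri} {i j : Fin 3} {x : Plane} (h : b.InEdge i x)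
    (hj : b.coord j x = 0) : j = i := by
  rcases Tri.cases i j with rfl | rfl | rfl
  · rfl
  · exact absurd hj h.2.1.ne'
  · exact absurd hj h.2.2.ne'

/-- If `b i` were missing, the coordinate `i` would vanish on `V` and hence on its convex hull. This
turns the conformity of the triangulation into statements about shared vertices. -/
lemma Tri.vertex_mem_of_mem_convexHull {b : Tri} {V : Set Plane} (hV : V ⊆ Set.range b)
    {x : Plane} (hx : x ∈ convexHull ℝ V) {i : Fin 3} (hi : b.coord i x ≠ 0) : b i ∈ V := by
  by_contra hb
  refine hi ?_
  have hsub : V ⊆ {y | b.coord i y = 0} := by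
    intro y hy
    obtain ⟨j, rfl⟩ := hV hy
    have hij : i ≠ j := fun h => hb (h ▸ hy)
    exact b.coord_apply_ne hij
  have hc : Convex ℝ {y | b.coord i y = 0} := by
    have : {y | b.coord i y = 0} = b.coord i ⁻¹' {0} := rfl
    rw [this]
    exact (convex_singleton 0).affine_preimage _
  exact convexHull_min hsub hc hx

/-- `T` is a connected open set which is the interior of its closure, decomposed into triangles that
meet along common faces. -/
structure IsTriangulated (T : Set Plane) {ι : Type} (b : ι → Tri) : Prop where
  isOpen : IsOpen T
  isConnected : IsConnected T
  interior_closure : interior (closure T) = T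
  closure_eq : closure T = ⋃ j, (b j).hull
  inter : ∀ j j', (b j).hull ∩ (b j').hull ⊆ convexHull ℝ (Set.range (b j) ∩ Set.range (b j'))
  inj : ∀ j j', Set.range (b j) = Set.range (b j') → j = j'

namespace IsTriangulated

variable {T : Set Plane} {ι : Type} {b : ι → Tri}

lemma hull_subset (h : IsTriangulated T b) (j : ι) : (b j).hull ⊆ closure T := by
  rw [h.closure_eq]
  exact Set.subset_iUnion (fun j => (b j).hull) j

lemma interior_subset (h : IsTriangulated T b) (j : ι) : interior (b j).hull ⊆ T := by
  rw [← h.interior_closure]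
  exact interior_mono (h.hull_subset j)

/-- At an interior point all three coordinates are positive, so by conformity all three vertices are
shared. -/
lemma eq_of_mem_interior (h : IsTriangulated T b) {j j' : ι} {x : Plane}
    (hx : x ∈ interior (b j).hull) (hx' : x ∈ (b j').hull) : j = j' := by
  refine h.inj j j' ?_
  have hsub : Set.range (b j) ⊆ Set.range (b j') := by
    rintro _ ⟨i, rfl⟩
    have := h.inter j j' ⟨_root_.interior_subset hx, hx'⟩
    exact (Tri.vertex_mem_of_mem_convexHull Set.inter_subset_left this
      (Tri.mem_interior_hull.1 hx i).ne').2
  have hfin := Set.finite_range (b j')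
  refine Set.eq_of_subset_of_ncard_le hsub ?_ hfin
  rw [Set.ncard_range_of_injective (b j').ind.injective,
    Set.ncard_range_of_injective (b j).ind.injective]

lemma exists_third : ∀ i1 i2 : Fin 3, i1 ≠ i2 →
    ∃ i' : Fin 3, i' ≠ i1 ∧ i' ≠ i2 ∧ ∀ k, k = i' ∨ k = i1 ∨ k = i2 := by
  decide

/-- The triangle with apex opposite to the edge `i'` lies on the other side of the edge `i`. -/
structure Opposite (b b' : Tri) (i i' : Fin 3) (c : ℝ) : Prop where
  neg : c < 0
  coord_eq : ∀ y, b'.coord i' y = c * b.coord i y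
  inEdge : ∀ x, b.InEdge i x → b'.InEdge i' x
  edge_eq : b.edge i = b'.edge i'

/-- Two triangles containing a point of the relative interior of an edge of the first one are equal,
or share this edge and lie on opposite sides of it. -/
lemma eq_or_opposite (h : IsTriangulated T b) {j j' : ι} {i : Fin 3} {x : Plane}
    (hx : (b j).InEdge i x) (hx' : x ∈ (b j').hull) :
    j = j' ∨ ∃ i' c, Opposite (b j) (b j') i i' c := by
  have hmem := h.inter j j' ⟨(b j).edge_subset_hull i hx.mem_edge, hx'⟩
  obtain ⟨i1, h1⟩ := (Tri.vertex_mem_of_mem_convexHull Set.inter_subset_left hmem hx.2.1.ne').2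
  obtain ⟨i2, h2⟩ := (Tri.vertex_mem_of_mem_convexHull Set.inter_subset_left hmem hx.2.2.ne').2
  have h12 : i1 ≠ i2 := by
    rintro rfl
    exact (b j).edge_endpoints_ne i (h1.symm.trans h2)
  obtain ⟨i', hi1, hi2, hcases⟩ := exists_third i1 i2 h12
  -- The coordinate opposite to the shared edge in the second triangle vanishes at both shared
  -- vertices, so it is a multiple of that in the first one. The factor is its value at the apex of
  -- the first triangle, and its sign tells on which side the second triangle lies.
  set c := (b j').coord i' (b j i) with hc
  have hco (y : Plane) : (b j').coord i' y = c * (b j).coord i y := by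
    rw [(b j).affine_eq ((b j').coord i') y, Tri.sum_eq i, ← h1, ← h2, (b j').coord_apply_ne hi1,
      (b j').coord_apply_ne hi2, hc]
    ring
  have hc1 (y : Plane) (hy : (b j).coord i y = 0) :
      (b j').coord i1 y = (b j).coord (i + 1) y := by
    rw [(b j).affine_eq ((b j').coord i1) y, Tri.sum_eq i, hy, ← h1, ← h2, (b j').coord_apply_eq,
      (b j').coord_apply_ne h12]
    ring
  have hc2 (y : Plane) (hy : (b j).coord i y = 0) :
      (b j').coord i2 y = (b j).coord (i + 2) y := by
    rw [(b j).affine_eq ((b j').coord i2) y, Tri.sum_eq i, hy, ← h1, ← h2, (b j').coord_apply_eq,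
      (b j').coord_apply_ne h12.symm]
    ring
  have hne1 := Tri.ne_add_one i'
  have hne2 := Tri.ne_add_two i'
  have hIn (y : Plane) (hy : (b j).InEdge i y) : (b j').InEdge i' y := by
    have p1 : 0 < (b j').coord i1 y := by rw [hc1 y hy.1]; exact hy.2.1
    have p2 : 0 < (b j').coord i2 y := by rw [hc2 y hy.1]; exact hy.2.2
    refine ⟨by rw [hco, hy.1, mul_zero], ?_, ?_⟩
    · rcases hcases (i' + 1) with hk | hk | hk
      · exact absurd hk hne1.symm
      · rw [hk]; exact p1
      · rw [hk]; exact p2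
    · rcases hcases (i' + 2) with hk | hk | hk
      · exact absurd hk hne2.symm
      · rw [hk]; exact p1
      · rw [hk]; exact p2
  have hc0 : c ≠ 0 := by
    intro h0
    have := hco (b j' i')
    rw [h0, (b j').coord_apply_eq, zero_mul] at this
    exact one_ne_zero this
  rcases lt_or_gt_of_ne hc0 with hneg | hpos
  · refine Or.inr ⟨i', c, hneg, hco, hIn, ?_⟩
    unfold Tri.edge
    rw [← h1, ← h2]
    rcases hcases (i' + 1) with hk | hk | hk
    · exact absurd hk hne1.symm
    · rcases hcases (i' + 2) with hl | hl | hl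
      · exact absurd hl hne2.symm
      · exact absurd (hk.trans hl.symm) (Tri.add_one_ne_add_two i')
      · rw [hk, hl]
    · rcases hcases (i' + 2) with hl | hl | hl
      · exact absurd hl hne2.symm
      · rw [hk, hl, segment_symm]
      · exact absurd (hk.trans hl.symm) (Tri.add_one_ne_add_two i')
  · left
    have hx2 := hIn x hx
    -- move slightly from `x` towards the apex of the first triangle
    have hl : Continuous (fun s : ℝ => (AffineMap.lineMap x (b j i) s : Plane)) :=
      AffineMap.lineMap_continuous
    have ev (b' : Tri) (k : Fin 3) (hk : 0 < b'.coord k x) :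
        ∀ᶠ s in nhdsWithin (0 : ℝ) (Set.Ioi 0), 0 < b'.coord k (AffineMap.lineMap x (b j i) s) := by
      have : Filter.Tendsto (fun s : ℝ => b'.coord k (AffineMap.lineMap x (b j i) s))
          (nhdsWithin 0 (Set.Ioi 0)) (nhds (b'.coord k x)) := by
        have := ((b'.continuous_coord k).comp hl).tendsto 0
        simp only [Function.comp_apply, AffineMap.lineMap_apply_zero] at this
        exact this.mono_left nhdsWithin_le_nhds
      exact this.eventually_const_lt hk
    have hi0 : ∀ᶠ s in nhdsWithin (0 : ℝ) (Set.Ioi 0),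
        0 < (b j).coord i (AffineMap.lineMap x (b j i) s) := by
      filter_upwards [self_mem_nhdsWithin] with s hs
      rw [AffineMap.apply_lineMap, hx.1, (b j).coord_apply_eq, AffineMap.lineMap_apply]
      simpa using hs
    obtain ⟨s, hs0, hs1, hs2, hs3, hs4⟩ := (hi0.and ((ev (b j) _ hx.2.1).and
      ((ev (b j) _ hx.2.2).and ((ev (b j') _ hx2.2.1).and (ev (b j') _ hx2.2.2))))).exists
    refine h.eq_of_mem_interior (x := AffineMap.lineMap x (b j i) s) ?_ ?_
    · refine Tri.mem_interior_hull.2 fun k => ?_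
      rcases Tri.cases i k with rfl | rfl | rfl
      · exact hs0
      · exact hs1
      · exact hs2
    · refine Tri.mem_hull.2 fun k => ?_
      rcases Tri.cases i' k with rfl | rfl | rfl
      · rw [hco]; exact (mul_pos hpos hs0).le
      · exact hs3.le
      · exact hs4.le

/-- The two triangles, lying on both sides of the edge, cover a neighbourhood of the point. That it
lies in `T` itself, and not merely in the closure, is where the absence of slits enters. -/
lemma Opposite.mem (h : IsTriangulated T b) {j j' : ι} {i i' : Fin 3} {c : ℝ}
    (ho : Opposite (b j) (b j') i i' c) {x : Plane} (hx : (b j).InEdge i x) : x ∈ T := by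
  have hx' := ho.inEdge x hx
  rw [← h.interior_closure, mem_interior_iff_mem_nhds]
  have ev (b' : Tri) (k : Fin 3) (hk : 0 < b'.coord k x) : ∀ᶠ y in nhds x, 0 < b'.coord k y :=
    (b'.continuous_coord k).continuousAt.eventually_const_lt hk
  filter_upwards [ev _ _ hx.2.1, ev _ _ hx.2.2, ev _ _ hx'.2.1, ev _ _ hx'.2.2] with y h1 h2 h3 h4
  rcases le_or_gt 0 ((b j).coord i y) with h0 | h0
  · refine h.hull_subset j (Tri.mem_hull.2 fun k => ?_)
    rcases Tri.cases i k with rfl | rfl | rfl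
    · exact h0
    · exact h1.le
    · exact h2.le
  · refine h.hull_subset j' (Tri.mem_hull.2 fun k => ?_)
    rcases Tri.cases i' k with rfl | rfl | rfl
    · rw [ho.coord_eq]; exact (mul_pos_of_neg_of_neg ho.neg h0).le
    · exact h3.le
    · exact h4.le

/-- The vertices of the triangulation. -/
def vertices (b : ι → Tri) : Set Plane := ⋃ j, Set.range (b j)

lemma finite_vertices [Finite ι] (b : ι → Tri) : (vertices b).Finite :=
  Set.finite_iUnion fun j => Set.finite_range (b j)

lemma ne_vertex {x : Plane} (hx : x ∉ vertices b) (j : ι) (i : Fin 3) : x ≠ b j i := by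
  rintro rfl
  exact hx (Set.mem_iUnion.2 ⟨j, i, rfl⟩)

lemma inEdge_of_mem_hull {j : ι} {x : Plane} (hx : x ∈ (b j).hull)
    (hxi : x ∉ interior (b j).hull) (hv : x ∉ vertices b) : ∃ i, (b j).InEdge i x := by
  rw [Tri.mem_interior_hull, not_forall] at hxi
  obtain ⟨i, hi⟩ := hxi
  exact ⟨i, Tri.inEdge_of_coord_eq_zero hx (le_antisymm (not_lt.1 hi) (Tri.mem_hull.1 hx i))
    (ne_vertex hv j)⟩

lemma frontier_eq (h : IsTriangulated T b) : frontier T = closure T \ T := by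
  rw [frontier, h.isOpen.interior_eq]

lemma exists_inEdge_of_mem_frontier (h : IsTriangulated T b) {x : Plane} (hx : x ∈ frontier T)
    (hv : x ∉ vertices b) : ∃ j i, (b j).InEdge i x := by
  rw [h.frontier_eq, h.closure_eq] at hx
  obtain ⟨j, hj⟩ := Set.mem_iUnion.1 hx.1
  exact ⟨j, inEdge_of_mem_hull hj (fun hi => hx.2 (h.interior_subset j hi)) hv⟩

lemma frontier_subset (h : IsTriangulated T b) : frontier T ⊆ ⋃ j, ⋃ i, (b j).edge i := by
  intro x hx
  rw [h.frontier_eq, h.closure_eq] at hx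
  obtain ⟨j, hj⟩ := Set.mem_iUnion.1 hx.1
  have hxi : x ∉ interior (b j).hull := fun hi => hx.2 (h.interior_subset j hi)
  rw [Tri.mem_interior_hull, not_forall] at hxi
  obtain ⟨i, hi⟩ := hxi
  refine Set.mem_iUnion.2 ⟨j, Set.mem_iUnion.2 ⟨i, ((b j).mem_edge_iff i).2 ⟨?_, hj⟩⟩⟩
  exact le_antisymm (not_lt.1 hi) (Tri.mem_hull.1 hj i)

lemma unique_of_mem_frontier (h : IsTriangulated T b) {x : Plane} (hx : x ∈ frontier T)
    {j j' : ι} {i : Fin 3} (hj : (b j).InEdge i x) (hj' : x ∈ (b j').hull) : j' = j := by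
  rcases h.eq_or_opposite hj hj' with rfl | ⟨i', c, ho⟩
  · rfl
  · rw [h.frontier_eq] at hx
    exact absurd (Opposite.mem h ho hj) hx.2

/-- Near such a point no other triangle is present, because there are finitely many, all are closed,
and `j` is the only one containing `x`. Hence `T` is given locally by the sign of one barycentric
coordinate. -/
lemma isOutwardNormal [Finite ι] (h : IsTriangulated T b) {x : Plane} (hx : x ∈ frontier T)
    {j : ι} {i : Fin 3} (hj : (b j).InEdge i x) : IsOutwardNormal T x ((b j).normal i) := by
  refine ⟨(b j).norm_normal i, ?_⟩
  have e1 : ∀ᶠ y in nhds x, ∀ j', y ∈ (b j').hull → j' = j := by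
    rw [Filter.eventually_all]
    intro j'
    by_cases hj' : x ∈ (b j').hull
    · exact Filter.Eventually.of_forall fun y _ => h.unique_of_mem_frontier hx hj hj'
    · filter_upwards [(b j').isCompact_hull.isClosed.isOpen_compl.mem_nhds hj'] with y hy hy'
      exact absurd hy' hy
  have ev (k : Fin 3) (hk : 0 < (b j).coord k x) : ∀ᶠ y in nhds x, 0 < (b j).coord k y :=
    ((b j).continuous_coord k).continuousAt.eventually_const_lt hk
  obtain ⟨r, hr, hball⟩ := Metric.eventually_nhds_iff_ball.1
    (e1.and ((ev _ hj.2.1).and (ev _ hj.2.2)))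
  refine ⟨r, hr, fun y hy => ?_⟩
  have hco : (b j).coord i y = inner ℝ (y - x) ((b j).grad i) := by
    rw [(b j).coord_eq i y x, hj.1, zero_add]
    simp [PiLp.inner_apply, mul_comm]
  have hg := norm_pos_iff.2 ((b j).grad_ne_zero i)
  have hiff : inner ℝ (y - x) ((b j).normal i) < 0 ↔ 0 < (b j).coord i y := by
    rw [Tri.normal, inner_neg_right, inner_smul_right, neg_lt_zero, ← hco]
    exact mul_pos_iff_of_pos_left (inv_pos.2 hg)
  rw [hiff]
  have hle {z : Plane} (hz : z ∈ Metric.ball x r) (hzT : z ∈ T) : 0 ≤ (b j).coord i z := by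
    have hz' := subset_closure hzT
    rw [h.closure_eq] at hz'
    obtain ⟨j', hj'⟩ := Set.mem_iUnion.1 hz'
    obtain rfl := (hball z hz).1 j' hj'
    exact Tri.mem_hull.1 hj' i
  constructor
  -- Strictness: if the coordinate vanished at `y`, points of the ray from the apex slightly beyond
  -- `y` would still lie in the open set `T` but have a negative coordinate.
  · intro hyT
    refine lt_of_le_of_ne (hle hy hyT) fun h0 => ?_
    have hcont : Continuous (fun s : ℝ => b j i + s • (y - b j i)) := by fun_prop
    have hU : IsOpen (T ∩ Metric.ball x r) := h.isOpen.inter Metric.isOpen_ball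
    have e2 : ∀ᶠ s in nhdsWithin (1 : ℝ) (Set.Ioi 1), b j i + s • (y - b j i) ∈
        T ∩ Metric.ball x r := by
      have h1 : b j i + (1 : ℝ) • (y - b j i) ∈ T ∩ Metric.ball x r := by
        rw [one_smul, add_sub_cancel]; exact ⟨hyT, hy⟩
      exact nhdsWithin_le_nhds (hcont.continuousAt.preimage_mem_nhds (hU.mem_nhds h1))
    obtain ⟨s, hs, hs1⟩ := (e2.and self_mem_nhdsWithin).exists
    have := hle hs.2 hs.1
    rw [(b j).coord_lineMap_vertex, ← h0] at this
    have hs1' : (1 : ℝ) < s := hs1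
    linarith
  · intro h0
    refine h.interior_subset j (Tri.mem_interior_hull.2 fun k => ?_)
    rcases Tri.cases i k with rfl | rfl | rfl
    · exact h0
    · exact (hball y hy).2.1
    · exact (hball y hy).2.2

end IsTriangulated

/-! ### Uniqueness of the outward normal -/

lemma IsOutwardNormal.unique {T : Set Plane} {x n n' : Plane} (h : IsOutwardNormal T x n)
    (h' : IsOutwardNormal T x n') : n = n' := by
  obtain ⟨hn, r, hr, hr'⟩ := h
  obtain ⟨hn', s, hs, hs'⟩ := h'
  by_contra hne
  have key (z : Plane) (hz : inner ℝ z n < 0) : inner ℝ z n' < 0 := by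
    have hz0 : 0 < ‖z‖ := by
      refine norm_pos_iff.2 fun h0 => ?_
      rw [h0, inner_zero_left] at hz
      exact lt_irrefl _ hz
    set ε := min r s / (2 * ‖z‖)
    have hε : 0 < ε := by have := lt_min hr hs; positivity
    have hlt : ‖ε • z‖ < min r s := by
      rw [norm_smul, Real.norm_of_nonneg hε.le]
      have := lt_min hr hs
      have e : ε * ‖z‖ = min r s / 2 := by simp only [ε]; field_simp
      rw [e]; linarith
    have m1 : x + ε • z ∈ Metric.ball x r := by
      rw [mem_ball_iff_norm, add_sub_cancel_left]; exact hlt.trans_le (min_le_left _ _)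
    have m2 : x + ε • z ∈ Metric.ball x s := by
      rw [mem_ball_iff_norm, add_sub_cancel_left]; exact hlt.trans_le (min_le_right _ _)
    have h1 := (hr' _ m1).2 (by
      rw [add_sub_cancel_left, inner_smul_left]
      exact mul_neg_of_pos_of_neg hε hz)
    have h2 := (hs' _ m2).1 h1
    rw [add_sub_cancel_left, inner_smul_left] at h2
    by_contra hcon
    exact absurd h2 (not_lt.2 (mul_nonneg hε.le (not_lt.1 hcon)))
  have hlt : inner ℝ n n' < 1 := by
    refine lt_of_le_of_ne ?_ fun h => hne ((inner_eq_one_iff_of_norm_eq_one hn hn').1 h)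
    have := real_inner_le_norm n n'
    rwa [hn, hn', one_mul] at this
  -- The direction `n' - n` points into the half-plane of `n` and out of that of `n'`, unless the
  -- two unit vectors coincide.
  have h1 := key (n' - n) (by
    rw [inner_sub_left, real_inner_self_eq_norm_sq, hn, real_inner_comm]; linarith)
  rw [inner_sub_left, real_inner_self_eq_norm_sq, hn'] at h1
  linarith

lemma IsOutwardNormal.outwardNormal_eq {T : Set Plane} {x n : Plane} (h : IsOutwardNormal T x n) :
    outwardNormal T x = n := by
  have hex : ∃ n, IsOutwardNormal T x n := ⟨n, h⟩
  unfold outwardNormal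
  rw [dif_pos hex]
  exact hex.choose_spec.unique h

/-! ### Traces on triangulated domains -/

/-- The union of the edges of a family of triangles. -/
def skeleton {ι : Type} (b : ι → Tri) : Set Plane := ⋃ e : ι × Fin 3, (b e.1).edge e.2

/-- The arc length measure on the union of the edges. -/
def skeletonMeasure {ι : Type} (b : ι → Tri) : Measure Plane :=
  (Measure.hausdorffMeasure 1 : Measure Plane).restrict (skeleton b)

/-- The sum of functions given on the edges, each extended by zero. -/
def edgeSum {ι : Type} [Fintype ι] (b : ι → Tri) (f : ι × Fin 3 → Plane → ℝ) (x : Plane) : ℝ :=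
  ∑ e, ((b e.1).edge e.2).indicator (f e) x

section skeleton

variable {ι : Type} [Fintype ι] (b : ι → Tri)

omit [Fintype ι] in
lemma edge_subset_skeleton (e : ι × Fin 3) : (b e.1).edge e.2 ⊆ skeleton b :=
  Set.subset_iUnion (fun e : ι × Fin 3 => (b e.1).edge e.2) e

omit [Fintype ι] in
lemma skeletonMeasure_restrict_edge (e : ι × Fin 3) :
    (skeletonMeasure b).restrict ((b e.1).edge e.2) = (b e.1).edgeMeasure e.2 := by
  unfold skeletonMeasure Tri.edgeMeasure
  rw [Measure.restrict_restrict ((b e.1).measurableSet_edge e.2),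
    Set.inter_eq_self_of_subset_left (edge_subset_skeleton b e)]

instance : IsFiniteMeasure (skeletonMeasure b) := by
  constructor
  unfold skeletonMeasure skeleton
  rw [Measure.restrict_apply_univ]
  refine (measure_iUnion_le _).trans_lt ?_
  rw [tsum_fintype, ENNReal.sum_lt_top]
  intro e _
  have := measure_lt_top ((b e.1).edgeMeasure e.2) Set.univ
  rwa [Tri.edgeMeasure, Measure.restrict_apply_univ] at this

lemma isClosed_skeleton : IsClosed (skeleton b) :=
  isClosed_iUnion_of_finite fun e => (b e.1).isClosed_edge e.2

/-- Arc length has no atoms, so identities on the skeleton need only be checked in the relative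
interiors of the edges. -/
lemma ae_notMem_vertices : ∀ᵐ x ∂(skeletonMeasure b), x ∉ IsTriangulated.vertices b := by
  have : NullSingletonClass (Measure.hausdorffMeasure 1 : Measure Plane) :=
    Measure.nullSingletonClass_hausdorff Plane (by norm_num)
  refine ae_restrict_of_ae ?_
  exact compl_mem_ae_iff.2 ((IsTriangulated.finite_vertices b).measure_zero _)

variable {b}

lemma memLp_edgeSum {f : ι × Fin 3 → Plane → ℝ}
    (hf : ∀ e, MemLp (f e) 2 ((b e.1).edgeMeasure e.2)) :
    MemLp (edgeSum b f) 2 (skeletonMeasure b) ∧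
      lpNorm (edgeSum b f) 2 (skeletonMeasure b) ≤
        ∑ e, lpNorm (f e) 2 ((b e.1).edgeMeasure e.2) := by
  have h1 (e : ι × Fin 3) : MemLp (((b e.1).edge e.2).indicator (f e)) 2 (skeletonMeasure b) := by
    rw [memLp_indicator_iff_restrict ((b e.1).measurableSet_edge e.2),
      skeletonMeasure_restrict_edge]
    exact hf e
  refine ⟨memLp_finsetSum _ fun e _ => h1 e, ?_⟩
  refine (lpNorm_fun_sum_le (fun e _ => h1 e)).trans (le_of_eq ?_)
  refine Finset.sum_congr rfl fun e _ => ?_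
  rw [← toReal_eLpNorm (h1 e).1, ← toReal_eLpNorm (hf e).1,
    eLpNorm_indicator_eq_eLpNorm_restrict ((b e.1).measurableSet_edge e.2),
    skeletonMeasure_restrict_edge]

lemma integral_edgeSum {f : ι × Fin 3 → Plane → ℝ}
    (hf : ∀ e, Integrable (f e) ((b e.1).edgeMeasure e.2)) :
    ∫ x, edgeSum b f x ∂(skeletonMeasure b) = ∑ e, ∫ x, f e x ∂((b e.1).edgeMeasure e.2) := by
  unfold edgeSum
  rw [integral_finsetSum]
  · refine Finset.sum_congr rfl fun e _ => ?_
    rw [integral_indicator ((b e.1).measurableSet_edge e.2), skeletonMeasure_restrict_edge]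
  · intro e _
    rw [integrable_indicator_iff ((b e.1).measurableSet_edge e.2), IntegrableOn,
      skeletonMeasure_restrict_edge]
    exact hf e

lemma edgeSum_mul (f : ι × Fin 3 → Plane → ℝ) (φ : Plane → ℝ) (x : Plane) :
    edgeSum b (fun e x => f e x * φ x) x = edgeSum b f x * φ x := by
  unfold edgeSum
  rw [Finset.sum_mul]
  refine Finset.sum_congr rfl fun e _ => ?_
  by_cases hx : x ∈ (b e.1).edge e.2
  · rw [Set.indicator_of_mem hx, Set.indicator_of_mem hx]
  · rw [Set.indicator_of_notMem hx, Set.indicator_of_notMem hx, zero_mul]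

end skeleton

namespace IsTriangulated

variable {T : Set Plane} {ι : Type} [Fintype ι] {b : ι → Tri}

omit [Fintype ι] in
lemma skeleton_subset (h : IsTriangulated T b) : skeleton b ⊆ closure T :=
  Set.iUnion_subset fun e => ((b e.1).edge_subset_hull e.2).trans (h.hull_subset e.1)

omit [Fintype ι] in
lemma frontier_subset_skeleton (h : IsTriangulated T b) : frontier T ⊆ skeleton b := by
  intro x hx
  obtain ⟨j, hj⟩ := Set.mem_iUnion.1 (h.frontier_subset hx)
  obtain ⟨i, hi⟩ := Set.mem_iUnion.1 hj
  exact edge_subset_skeleton b (j, i) hi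

omit [Fintype ι] in
lemma skeletonMeasure_restrict_frontier (h : IsTriangulated T b) :
    (skeletonMeasure b).restrict (frontier T) = boundaryMeasure T := by
  unfold skeletonMeasure boundaryMeasure
  rw [Measure.restrict_restrict isClosed_frontier.measurableSet,
    Set.inter_eq_self_of_subset_left h.frontier_subset_skeleton]

omit [Fintype ι] in
lemma boundaryMeasure_le (h : IsTriangulated T b) : boundaryMeasure T ≤ skeletonMeasure b := by
  rw [← h.skeletonMeasure_restrict_frontier]
  exact Measure.restrict_le_self

omit [Fintype ι] in
lemma pairwise_disjoint (h : IsTriangulated T b) :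
    Pairwise (Function.onFun Disjoint fun j => interior (b j).hull) := fun _ _ hij =>
  Set.disjoint_left.2 fun _ hx hx' =>
    hij (h.eq_of_mem_interior hx (_root_.interior_subset hx'))

/-- Up to the boundaries of the triangles, which are null by convexity, `T` is the disjoint union of
the open triangles. -/
lemma restrict_eq (h : IsTriangulated T b) : volume.restrict T =
    ∑ j, volume.restrict (interior (b j).hull) := by
  have e1 : T =ᵐ[volume] ⋃ j, interior (b j).hull := by
    refine Filter.EventuallyLE.antisymm ?_ ?_
    · have hn : ∀ᵐ x, x ∉ ⋃ j, ((b j).hull \ interior (b j).hull) :=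
        compl_mem_ae_iff.2 (measure_iUnion_null fun j => (b j).volume_hull_diff)
      filter_upwards [hn] with x hx hxT
      have hxT' := subset_closure hxT
      rw [h.closure_eq] at hxT'
      obtain ⟨j, hj⟩ := Set.mem_iUnion.1 hxT'
      refine Set.mem_iUnion.2 ⟨j, ?_⟩
      by_contra hcon
      exact hx (Set.mem_iUnion.2 ⟨j, hj, hcon⟩)
    · exact Filter.Eventually.of_forall fun x hx => by
        obtain ⟨j, hj⟩ := Set.mem_iUnion.1 hx
        exact h.interior_subset j hj
  rw [Measure.restrict_congr_set e1, Measure.restrict_iUnion h.pairwise_disjoint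
    fun j => isOpen_interior.measurableSet, Measure.sum_fintype]

lemma setIntegral_eq_sum (h : IsTriangulated T b) {f : Plane → ℝ}
    (hf : IntegrableOn f T) : ∫ x in T, f x = ∑ j, ∫ x in interior (b j).hull, f x := by
  rw [h.restrict_eq, integral_finsetSum_measure]
  exact fun j _ => hf.mono_set (h.interior_subset j)

lemma lpNorm_sq (h : IsTriangulated T b) {f : Plane → ℝ} (hf : MemLp f 2 (volume.restrict T)) :
    lpNorm f 2 (volume.restrict T) ^ 2 =
      ∑ j, lpNorm f 2 (volume.restrict (interior (b j).hull)) ^ 2 := by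
  rw [lpNorm_sq_eq_integral hf, h.setIntegral_eq_sum hf.integrable_sq]
  refine Finset.sum_congr rfl fun j _ => ?_
  rw [lpNorm_sq_eq_integral
    (hf.mono_measure (Measure.restrict_mono (h.interior_subset j) le_rfl))]

lemma isBounded (h : IsTriangulated T b) : Bornology.IsBounded T := by
  refine Bornology.IsBounded.subset ?_ subset_closure
  rw [h.closure_eq]
  exact (isCompact_iUnion fun j => (b j).isCompact_hull).isBounded

/-- The part of a sum over the edges which is seen at a boundary point. -/
lemma edgeSum_of_mem_frontier (h : IsTriangulated T b) {x : Plane} (hx : x ∈ frontier T)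
    {j : ι} {i : Fin 3} (hj : (b j).InEdge i x) (f : ι × Fin 3 → Plane → ℝ) :
    edgeSum b f x = f (j, i) x := by
  unfold edgeSum
  rw [Fintype.sum_eq_single (j, i), Set.indicator_of_mem hj.mem_edge]
  rintro ⟨j', i'⟩ hne
  refine Set.indicator_of_notMem (fun hmem => hne ?_) _
  have hm := ((b j').mem_edge_iff i').1 hmem
  obtain rfl := h.unique_of_mem_frontier hx hj hm.2
  rw [hj.eq_of_coord_eq_zero hm.1]

-- At most two triangles share an edge: the third would lie opposite to both, so its coordinate
-- factor with respect to the first would be negative and also a product of two negative factors.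
omit [Fintype ι] in
lemma Opposite.unique (h : IsTriangulated T b) {j j' j'' : ι} {i i' : Fin 3} {c : ℝ}
    (ho : Opposite (b j) (b j') i i' c) {x : Plane} (hx : (b j).InEdge i x)
    (hx' : x ∈ (b j'').hull) : j'' = j ∨ j'' = j' := by
  rcases h.eq_or_opposite hx hx' with rfl | ⟨i2, c2, ho2⟩
  · exact Or.inl rfl
  rcases h.eq_or_opposite (ho.inEdge x hx) hx' with rfl | ⟨i3, c3, ho3⟩
  · exact Or.inr rfl
  exfalso
  obtain rfl := (ho2.inEdge x hx).eq_of_coord_eq_zero (ho3.inEdge x (ho.inEdge x hx)).1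
  have h1 := ho2.coord_eq (b j i)
  have h2 := ho3.coord_eq (b j i)
  rw [(b j).coord_apply_eq] at h1
  rw [ho.coord_eq, (b j).coord_apply_eq] at h2
  nlinarith [ho.neg, ho2.neg, ho3.neg, mul_pos_of_neg_of_neg ho.neg ho3.neg]

omit [Fintype ι] in
lemma Opposite.ne {j j' : ι} {i i' : Fin 3} {c : ℝ}
    (ho : Opposite (b j) (b j') i i' c) {x : Plane} (hx : (b j).InEdge i x) : j ≠ j' := by
  rintro rfl
  obtain rfl := hx.eq_of_coord_eq_zero (ho.inEdge x hx).1
  have h1 := ho.coord_eq (b j i')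
  rw [(b j).coord_apply_eq] at h1
  linarith [ho.neg]

/-- The part of a sum over the edges which is seen at an interior point of a common edge. -/
lemma edgeSum_of_opposite (h : IsTriangulated T b) {x : Plane} {j j' : ι} {i i' : Fin 3} {c : ℝ}
    (ho : Opposite (b j) (b j') i i' c) (hj : (b j).InEdge i x)
    (f : ι × Fin 3 → Plane → ℝ) : edgeSum b f x = f (j, i) x + f (j', i') x := by
  unfold edgeSum
  rw [Fintype.sum_eq_add (j, i) (j', i') (fun he => ho.ne hj (congrArg Prod.fst he)),
    Set.indicator_of_mem hj.mem_edge, Set.indicator_of_mem (ho.inEdge x hj).mem_edge]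
  rintro ⟨j2, i2⟩ ⟨hne1, hne2⟩
  refine Set.indicator_of_notMem (fun hmem => ?_) _
  have hm := ((b j2).mem_edge_iff i2).1 hmem
  rcases ho.unique h hj hm.2 with rfl | rfl
  · exact hne1 (by rw [hj.eq_of_coord_eq_zero hm.1])
  · exact hne2 (by rw [(ho.inEdge x hj).eq_of_coord_eq_zero hm.1])

lemma Opposite.normal_eq {b b' : Tri} {i i' : Fin 3} {c : ℝ} (ho : Opposite b b' i i' c) :
    b'.normal i' = -b.normal i := by
  have hg : b'.grad i' = c • b.grad i := by
    refine ext_inner_left ℝ fun z => ?_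
    have e (b : Tri) (i : Fin 3) : inner ℝ z (b.grad i) = b.coord i (z + 0) - b.coord i 0 := by
      rw [b.coord_eq i (z + 0) 0]
      simp [PiLp.inner_apply, mul_comm]
    rw [inner_smul_right, e, e, ho.coord_eq, ho.coord_eq]
    ring
  have hn := norm_pos_iff.2 (b.grad_ne_zero i)
  unfold Tri.normal
  rw [hg, norm_smul, Real.norm_of_nonpos ho.neg.le, smul_smul, neg_neg]
  rw [← neg_smul]
  congr 1
  have := ho.neg.ne
  field_simp

section trace

variable {w : Plane → ℝ} {D : Fin 2 → Plane → ℝ}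

/-- Green's formula summed over the triangles. A common edge carries two contributions with opposite
normals, that is, the jump of the trace times the normal. -/
lemma integral_skeleton (h : IsTriangulated T b) (hw : IsSobolevOne T w D) (k : Fin 2)
    {φ : Plane → ℝ} (hφ : IsTest Set.univ φ) :
    ∫ x, edgeSum b (fun e x => (b e.1).normal e.2 k * (b e.1).edgeTrace e.2 w D x) x * φ x
      ∂(skeletonMeasure b) = ∫ x in T, (w x * partialDeriv k φ x + D k x * φ x) := by
  have hI {f g : Plane → ℝ} {μ : Measure Plane} (hf : Integrable f μ) (hg : IsTest Set.univ g) :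
      Integrable (fun x => f x * g x) μ := by
    obtain ⟨M, hM⟩ := hg.hasCompactSupport.exists_bound_of_continuous hg.contDiff.continuous
    exact hf.mul_bdd (c := M) hg.contDiff.continuous.aestronglyMeasurable (ae_of_all _ hM)
  have hfin : IsFiniteMeasure (volume.restrict T) := ⟨by
    rw [Measure.restrict_apply_univ]; exact h.isBounded.measure_lt_top⟩
  rw [h.setIntegral_eq_sum]
  · rw [show (fun x => edgeSum b (fun e x => (b e.1).normal e.2 k *
        (b e.1).edgeTrace e.2 w D x) x * φ x) = edgeSum b (fun e x => (b e.1).normal e.2 k *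
        (b e.1).edgeTrace e.2 w D x * φ x) from funext fun x => (edgeSum_mul _ φ x).symm]
    rw [integral_edgeSum, Fintype.sum_prod_type]
    · refine Finset.sum_congr rfl fun j _ => ?_
      rw [(hw.mono (h.interior_subset j)).green k hφ]
    · intro e
      refine hI (Integrable.const_mul ?_ _) hφ
      exact ((hw.mono (h.interior_subset e.1)).memLp_edgeTrace e.2).1.integrable (by norm_num)
  · exact (hI (hw.memLp.integrable (by norm_num)) (hφ.partialDeriv k)).add
      (hI ((hw.memLp_deriv k).integrable (by norm_num)) hφ)

lemma integrable_edgeSum_normal (h : IsTriangulated T b) (hw : IsSobolevOne T w D) (k : Fin 2) :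
    Integrable (edgeSum b (fun e x => (b e.1).normal e.2 k * (b e.1).edgeTrace e.2 w D x))
      (skeletonMeasure b) :=
  (memLp_edgeSum fun e => ((hw.mono (h.interior_subset e.1)).memLp_edgeTrace e.2).1.const_mul
    _).1.integrable (by norm_num)

/-- For `φ` supported in `T` the right-hand side of `integral_skeleton` vanishes by the definition
of weak derivatives, so the jump vanishes inside `T`. -/
lemma edgeSum_normal_eq_zero (h : IsTriangulated T b) (hw : IsSobolevOne T w D) (k : Fin 2) :
    ∀ᵐ x ∂(skeletonMeasure b), x ∈ T →
      edgeSum b (fun e x => (b e.1).normal e.2 k * (b e.1).edgeTrace e.2 w D x) x = 0 := by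
  refine h.isOpen.ae_eq_zero_of_integral_contDiff_smul_eq_zero
    ((h.integrable_edgeSum_normal hw k).locallyIntegrable.locallyIntegrableOn _) ?_
  intro φ h1 h2 h3
  have hφ : IsTest T φ := ⟨h1, h2, h3⟩
  have := h.integral_skeleton hw k (hφ.mono (Set.subset_univ _))
  simp only [smul_eq_mul]
  rw [show (fun x => φ x * edgeSum b (fun e x => (b e.1).normal e.2 k *
    (b e.1).edgeTrace e.2 w D x) x) = fun x => edgeSum b (fun e x => (b e.1).normal e.2 k *
    (b e.1).edgeTrace e.2 w D x) x * φ x from funext fun x => mul_comm _ _, this,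
    integral_add ((hφ.partialDeriv k).integrableOn_mul (locallyIntegrableOn_of_memLp hw.memLp))
    (hφ.integrableOn_mul (locallyIntegrableOn_of_memLp (hw.memLp_deriv k))),
    hw.integral_eq k φ hφ, neg_add_cancel]

/-- The traces on a common edge from the two adjacent triangles agree. -/
lemma edgeTrace_ae_eq (h : IsTriangulated T b) (hw : IsSobolevOne T w D) {j j' : ι}
    {i i' : Fin 3} {c : ℝ} (ho : Opposite (b j) (b j') i i' c) :
    (b j).edgeTrace i w D =ᵐ[(b j).edgeMeasure i] (b j').edgeTrace i' w D := by
  have e := skeletonMeasure_restrict_edge b (j, i)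
  simp only at e
  rw [← e, Filter.EventuallyEq, ae_restrict_iff' ((b j).measurableSet_edge i)]
  filter_upwards [h.edgeSum_normal_eq_zero hw 0, h.edgeSum_normal_eq_zero hw 1,
    ae_notMem_vertices b] with x h0 h1 hv hx
  have hm := ((b j).mem_edge_iff i).1 hx
  have hin := Tri.inEdge_of_coord_eq_zero hm.2 hm.1 (ne_vertex hv j)
  have hxT := ho.mem h hin
  by_contra hne
  -- If the traces differed, both components of the normal would vanish, which contradicts its unit
  -- length.
  have key (k : Fin 2) (hk : edgeSum b (fun e x => (b e.1).normal e.2 k *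
      (b e.1).edgeTrace e.2 w D x) x = 0) : (b j).normal i k = 0 := by
    rw [h.edgeSum_of_opposite ho hin] at hk
    simp only [ho.normal_eq, PiLp.neg_apply] at hk
    have : (b j).normal i k * ((b j).edgeTrace i w D x - (b j').edgeTrace i' w D x) = 0 := by
      linarith
    exact (mul_eq_zero.1 this).resolve_right (sub_ne_zero.2 hne)
  have hz : (b j).normal i = 0 := by
    ext k
    fin_cases k
    · exact key 0 (h0 hxT)
    · exact key 1 (h1 hxT)
  have := (b j).norm_normal i
  rw [hz, norm_zero] at this
  exact zero_ne_one this

/-- The inner part of the skeleton contributes nothing; on the frontier exactly one triangle is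
seen, and its edge normal is the outward normal of `T`. -/
lemma setIntegral_eq_boundary (h : IsTriangulated T b) (hw : IsSobolevOne T w D) (k : Fin 2)
    {φ : Plane → ℝ} (hφ : IsTest Set.univ φ) :
    ∫ x in T, (w x * partialDeriv k φ x + D k x * φ x) =
      ∫ x, edgeSum b (fun e => (b e.1).edgeTrace e.2 w D) x * φ x * outwardNormal T x k
        ∂(boundaryMeasure T) := by
  rw [← h.integral_skeleton hw k hφ, ← h.skeletonMeasure_restrict_frontier,
    ← integral_indicator isClosed_frontier.measurableSet]
  have hsk : ∀ᵐ x ∂(skeletonMeasure b), x ∈ skeleton b :=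
    ae_restrict_mem (isClosed_skeleton b).measurableSet
  refine integral_congr_ae ?_
  filter_upwards [h.edgeSum_normal_eq_zero hw k, ae_notMem_vertices b, hsk] with x h0 hv hx
  by_cases hxf : x ∈ frontier T
  · obtain ⟨j, i, hji⟩ := h.exists_inEdge_of_mem_frontier hxf hv
    rw [Set.indicator_of_mem hxf, h.edgeSum_of_mem_frontier hxf hji,
      h.edgeSum_of_mem_frontier hxf hji, (h.isOutwardNormal hxf hji).outwardNormal_eq]
    ring
  · rw [Set.indicator_of_notMem hxf]
    have hxT : x ∈ T := by
      by_contra hcon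
      exact hxf (by rw [h.frontier_eq]; exact ⟨h.skeleton_subset hx, hcon⟩)
    rw [h0 hxT, zero_mul]

lemma memLp_edgeSum_trace (h : IsTriangulated T b) (hw : IsSobolevOne T w D) :
    MemLp (edgeSum b (fun e => (b e.1).edgeTrace e.2 w D)) 2 (boundaryMeasure T) :=
  (memLp_edgeSum fun e => ((hw.mono (h.interior_subset e.1)).memLp_edgeTrace e.2).1).1.mono_measure
    h.boundaryMeasure_le

lemma isTrace (h : IsTriangulated T b) (hs : MemSobolev T 1 w) : IsTrace T w
    (edgeSum b (fun e => (b e.1).edgeTrace e.2 w fun i => weakDeriv T (unitIndex i) w)) := by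
  have hw := hs.isSobolevOne_self h.isOpen
  refine ⟨hs, h.memLp_edgeSum_trace hw, fun φ h1 h2 => ?_⟩
  have hφ : IsTest Set.univ φ := ⟨h1, h2, Set.subset_univ _⟩
  have hfin : IsFiniteMeasure (volume.restrict T) := ⟨by
    rw [Measure.restrict_apply_univ]; exact h.isBounded.measure_lt_top⟩
  have hI {f g : Plane → ℝ} (hf : MemLp f 2 (volume.restrict T)) (hg : IsTest Set.univ g) :
      IntegrableOn (fun x => f x * g x) T := by
    obtain ⟨M, hM⟩ := hg.hasCompactSupport.exists_bound_of_continuous hg.contDiff.continuous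
    exact (hf.integrable (by norm_num)).mul_bdd (c := M)
      hg.contDiff.continuous.aestronglyMeasurable (ae_of_all _ hM)
  refine ⟨?_, ?_⟩
  · have := h.setIntegral_eq_boundary hw 0 hφ
    rwa [integral_add (hI hw.memLp (hφ.partialDeriv 0)) (hI (hw.memLp_deriv 0) hφ)] at this
  · have := h.setIntegral_eq_boundary hw 1 hφ
    rwa [integral_add (hI hw.memLp (hφ.partialDeriv 1)) (hI (hw.memLp_deriv 1) hφ)] at this

lemma ae_exists_inEdge (h : IsTriangulated T b) : ∀ᵐ x ∂(boundaryMeasure T),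
    x ∈ frontier T ∧ ∃ j i, (b j).InEdge i x := by
  have h1 : ∀ᵐ x ∂(boundaryMeasure T), x ∈ frontier T :=
    ae_restrict_mem isClosed_frontier.measurableSet
  have h2 := ae_mono h.boundaryMeasure_le (ae_notMem_vertices b)
  filter_upwards [h1, h2] with x hx hv
  exact ⟨hx, h.exists_inEdge_of_mem_frontier hx hv⟩

/-- The integration by parts formulas determine both components of `g` times the normal, and the
normal is nonzero almost everywhere. So the choice inside `trace` is immaterial. -/
lemma isTrace_ae_eq (h : IsTriangulated T b) {g g' : Plane → ℝ} (hg : IsTrace T w g)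
    (hg' : IsTrace T w g') : g =ᵐ[boundaryMeasure T] g' := by
  have hfin : IsFiniteMeasure (boundaryMeasure T) :=
    isFiniteMeasure_of_le _ h.boundaryMeasure_le
  have hnm (k : Fin 2) (x : Plane) : |outwardNormal T x k| ≤ 1 := by
    by_cases hex : ∃ n, IsOutwardNormal T x n
    · obtain ⟨n, hn⟩ := hex
      rw [hn.outwardNormal_eq]
      have := PiLp.norm_apply_le n k
      rwa [hn.1, Real.norm_eq_abs] at this
    · unfold outwardNormal
      rw [dif_neg hex]
      simp
  -- `outwardNormal` is defined by choice; its measurability comes from agreeing almost everywhere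
  -- with constants glued edge by edge.
  have hms (k : Fin 2) : AEStronglyMeasurable (fun x => outwardNormal T x k)
      (boundaryMeasure T) := by
    have hs : MemLp (edgeSum b (fun e _ => (b e.1).normal e.2 k)) 2 (boundaryMeasure T) :=
      (memLp_edgeSum fun e => memLp_const _).1.mono_measure h.boundaryMeasure_le
    refine hs.1.congr ?_
    filter_upwards [h.ae_exists_inEdge] with x ⟨hx, j, i, hji⟩
    rw [h.edgeSum_of_mem_frontier hx hji, (h.isOutwardNormal hx hji).outwardNormal_eq]
  have hint (k : Fin 2) {g : Plane → ℝ} (hg : MemLp g 2 (boundaryMeasure T)) :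
      Integrable (fun x => g x * outwardNormal T x k) (boundaryMeasure T) :=
    (hg.integrable (by norm_num)).mul_bdd (c := 1) (hms k) (ae_of_all _ (hnm k))
  have key (k : Fin 2) (hk : ∀ φ : Plane → ℝ, ContDiff ℝ ∞ φ → HasCompactSupport φ →
      ∫ x, g x * φ x * outwardNormal T x k ∂(boundaryMeasure T) =
        ∫ x, g' x * φ x * outwardNormal T x k ∂(boundaryMeasure T)) :
      ∀ᵐ x ∂(boundaryMeasure T), g x * outwardNormal T x k - g' x * outwardNormal T x k = 0 := by
    have hd := (hint k hg.2.1).sub (hint k hg'.2.1)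
    refine ae_eq_zero_of_integral_contDiff_smul_eq_zero hd.locallyIntegrable fun φ h1 h2 => ?_
    obtain ⟨M, hM⟩ := h2.exists_bound_of_continuous h1.continuous
    have hi {g : Plane → ℝ} (hg : MemLp g 2 (boundaryMeasure T)) :
        Integrable (fun x => g x * φ x * outwardNormal T x k) (boundaryMeasure T) := by
      refine ((hint k hg).mul_bdd (c := M) h1.continuous.aestronglyMeasurable
        (ae_of_all _ hM)).congr (ae_of_all _ fun x => ?_)
      simp only; ring
    have := sub_eq_zero.2 (hk φ h1 h2)
    rw [← integral_sub (hi hg.2.1) (hi hg'.2.1)] at this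
    rw [← this]
    refine integral_congr_ae (ae_of_all _ fun x => ?_)
    simp only [smul_eq_mul]
    ring
  have k0 := key 0 fun φ h1 h2 => ((hg.2.2 φ h1 h2).1).symm.trans (hg'.2.2 φ h1 h2).1
  have k1 := key 1 fun φ h1 h2 => ((hg.2.2 φ h1 h2).2).symm.trans (hg'.2.2 φ h1 h2).2
  filter_upwards [k0, k1, h.ae_exists_inEdge] with x h0 h1 ⟨hx, j, i, hji⟩
  have hn := h.isOutwardNormal hx hji
  rw [hn.outwardNormal_eq, ← sub_mul] at h0 h1
  by_contra hne
  have hz : (b j).normal i = 0 := by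
    ext k
    fin_cases k
    · exact (mul_eq_zero.1 h0).resolve_left (sub_ne_zero.2 hne)
    · exact (mul_eq_zero.1 h1).resolve_left (sub_ne_zero.2 hne)
  have := (b j).norm_normal i
  rw [hz, norm_zero] at this
  exact zero_ne_one this

/-- The trace inequality, with the traces on the edges of the triangles. -/
lemma hasTrace (h : IsTriangulated T b) (hs : MemSobolev T 1 w) :
    HasTrace T w ∧ lpNorm (trace T w) 2 (boundaryMeasure T) ≤
      ∑ e : ι × Fin 3, lpNorm ((b e.1).edgeTrace e.2 w fun i => weakDeriv T (unitIndex i) w) 2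
        ((b e.1).edgeMeasure e.2) := by
  have ht := h.isTrace hs
  have hex : HasTrace T w := ⟨_, ht⟩
  refine ⟨hex, ?_⟩
  have hw := hs.isSobolevOne_self h.isOpen
  have hc : IsTrace T w (trace T w) := by
    unfold trace
    rw [dif_pos hex]
    exact hex.choose_spec
  rw [lpNorm_congr_ae (h.isTrace_ae_eq hc ht)]
  obtain ⟨h1, h2⟩ := memLp_edgeSum (b := b)
    (f := fun e => (b e.1).edgeTrace e.2 w fun i => weakDeriv T (unitIndex i) w)
    fun e => ((hw.mono (h.interior_subset e.1)).memLp_edgeTrace e.2).1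
  refine le_trans ?_ h2
  rw [← toReal_eLpNorm h1.1, ← toReal_eLpNorm (h1.mono_measure h.boundaryMeasure_le).1]
  exact ENNReal.toReal_mono h1.2.ne (eLpNorm_mono_measure _ h.boundaryMeasure_le)

end trace

end IsTriangulated

/-! ### The Poincaré inequality on triangulated domains -/

lemma le_of_sq_le_sq {x y : ℝ} (h : x ^ 2 ≤ y ^ 2) (hy : 0 ≤ y) : x ≤ y :=
  (le_abs_self x).trans (abs_le_of_sq_le_sq h hy)

/-- The disc is homeomorphic to the plane, and the complement of a countable set in the plane is
connected. -/
lemma isPreconnected_ball_diff_finite (x : Plane) {r : ℝ} (hr : 0 < r) {V : Set Plane}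
    (hV : V.Finite) : IsPreconnected (Metric.ball x r \ V) := by
  set F := OpenPartialHomeomorph.univBall x r
  have hs : F.source = Set.univ := OpenPartialHomeomorph.univBall_source x r
  have ht : F.target = Metric.ball x r := OpenPartialHomeomorph.univBall_target x hr
  have hinj : Function.Injective F := by
    rw [← Set.injOn_univ, ← hs]; exact F.injOn
  have hfin : (F ⁻¹' V).Finite := hV.preimage hinj.injOn
  have hrank : 1 < Module.rank ℝ Plane := by
    apply Module.one_lt_rank_of_one_lt_finrank
    simp
  have := (hfin.countable.isConnected_compl_of_one_lt_rank hrank).isPreconnected.image F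
    (OpenPartialHomeomorph.continuous_univBall x r).continuousOn
  convert this using 1
  ext y
  constructor
  · rintro ⟨hy, hyV⟩
    rw [← ht] at hy
    exact ⟨F.symm y, by simpa [F.right_inv hy] using hyV, F.right_inv hy⟩
  · rintro ⟨z, hz, rfl⟩
    exact ⟨by rw [← ht]; exact F.map_source (by rw [hs]; trivial), hz⟩

namespace IsTriangulated

variable {T : Set Plane} {ι : Type} {b : ι → Tri}

/-- The graph whose edges join the triangles on opposite sides of a common edge. -/
def adjGraph (b : ι → Tri) : SimpleGraph ι :=
  SimpleGraph.fromRel fun j j' => ∃ i i' c, Opposite (b j) (b j') i i' c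

/-- Otherwise the triangles split into a component and the rest, with closed unions meeting at
vertices only, since a shared edge would join them. Finitely many points do not disconnect a disc,
so `T` would be disconnected. -/
lemma preconnected [Finite ι] (h : IsTriangulated T b) : (adjGraph b).Preconnected := by
  intro j0 j1
  by_contra hnot
  set A : Set ι := {j | (adjGraph b).Reachable j0 j}
  set FA : Set Plane := ⋃ j ∈ A, (b j).hull
  set FB : Set Plane := ⋃ j ∈ Aᶜ, (b j).hull
  have hFA : IsClosed FA :=
    (Set.toFinite A).isClosed_biUnion fun j _ => (b j).isCompact_hull.isClosed
  have hFB : IsClosed FB :=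
    (Set.toFinite Aᶜ).isClosed_biUnion fun j _ => (b j).isCompact_hull.isClosed
  have hV := finite_vertices b
  have hAB : FA ∩ FB ⊆ vertices b := by
    rintro x ⟨hxA, hxB⟩
    by_contra hv
    obtain ⟨j, hj, hjx⟩ := Set.mem_iUnion₂.1 hxA
    obtain ⟨j', hj', hjx'⟩ := Set.mem_iUnion₂.1 hxB
    have hne : j ≠ j' := fun he => hj' (he ▸ hj)
    obtain ⟨i, hi⟩ := inEdge_of_mem_hull hjx
      (fun hint => hne (h.eq_of_mem_interior hint hjx')) hv
    rcases h.eq_or_opposite hi hjx' with he | ⟨i', c, ho⟩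
    · exact hne he
    · refine hj' (SimpleGraph.Reachable.trans hj (SimpleGraph.Adj.reachable ?_))
      exact (SimpleGraph.fromRel_adj _ _ _).2 ⟨hne, Or.inl ⟨i, i', c, ho⟩⟩
  have hcover : T ⊆ FA ∪ FB := by
    intro x hx
    have hx' := subset_closure hx
    rw [h.closure_eq] at hx'
    obtain ⟨j, hj⟩ := Set.mem_iUnion.1 hx'
    by_cases hA : j ∈ A
    · exact Or.inl (Set.mem_iUnion₂.2 ⟨j, hA, hj⟩)
    · exact Or.inr (Set.mem_iUnion₂.2 ⟨j, hA, hj⟩)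
  have hVd : Dense (vertices b)ᶜ := by
    have : Nontrivial Plane := inferInstance
    exact hV.countable.dense_compl ℝ
  -- A small disc without the vertices is connected and covered by two closed sets disjoint on it,
  -- so it lies in one of them; by closedness, so does the whole disc.
  have hU : T ⊆ interior FA ∪ interior FB := by
    intro x hx
    obtain ⟨r, hr, hball⟩ := Metric.isOpen_iff.1 h.isOpen x hx
    have hd : Metric.ball x r ⊆ closure (Metric.ball x r \ vertices b) :=
      hVd.open_subset_closure_inter Metric.isOpen_ball
    have hpre := isPreconnected_ball_diff_finite x hr hV
    have hsub : Metric.ball x r \ vertices b ⊆ FA ∨ Metric.ball x r \ vertices b ⊆ FB := by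
      refine (isPreconnected_iff_subset_of_disjoint_closed.1 hpre) FA FB hFA hFB
        (Set.sdiff_subset.trans (hball.trans hcover)) ?_
      rw [Set.eq_empty_iff_forall_notMem]
      exact fun y hy => hy.1.2 (hAB hy.2)
    rcases hsub with hs | hs
    · exact Or.inl (mem_interior_iff_mem_nhds.2 (Filter.mem_of_superset (Metric.ball_mem_nhds x hr)
        (hd.trans (closure_minimal hs hFA))))
    · exact Or.inr (mem_interior_iff_mem_nhds.2 (Filter.mem_of_superset (Metric.ball_mem_nhds x hr)
        (hd.trans (closure_minimal hs hFB))))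
  obtain ⟨x0, hx0⟩ := (b j0).interior_nonempty
  obtain ⟨x1, hx1⟩ := (b j1).interior_nonempty
  have hsub {j : ι} {B : Set ι} (hj : j ∈ B) :
      interior (b j).hull ⊆ interior (⋃ j ∈ B, (b j).hull) :=
    interior_mono (Set.subset_biUnion_of_mem (u := fun j => (b j).hull) hj)
  obtain ⟨y, -, hyA, hyB⟩ := h.isConnected.isPreconnected _ _ isOpen_interior isOpen_interior hU
    ⟨x0, h.interior_subset j0 hx0, hsub (SimpleGraph.Reachable.refl j0 : j0 ∈ A) hx0⟩
    ⟨x1, h.interior_subset j1 hx1, hsub (show j1 ∈ Aᶜ from hnot) hx1⟩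
  -- Connectedness makes the two interiors overlap in a nonempty open set, which contains a point
  -- that is not a vertex.
  obtain ⟨z, hz, hzV⟩ := hVd.inter_open_nonempty _ (isOpen_interior.inter isOpen_interior)
    ⟨y, hyA, hyB⟩
  exact hzV (hAB ⟨_root_.interior_subset hz.1, _root_.interior_subset hz.2⟩)

end IsTriangulated

/-! ### Comparison of mean values along chains of triangles -/

lemma abs_sub_le_of_walk {ι : Type} {G : SimpleGraph ι} {k : ι → ℝ} {δ : ℝ}
    (hG : ∀ j j', G.Adj j j' → |k j - k j'| ≤ δ) {u v : ι} (p : G.Walk u v) :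
    |k u - k v| ≤ p.length * δ := by
  induction p with
  | nil => simp
  | @cons a b c hadj p ih =>
    rw [SimpleGraph.Walk.length_cons]
    push_cast
    have := abs_sub_le (k a) (k b) (k c)
    linarith [hG _ _ hadj]

lemma setIntegral_mul_partialDeriv {U : Set Plane} {φ f : Plane → ℝ} (hφ : IsTest U φ)
    (hf : ContDiff ℝ ∞ f) (i : Fin 2) :
    ∫ x in U, f x * partialDeriv i φ x = -∫ x in U, partialDeriv i f x * φ x := by
  rw [← (hφ.partialDeriv i).setIntegral_eq (Set.subset_univ U),
    ← hφ.setIntegral_eq (Set.subset_univ U), setIntegral_univ, setIntegral_univ]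
  have hφ' : IsTest Set.univ φ := hφ.mono (Set.subset_univ _)
  have hi {f g : Plane → ℝ} (hf : ContDiff ℝ ∞ f) (hg : IsTest Set.univ g) :
      Integrable (fun x => f x * g x) := by
    have := hg.integrableOn_mul
      ((hf.continuous.locallyIntegrable (μ := volume)).locallyIntegrableOn _)
    rwa [integrableOn_univ] at this
  exact integral_mul_fderiv_eq_neg_fderiv_mul_of_integrable
    (hi (contDiff_partialDeriv hf i) hφ') (hi hf (hφ'.partialDeriv i)) (hi hf hφ')
    (fun x _ => hf.differentiable (by simp) x) (fun x _ => hφ.contDiff.differentiable (by simp) x)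

lemma IsSobolevOne.sub_const {U : Set Plane} (hU : Bornology.IsBounded U) {w : Plane → ℝ}
    {D : Fin 2 → Plane → ℝ} (h : IsSobolevOne U w D) (k : ℝ) :
    IsSobolevOne U (fun x => w x - k) D where
  memLp := by
    have : IsFiniteMeasure (volume.restrict U) := ⟨by
      rw [Measure.restrict_apply_univ]; exact hU.measure_lt_top⟩
    exact h.memLp.sub (memLp_const k)
  memLp_deriv := h.memLp_deriv
  integral_eq i φ hφ := by
    have e := setIntegral_mul_partialDeriv hφ (contDiff_const (c := k)) i
    have e0 : partialDeriv i (fun _ : Plane => k) = 0 := by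
      ext x; simp [partialDeriv]
    simp only [e0, Pi.zero_apply, zero_mul, integral_zero, neg_zero] at e
    simp only [sub_mul]
    rw [integral_sub, h.integral_eq i φ hφ, e, sub_zero]
    · exact (hφ.partialDeriv i).integrableOn_mul (locallyIntegrableOn_of_memLp h.memLp)
    · exact (hφ.partialDeriv i).integrableOn_mul
        ((continuous_const.locallyIntegrable (μ := volume)).locallyIntegrableOn _)

lemma Tri.isBounded_interior (b : Tri) : Bornology.IsBounded (interior b.hull) :=
  b.isCompact_hull.isBounded.subset interior_subset

/-- The mean value of the trace over an edge. -/
def Tri.edgeMean (b : Tri) (i : Fin 3) (w : Plane → ℝ) (D : Fin 2 → Plane → ℝ) : ℝ :=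
  (b.length i)⁻¹ * ∫ x, b.edgeTrace i w D x ∂(b.edgeMeasure i)

lemma lpNorm_one_sq {U : Set Plane} (hU : volume U ≠ ⊤) :
    MemLp (fun _ => (1 : ℝ)) 2 (volume.restrict U) ∧
      lpNorm (fun _ => (1 : ℝ)) 2 (volume.restrict U) ^ 2 = volume.real U := by
  have : IsFiniteMeasure (volume.restrict U) := ⟨by
    rw [Measure.restrict_apply_univ]; exact hU.lt_top⟩
  have h := memLp_const (μ := volume.restrict U) (p := 2) (1 : ℝ)
  refine ⟨h, ?_⟩
  rw [lpNorm_sq_eq_integral h]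
  simp

/-- `edge_mean` expresses the mean over the edge as an integral over the triangle, and subtracting a
constant from `w` shifts that mean by the same constant. Cauchy–Schwarz against the function 1 costs
one factor of the area, which cancels. -/
lemma IsSobolevOne.edgeMean_sub_sq_le {b : Tri} {w : Plane → ℝ} {D : Fin 2 → Plane → ℝ}
    (h : IsSobolevOne (interior b.hull) w D) (i : Fin 3) (k : ℝ) :
    4 * b.area * (b.edgeMean i w D - k) ^ 2 ≤
      (2 * lpNorm (fun x => w x - k) 2 (volume.restrict (interior b.hull)) +
        Metric.diam b.hull * ∑ k, lpNorm (D k) 2 (volume.restrict (interior b.hull))) ^ 2 := by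
  have h' := h.sub_const b.isBounded_interior k
  obtain ⟨h1, h2⟩ := h'.memLp_radialDiv i
  obtain ⟨o1, o2⟩ := lpNorm_one_sq b.volume_ne_top
  have e : ∫ x in interior b.hull, radialDiv (fun x => w x - k) D (b i) x * 1 =
      2 * b.area * (b.edgeMean i w D - k) := by
    have e1 : (fun x => radialDiv (fun x => w x - k) D (b i) x * 1) =
        fun x => radialDiv w D (b i) x - 2 * k := by
      ext x; simp only [radialDiv]; ring
    rw [e1, integral_sub ((h.memLp_radialDiv i).1.integrable (by norm_num)) (integrable_const _),
      h.edge_mean i]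
    simp only [integral_const, smul_eq_mul, measureReal_restrict_apply_univ]
    unfold Tri.edgeMean Tri.area
    ring
  have hcs := abs_integral_mul_le h1 o1
  rw [e] at hcs
  have hsq := pow_le_pow_left₀ (abs_nonneg _) hcs 2
  rw [sq_abs, mul_pow (lpNorm _ _ _), o2] at hsq
  have hp := b.area_pos
  have hle := pow_le_pow_left₀ lpNorm_nonneg h2 2
  have h3 : (2 * b.area * (b.edgeMean i w D - k)) ^ 2 =
    b.area * (4 * b.area * (b.edgeMean i w D - k) ^ 2) := by ring
  rw [h3] at hsq
  have h4 : b.area * (4 * b.area * (b.edgeMean i w D - k) ^ 2) ≤ b.area *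
      lpNorm (radialDiv (fun x => w x - k) D (b i)) 2 (volume.restrict (interior b.hull)) ^ 2 := by
    rw [mul_comm b.area (lpNorm _ _ _ ^ 2)]
    exact hsq
  exact (le_of_mul_le_mul_left h4 hp).trans hle

lemma Tri.volume_edgeMeasure (b : Tri) (i : Fin 3) :
    (b.edgeMeasure i).real Set.univ = b.length i := by
  rw [b.edgeMeasure_eq, measureReal_ennreal_smul_apply,
    map_measureReal_apply (b.continuous_edgePt i).measurable MeasurableSet.univ]
  simp [unitMeasure, (b.length_pos i).le]

lemma IsTriangulated.edgeMean_eq {T : Set Plane} {ι : Type} [Fintype ι] {b : ι → Tri}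
    (h : IsTriangulated T b) {w : Plane → ℝ} {D : Fin 2 → Plane → ℝ} (hw : IsSobolevOne T w D)
    {j j' : ι} {i i' : Fin 3} {c : ℝ} (ho : Opposite (b j) (b j') i i' c) :
    (b j).edgeMean i w D = (b j').edgeMean i' w D := by
  have e : (b j).edgeMeasure i = (b j').edgeMeasure i' := by
    unfold Tri.edgeMeasure; rw [ho.edge_eq]
  unfold Tri.edgeMean
  rw [← Tri.volume_edgeMeasure, ← Tri.volume_edgeMeasure,
    integral_congr_ae (h.edgeTrace_ae_eq hw ho),
    e]

lemma Tri.area_le (b : Tri) : b.area ≤ Metric.diam b.hull ^ 2 * discArea := by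
  have hsub : interior b.hull ⊆ Metric.closedBall (b 0) (Metric.diam b.hull) := fun x hx => by
    rw [Metric.mem_closedBall, dist_eq_norm]
    exact b.norm_sub_vertex_le 0 (interior_subset hx)
  have := measureReal_mono (μ := volume) hsub measure_closedBall_lt_top.ne
  rwa [measureReal_def, measureReal_def, volume_closedBall _ Metric.diam_nonneg,
    ENNReal.toReal_ofReal (mul_nonneg (sq_nonneg _) discArea_pos.le)] at this

lemma lpNorm_le_of_integral_eq_zero {U : Set Plane} (hU : volume U ≠ ⊤) {w : Plane → ℝ}
    (hw : MemLp w 2 (volume.restrict U)) (h0 : ∫ x in U, w x = 0) (k : ℝ) :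
    lpNorm w 2 (volume.restrict U) ≤ lpNorm (fun x => w x - k) 2 (volume.restrict U) := by
  have : IsFiniteMeasure (volume.restrict U) := ⟨by
    rw [Measure.restrict_apply_univ]; exact hU.lt_top⟩
  have hk : MemLp (fun x => w x - k) 2 (volume.restrict U) := hw.sub (memLp_const k)
  rw [← pow_le_pow_iff_left₀ lpNorm_nonneg lpNorm_nonneg two_ne_zero, lpNorm_sq_eq_integral hw,
    lpNorm_sq_eq_integral hk]
  have e : (fun x => (w x - k) ^ 2) = fun x => w x ^ 2 + (k ^ 2 - 2 * k * w x) := by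
    ext x; ring
  have hi : Integrable w (volume.restrict U) := hw.integrable (by norm_num)
  have hi2 : Integrable (fun x => k ^ 2 - 2 * k * w x) (volume.restrict U) :=
    (integrable_const _).sub (hi.const_mul _)
  rw [e, integral_add hw.integrable_sq hi2,
    integral_sub (integrable_const _) (hi.const_mul _), integral_const_mul, h0]
  simp only [integral_const, smul_eq_mul, mul_zero, sub_zero]
  have : 0 ≤ (volume.restrict U).real Set.univ * k ^ 2 := by positivity
  linarith

namespace IsTriangulated

variable {T : Set Plane} {ι : Type} [Fintype ι] {b : ι → Tri}

omit [Fintype ι] in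
lemma nonempty (h : IsTriangulated T b) : Nonempty ι := by
  obtain ⟨x, hx⟩ := h.isConnected.nonempty
  have hx' := subset_closure hx
  rw [h.closure_eq] at hx'
  obtain ⟨j, -⟩ := Set.mem_iUnion.1 hx'
  exact ⟨j⟩

lemma diam_hull_le (h : IsTriangulated T b) (j : ι) : Metric.diam (b j).hull ≤ Metric.diam T := by
  rw [← Metric.diam_closure T]
  exact Metric.diam_mono (h.hull_subset j) h.isBounded.closure

lemma diam_pos (h : IsTriangulated T b) : 0 < Metric.diam T := by
  obtain ⟨j⟩ := h.nonempty
  exact ((b j).length_pos 0).trans_le (((b j).length_le_diam 0).trans (h.diam_hull_le j))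

/-- The first constant in the Poincaré inequality: the one on a single triangle. -/
def triConst (c : ℝ) : ℝ := √(discArea / c)

/-- The second constant in the Poincaré inequality: the one in the comparison of the mean values on
a triangle and on one of its edges. -/
def meanConst (c : ℝ) : ℝ := (2 * triConst c + 1) / (2 * √c)

/-- The constant in the Poincaré inequality. -/
def poincareConst (c : ℝ) (N : ℕ) : ℝ :=
  N * (triConst c + N * (2 * meanConst c) * √discArea)

lemma poincareConst_nonneg (c : ℝ) (N : ℕ) : 0 ≤ poincareConst c N := by
  have h1 : 0 ≤ triConst c := Real.sqrt_nonneg _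
  have h2 : 0 ≤ meanConst c := by unfold meanConst; positivity
  unfold poincareConst
  positivity

variable {w : Plane → ℝ} {D : Fin 2 → Plane → ℝ}

/-- Each triangle has its own constant `k j`. For neighbours both constants are close to the mean
over the common edge, hence to each other; along a chain the differences add up, so one constant
serves all triangles. -/
lemma exists_const_lpNorm_le (h : IsTriangulated T b) {c : ℝ} (hc : 0 < c) {N : ℕ}
    (hN : Fintype.card ι ≤ N) (hb : ∀ j, c * Metric.diam T ^ 2 ≤ (b j).area)
    (hw : IsSobolevOne T w D) : ∃ k : ℝ, lpNorm (fun x => w x - k) 2 (volume.restrict T) ≤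
      poincareConst c N * Metric.diam T * ∑ i, lpNorm (D i) 2 (volume.restrict T) := by
  set d := Metric.diam T
  have hd : 0 < d := h.diam_pos
  set G := ∑ i, lpNorm (D i) 2 (volume.restrict T)
  have hG : 0 ≤ G := Finset.sum_nonneg fun i _ => lpNorm_nonneg
  have hD (j : ι) (i : Fin 2) : lpNorm (D i) 2 (volume.restrict (interior (b j).hull)) ≤
      lpNorm (D i) 2 (volume.restrict T) :=
    lpNorm_restrict_le (hw.memLp_deriv i) (Measure.restrict_mono (h.interior_subset j) le_rfl)
  have hGj (j : ι) : ∑ i, lpNorm (D i) 2 (volume.restrict (interior (b j).hull)) ≤ G :=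
    Finset.sum_le_sum fun i _ => hD j i
  have hdisc := discArea_pos
  have hC1 : 0 ≤ triConst c := Real.sqrt_nonneg _
  have hC2 : 0 ≤ meanConst c := by unfold meanConst; positivity
  have hC1s : triConst c ^ 2 = discArea / c := Real.sq_sqrt (by positivity)
  have hC2s : 4 * c * meanConst c ^ 2 = (2 * triConst c + 1) ^ 2 := by
    unfold meanConst
    rw [div_pow, mul_pow 2, Real.sq_sqrt hc.le]
    field_simp
    norm_num
  have hk (j : ι) : ∃ k : ℝ, lpNorm (fun x => w x - k) 2
      (volume.restrict (interior (b j).hull)) ≤ triConst c * d * G := by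
    obtain ⟨k, hk⟩ := (hw.mono (h.interior_subset j)).exists_const_lpNorm_le isOpen_interior
      (b j).convex_hull.interior (b j).interior_nonempty (d := d) hd.le
      (fun x hx y hy => (Metric.dist_le_diam_of_mem (b j).isCompact_hull.isBounded
        (_root_.interior_subset hx) (_root_.interior_subset hy)).trans (h.diam_hull_le j))
    refine ⟨k, ?_⟩
    have h1 : ∑ i, lpNorm (D i) 2 (volume.restrict (interior (b j).hull)) ^ 2 ≤ G ^ 2 :=
      (Finset.sum_sq_le_sq_sum_of_nonneg fun i _ => lpNorm_nonneg).trans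
        (pow_le_pow_left₀ (Finset.sum_nonneg fun i _ => lpNorm_nonneg) (hGj j) 2)
    rw [← pow_le_pow_iff_left₀ lpNorm_nonneg (by positivity) two_ne_zero]
    have h2 : c * d ^ 2 * lpNorm (fun x => w x - k) 2
        (volume.restrict (interior (b j).hull)) ^ 2 ≤ d ^ 4 * discArea * G ^ 2 :=
      (mul_le_mul_of_nonneg_right (hb j) (sq_nonneg _)).trans
        (hk.trans (mul_le_mul_of_nonneg_left h1 (by positivity)))
    have h3 : c * d ^ 2 * (triConst c * d * G) ^ 2 = d ^ 4 * discArea * G ^ 2 := by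
      rw [mul_pow, mul_pow, hC1s]; field_simp
    rw [← h3] at h2
    exact le_of_mul_le_mul_left h2 (by positivity)
  choose k hk using hk
  have hmean (j : ι) (i : Fin 3) : |(b j).edgeMean i w D - k j| ≤ meanConst c * G := by
    have h1 := (hw.mono (h.interior_subset j)).edgeMean_sub_sq_le i (k j)
    have h2 : 2 * lpNorm (fun x => w x - k j) 2 (volume.restrict (interior (b j).hull)) +
        Metric.diam (b j).hull * ∑ k, lpNorm (D k) 2 (volume.restrict (interior (b j).hull)) ≤
        (2 * triConst c + 1) * d * G := by
      have h3 := mul_le_mul (h.diam_hull_le j) (hGj j)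
        (Finset.sum_nonneg fun i _ => lpNorm_nonneg) hd.le
      linarith [hk j]
    have h4 := h1.trans (pow_le_pow_left₀ (add_nonneg (mul_nonneg zero_le_two lpNorm_nonneg)
      (mul_nonneg Metric.diam_nonneg (Finset.sum_nonneg fun i _ => lpNorm_nonneg))) h2 2)
    have h5 : 4 * c * d ^ 2 * ((b j).edgeMean i w D - k j) ^ 2 ≤
        4 * c * d ^ 2 * (meanConst c * G) ^ 2 := by
      calc _ = 4 * (c * d ^ 2) * ((b j).edgeMean i w D - k j) ^ 2 := by ring
        _ ≤ 4 * (b j).area * ((b j).edgeMean i w D - k j) ^ 2 := by gcongr; exact hb j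
        _ ≤ ((2 * triConst c + 1) * d * G) ^ 2 := h4
        _ = (2 * triConst c + 1) ^ 2 * d ^ 2 * G ^ 2 := by ring
        _ = 4 * c * d ^ 2 * (meanConst c * G) ^ 2 := by rw [← hC2s]; ring
    exact abs_le_of_sq_le_sq (le_of_mul_le_mul_left h5 (by positivity)) (by positivity)
  have hadj (j j' : ι) (hjj : (adjGraph b).Adj j j') : |k j - k j'| ≤ 2 * meanConst c * G := by
    have key {j j' : ι} {i i' : Fin 3} {c' : ℝ} (ho : Opposite (b j) (b j') i i' c') :
        |k j - k j'| ≤ 2 * meanConst c * G := by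
      have h1 := hmean j i
      have h2 := hmean j' i'
      rw [h.edgeMean_eq hw ho] at h1
      rw [abs_le] at *
      constructor <;> linarith [h1.1, h1.2, h2.1, h2.2]
    rcases ((SimpleGraph.fromRel_adj _ _ _).1 hjj).2 with ⟨i, i', c', ho⟩ | ⟨i, i', c', ho⟩
    · exact key ho
    · rw [abs_sub_comm]; exact key ho
  obtain ⟨j0⟩ := h.nonempty
  have hdiff (j : ι) : |k j - k j0| ≤ N * (2 * meanConst c * G) := by
    classical
    obtain ⟨p⟩ := h.preconnected j j0
    -- A path visits no triangle twice, so its length is less than the number of triangles.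
    have hlen := p.toPath.2.length_lt
    refine (abs_sub_le_of_walk hadj (p.toPath : (adjGraph b).Walk j j0)).trans ?_
    have : ((p.toPath : (adjGraph b).Walk j j0).length : ℝ) ≤ N := by
      exact_mod_cast (hlen.le.trans hN)
    gcongr
  refine ⟨k j0, ?_⟩
  set C3 := triConst c + N * (2 * meanConst c) * √discArea with hC3
  have hC30 : 0 ≤ C3 := by positivity
  have htri (j : ι) : lpNorm (fun x => w x - k j0) 2 (volume.restrict (interior (b j).hull)) ≤
      C3 * d * G := by
    obtain ⟨o1, o2⟩ := lpNorm_one_sq (b j).volume_ne_top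
    have hone : lpNorm (fun _ => (1 : ℝ)) 2 (volume.restrict (interior (b j).hull)) ≤
        d * √discArea := by
      refine le_of_sq_le_sq ?_ (by positivity)
      rw [o2, mul_pow, Real.sq_sqrt hdisc.le]
      refine (b j).area_le.trans ?_
      have := h.diam_hull_le j
      have := Metric.diam_nonneg (s := (b j).hull)
      gcongr
    have hm := ((hw.mono (h.interior_subset j)).sub_const (b j).isBounded_interior (k j)).memLp
    have e : (fun x => w x - k j0) = (fun x => w x - k j) + fun x => (k j - k j0) * 1 := by
      ext x; simp
    rw [e]
    refine (lpNorm_add_le hm (by norm_num)).trans ?_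
    rw [lpNorm_const_mul]
    have h1 := mul_le_mul (hdiff j) hone lpNorm_nonneg (by positivity)
    calc _ ≤ triConst c * d * G + N * (2 * meanConst c * G) * (d * √discArea) :=
          add_le_add (hk j) h1
      _ = C3 * d * G := by rw [hC3]; ring
  have hm := (hw.sub_const h.isBounded (k j0)).memLp
  refine le_of_sq_le_sq ?_ (by have := poincareConst_nonneg c N; positivity)
  rw [h.lpNorm_sq hm]
  -- Used below to replace `N` by `N ^ 2`, so that the square root gives the factor `N` of
  -- `poincareConst`.
  have hN1 : (1 : ℝ) ≤ N := by
    have : Nonempty ι := ⟨j0⟩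
    exact_mod_cast (Fintype.card_pos (α := ι)).trans_le hN
  calc ∑ j, lpNorm (fun x => w x - k j0) 2 (volume.restrict (interior (b j).hull)) ^ 2
      ≤ ∑ _j : ι, (C3 * d * G) ^ 2 :=
        Finset.sum_le_sum fun j _ => pow_le_pow_left₀ lpNorm_nonneg (htri j) 2
    _ = Fintype.card ι * (C3 * d * G) ^ 2 := by simp
    _ ≤ N * (C3 * d * G) ^ 2 := by gcongr
    _ ≤ N ^ 2 * (C3 * d * G) ^ 2 := by
        gcongr
        nlinarith
    _ = (poincareConst c N * d * G) ^ 2 := by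
        unfold poincareConst
        rw [← hC3]; ring

/-- The Poincaré inequality for functions with zero mean value. -/
lemma lpNorm_le (h : IsTriangulated T b) {c : ℝ} (hc : 0 < c) {N : ℕ}
    (hN : Fintype.card ι ≤ N) (hb : ∀ j, c * Metric.diam T ^ 2 ≤ (b j).area)
    (hw : IsSobolevOne T w D) (h0 : ∫ x in T, w x = 0) : lpNorm w 2 (volume.restrict T) ≤
      poincareConst c N * Metric.diam T * ∑ i, lpNorm (D i) 2 (volume.restrict T) := by
  obtain ⟨k, hk⟩ := h.exists_const_lpNorm_le hc hN hb hw
  exact (lpNorm_le_of_integral_eq_zero h.isBounded.measure_lt_top.ne hw.memLp h0 k).trans hk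

end IsTriangulated

/-! ### Domains with uniform analytic constants -/

/-- Bounded open sets containing a disc of comparable size, on which the Poincaré inequality and the
trace inequality hold with the constant `C`. -/
structure IsAdmissible (T : Set Plane) (C ρ : ℝ) : Prop where
  isOpen : IsOpen T
  isBounded : Bornology.IsBounded T
  diam_pos : 0 < Metric.diam T
  exists_closedBall_subset : ∃ x, Metric.closedBall x (ρ * Metric.diam T) ⊆ T
  poincare : ∀ (w : Plane → ℝ) (D : Fin 2 → Plane → ℝ), IsSobolevOne T w D →
    ∫ x in T, w x = 0 → lpNorm w 2 (volume.restrict T) ≤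
      C * Metric.diam T * ∑ i, lpNorm (D i) 2 (volume.restrict T)
  trace : ∀ w : Plane → ℝ, MemSobolev T 1 w → HasTrace T w ∧
    √(Metric.diam T) * lpNorm (EnergyProj.trace T w) 2 (boundaryMeasure T) ≤
      C * (lpNorm w 2 (volume.restrict T) + Metric.diam T *
        ∑ i, lpNorm (weakDeriv T (unitIndex i) w) 2 (volume.restrict T))

/-- The trace bound is the edgewise one summed over three edges for each of at most `N` triangles,
with every area bounded below by `c` times the squared diameter of `T`. -/
lemma IsTriangulated.isAdmissible {T : Set Plane} {ι : Type} [Fintype ι] {b : ι → Tri}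
    (h : IsTriangulated T b) {c : ℝ} (hc : 0 < c) {N : ℕ} (hN : Fintype.card ι ≤ N)
    (hb : ∀ j, c * Metric.diam T ^ 2 ≤ (b j).area) {ρ : ℝ}
    (hρ : ∃ x, Metric.closedBall x (ρ * Metric.diam T) ⊆ T) :
    IsAdmissible T (max (poincareConst c N) (3 * N / √c)) ρ where
  isOpen := h.isOpen
  isBounded := h.isBounded
  diam_pos := h.diam_pos
  exists_closedBall_subset := hρ
  poincare w D hw h0 := by
    refine (h.lpNorm_le hc hN hb hw h0).trans ?_
    have := h.diam_pos
    have : 0 ≤ ∑ i, lpNorm (D i) 2 (volume.restrict T) :=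
      Finset.sum_nonneg fun i _ => lpNorm_nonneg
    gcongr
    exact le_max_left _ _
  trace w hw := by
    obtain ⟨h1, h2⟩ := h.hasTrace hw
    refine ⟨h1, ?_⟩
    have hs := hw.isSobolevOne_self h.isOpen
    set d := Metric.diam T
    have hd : 0 < d := h.diam_pos
    set G := ∑ i, lpNorm (weakDeriv T (unitIndex i) w) 2 (volume.restrict T)
    have hG : 0 ≤ G := Finset.sum_nonneg fun i _ => lpNorm_nonneg
    set W := lpNorm w 2 (volume.restrict T)
    have hW : 0 ≤ W := lpNorm_nonneg
    have hc' := Real.sqrt_pos.2 hc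
    have key (e : ι × Fin 3) : √d * lpNorm ((b e.1).edgeTrace e.2 w
        fun i => weakDeriv T (unitIndex i) w) 2 ((b e.1).edgeMeasure e.2) ≤
        (W + d * G) / √c := by
      have h3 := ((hs.mono (h.interior_subset e.1)).memLp_edgeTrace e.2).2
      set X := lpNorm ((b e.1).edgeTrace e.2 w
        fun i => weakDeriv T (unitIndex i) w) 2 ((b e.1).edgeMeasure e.2)
      have hm : volume.restrict (interior (b e.1).hull) ≤ volume.restrict T :=
        Measure.restrict_mono (h.interior_subset e.1) le_rfl
      have h4 := lpNorm_restrict_le hs.memLp hm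
      have h5 : ∑ k, lpNorm (weakDeriv T (unitIndex k) w) 2
          (volume.restrict (interior (b e.1).hull)) ≤ G :=
        Finset.sum_le_sum fun i _ => lpNorm_restrict_le (hs.memLp_deriv i) hm
      have h50 : 0 ≤ ∑ k, lpNorm (weakDeriv T (unitIndex k) w) 2
          (volume.restrict (interior (b e.1).hull)) :=
        Finset.sum_nonneg fun i _ => lpNorm_nonneg
      have h6 := h.diam_hull_le e.1
      have h7 : 4 * (c * d ^ 2) * X ^ 2 ≤ d * (2 * W + d * G) ^ 2 := by
        calc _ ≤ 4 * (b e.1).area * X ^ 2 := by gcongr; exact hb e.1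
          _ ≤ _ := h3
          _ ≤ _ := by
            have := Metric.diam_nonneg (s := (b e.1).hull)
            have := lpNorm_nonneg (f := w) (p := 2)
              (μ := volume.restrict (interior (b e.1).hull))
            gcongr
      rw [le_div_iff₀ hc']
      refine le_of_sq_le_sq ?_ (by positivity)
      rw [mul_pow, mul_pow, Real.sq_sqrt hd.le, Real.sq_sqrt hc.le]
      -- One factor `d` is divided out; the one left beside `X ^ 2` is the square of the weight
      -- `√d`.
      have h8 : d * (4 * (d * X ^ 2 * c)) ≤ d * (2 * W + d * G) ^ 2 := by
        calc _ = 4 * (c * d ^ 2) * X ^ 2 := by ring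
          _ ≤ _ := h7
      have h9 := le_of_mul_le_mul_left h8 hd
      have h10 : (2 * W + d * G) ^ 2 ≤ (2 * (W + d * G)) ^ 2 := by
        have : 0 ≤ d * G := by positivity
        gcongr
        linarith
      nlinarith
    calc √d * lpNorm (EnergyProj.trace T w) 2 (boundaryMeasure T)
        ≤ √d * ∑ e : ι × Fin 3, lpNorm ((b e.1).edgeTrace e.2 w
            fun i => weakDeriv T (unitIndex i) w) 2 ((b e.1).edgeMeasure e.2) := by gcongr
      _ ≤ ∑ _e : ι × Fin 3, (W + d * G) / √c := by
          rw [Finset.mul_sum]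
          exact Finset.sum_le_sum fun e _ => key e
      _ = (Fintype.card ι * 3) * ((W + d * G) / √c) := by simp
      _ ≤ (N * 3) * ((W + d * G) / √c) := by
          have : 0 ≤ (W + d * G) / √c := by positivity
          have : (Fintype.card ι : ℝ) ≤ N := by exact_mod_cast hN
          gcongr
      _ = 3 * N / √c * (W + d * G) := by ring
      _ ≤ _ := by
          have : 0 ≤ d * G := by positivity
          gcongr
          exact le_max_right _ _

/-! ### Sobolev seminorms on admissible domains -/

lemma sobolevSeminorm_nonneg (T : Set Plane) (m : ℕ) (v : Plane → ℝ) :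
    0 ≤ sobolevSeminorm T m v := Finset.sum_nonneg fun _ _ => lpNorm_nonneg

lemma lpNorm_weakDeriv_le (T : Set Plane) (κ : ℕ × ℕ) (v : Plane → ℝ) :
    lpNorm (weakDeriv T κ v) 2 (volume.restrict T) ≤ sobolevSeminorm T (κ.1 + κ.2) v :=
  Finset.single_le_sum (f := fun κ => lpNorm (weakDeriv T κ v) 2 (volume.restrict T))
    (fun _ _ => lpNorm_nonneg) (Finset.HasAntidiagonal.mem_antidiagonal.2 rfl)

lemma sum_lpNorm_weakDeriv_le (T : Set Plane) (κ : ℕ × ℕ) (v : Plane → ℝ) :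
    ∑ i, lpNorm (weakDeriv T (κ + unitIndex i) v) 2 (volume.restrict T) ≤
      2 * sobolevSeminorm T (κ.1 + κ.2 + 1) v := by
  have h (i : Fin 2) := lpNorm_weakDeriv_le T (κ + unitIndex i) v
  simp only [order_add_unitIndex] at h
  rw [Fin.sum_univ_two]
  linarith [h 0, h 1]

namespace IsAdmissible

variable {T : Set Plane} {C ρ : ℝ}

lemma volume_ne_top (h : IsAdmissible T C ρ) : volume T ≠ ⊤ := h.isBounded.measure_lt_top.ne

lemma isFiniteMeasure (h : IsAdmissible T C ρ) : IsFiniteMeasure (volume.restrict T) :=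
  ⟨by rw [Measure.restrict_apply_univ]; exact h.volume_ne_top.lt_top⟩

/-- The Poincaré inequality for the derivatives of order `m`. -/
lemma sobolevSeminorm_le (h : IsAdmissible T C ρ) (hC : 0 ≤ C) {s m : ℕ} (hm : m < s)
    {v : Plane → ℝ} (hv : MemSobolev T s v)
    (h0 : ∀ κ : ℕ × ℕ, κ.1 + κ.2 = m → ∫ x in T, weakDeriv T κ v x = 0) :
    sobolevSeminorm T m v ≤
      2 * (m + 1) * C * Metric.diam T * sobolevSeminorm T (m + 1) v := by
  have hd := h.diam_pos
  calc sobolevSeminorm T m v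
      ≤ ∑ _κ ∈ Finset.HasAntidiagonal.antidiagonal m,
          C * Metric.diam T * (2 * sobolevSeminorm T (m + 1) v) := by
        refine Finset.sum_le_sum fun κ hκ => ?_
        rw [Finset.HasAntidiagonal.mem_antidiagonal] at hκ
        refine (h.poincare _ _ (hv.isSobolevOne h.isOpen (hκ ▸ hm)) (h0 κ hκ)).trans ?_
        have := sum_lpNorm_weakDeriv_le T κ v
        rw [hκ] at this
        gcongr
    _ = _ := by
        rw [Finset.sum_const, Finset.Nat.card_antidiagonal, nsmul_eq_mul]
        push_cast
        ring

/-- The trace inequality for the derivatives of order `m`. -/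
lemma boundarySeminorm_le (h : IsAdmissible T C ρ) (hC : 0 ≤ C) {s m : ℕ} (hm : m < s)
    {v : Plane → ℝ} (hv : MemSobolev T s v) :
    (∀ κ ∈ Finset.HasAntidiagonal.antidiagonal m, HasTrace T (weakDeriv T κ v)) ∧
      √(Metric.diam T) * boundarySeminorm T m v ≤ 2 * (m + 1) * C * (sobolevSeminorm T m v +
        Metric.diam T * sobolevSeminorm T (m + 1) v) := by
  have hd := h.diam_pos
  have hκ {κ : ℕ × ℕ} (hκ : κ ∈ Finset.HasAntidiagonal.antidiagonal m) :=
    h.trace _ (hv.weakDeriv_memSobolev_one h.isOpen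
      (κ := κ) (by rw [Finset.HasAntidiagonal.mem_antidiagonal] at hκ; omega))
  refine ⟨fun κ h' => (hκ h').1, ?_⟩
  unfold boundarySeminorm
  rw [Finset.mul_sum]
  have h1 := sobolevSeminorm_nonneg T m v
  have h2 := sobolevSeminorm_nonneg T (m + 1) v
  calc _ ≤ ∑ _κ ∈ Finset.HasAntidiagonal.antidiagonal m, C * (sobolevSeminorm T m v +
          Metric.diam T * (2 * sobolevSeminorm T (m + 1) v)) := by
        refine Finset.sum_le_sum fun κ h' => (hκ h').2.trans ?_
        rw [Finset.HasAntidiagonal.mem_antidiagonal] at h'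
        have e (i : Fin 2) : lpNorm (weakDeriv T (unitIndex i) (weakDeriv T κ v)) 2
            (volume.restrict T) = lpNorm (weakDeriv T (κ + unitIndex i) v) 2
            (volume.restrict T) :=
          -- The trace inequality produces `∂ᵢ` of the chosen representative of `∂^κ v`, which
          -- agrees almost everywhere with the derivative of order `m + 1`.
          lpNorm_congr_ae ((hv.isWeakDeriv_partial (h' ▸ hm) i).weakDeriv_ae_eq h.isOpen)
        simp only [e]
        have h3 := sum_lpNorm_weakDeriv_le T κ v
        have h4 := lpNorm_weakDeriv_le T κ v
        rw [h'] at h3 h4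
        gcongr
    _ = (m + 1) * (C * (sobolevSeminorm T m v +
          Metric.diam T * (2 * sobolevSeminorm T (m + 1) v))) := by
        rw [Finset.sum_const, Finset.Nat.card_antidiagonal, nsmul_eq_mul]
        push_cast
        ring
    _ ≤ (m + 1) * (C * (2 * sobolevSeminorm T m v +
          Metric.diam T * (2 * sobolevSeminorm T (m + 1) v))) := by
        gcongr
        linarith
    _ = _ := by ring

end IsAdmissible

/-! ### Polynomial functions -/

open MvPolynomial in
lemma totalDegree_pderiv_le (i : Fin 2) (p : MvPolynomial (Fin 2) ℝ) :
    (pderiv i p).totalDegree ≤ p.totalDegree - 1 := by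
  conv_lhs => rw [p.as_sum, map_sum]
  refine totalDegree_finsetSum_le fun s hs => ?_
  rw [pderiv_monomial]
  by_cases h0 : s i = 0
  · simp [h0]
  · refine (totalDegree_monomial_le _ _).trans ?_
    have h1 := le_totalDegree hs
    have h2 : s = (s - Finsupp.single i 1) + Finsupp.single i 1 := by
      rw [tsub_add_cancel_of_le]
      rw [Finsupp.single_le_iff]; omega
    have h3 : (s.sum fun _ e => e) = ((s - Finsupp.single i 1).sum fun _ e => e) + 1 := by
      conv_lhs => rw [h2]
      rw [Finsupp.sum_add_index' (fun _ => rfl) (fun _ _ _ => rfl)]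
      simp
    change ((s - Finsupp.single i 1).sum fun _ e => e) ≤ _
    omega

open MvPolynomial in
lemma totalDegree_bind₁_le (f : Fin 2 → MvPolynomial (Fin 2) ℝ) (hf : ∀ i, (f i).totalDegree ≤ 1)
    (p : MvPolynomial (Fin 2) ℝ) : (bind₁ f p).totalDegree ≤ p.totalDegree := by
  conv_lhs => rw [p.as_sum, map_sum]
  refine totalDegree_finsetSum_le fun s hs => ?_
  rw [bind₁_monomial]
  refine (totalDegree_mul _ _).trans ?_
  rw [totalDegree_C, zero_add]
  refine (totalDegree_finsetProd _ _).trans ((Finset.sum_le_sum fun i _ => ?_).trans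
    (le_totalDegree hs))
  refine (totalDegree_pow _ _).trans ?_
  exact (Nat.mul_le_mul_left _ (hf i)).trans (mul_one _).le

lemma hasFDerivAt_polyFun (p : MvPolynomial (Fin 2) ℝ) (x : Plane) :
    HasFDerivAt (polyFun p) (∑ i, polyFun (MvPolynomial.pderiv i p) x •
      (EuclideanSpace.proj i : Plane →L[ℝ] ℝ)) x := by
  induction p using MvPolynomial.induction_on with
  | C a =>
    have : polyFun (MvPolynomial.C a) = fun _ => a := by ext y; simp [polyFun]
    rw [this]
    refine (hasFDerivAt_const a x).congr_fderiv ?_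
    simp [polyFun]
  | add p q hp hq =>
    have : polyFun (p + q) = fun y => polyFun p y + polyFun q y := by ext y; simp [polyFun]
    rw [this]
    refine (hp.add hq).congr_fderiv ?_
    rw [← Finset.sum_add_distrib]
    refine Finset.sum_congr rfl fun i _ => ?_
    rw [← add_smul]
    simp [polyFun]
  | mul_X p i hp =>
    have : polyFun (p * MvPolynomial.X i) =
        fun y => polyFun p y * (EuclideanSpace.proj i : Plane →L[ℝ] ℝ) y := by
      ext y; simp [polyFun]
    rw [this]
    refine (hp.mul (EuclideanSpace.proj i : Plane →L[ℝ] ℝ).hasFDerivAt).congr_fderiv ?_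
    ext y
    fin_cases i <;>
    · simp [polyFun, Fin.sum_univ_two, MvPolynomial.pderiv_X]
      ring

lemma contDiff_polyFun (p : MvPolynomial (Fin 2) ℝ) : ContDiff ℝ ∞ (polyFun p) := by
  induction p using MvPolynomial.induction_on with
  | C a =>
    have : polyFun (MvPolynomial.C a) = fun _ => a := by ext y; simp [polyFun]
    rw [this]; exact contDiff_const
  | add p q hp hq =>
    have : polyFun (p + q) = fun y => polyFun p y + polyFun q y := by ext y; simp [polyFun]
    rw [this]; exact hp.add hq
  | mul_X p i hp =>
    have : polyFun (p * MvPolynomial.X i) =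
        fun y => polyFun p y * (EuclideanSpace.proj i : Plane →L[ℝ] ℝ) y := by
      ext y; simp [polyFun]
    rw [this]; exact hp.mul (ContinuousLinearMap.contDiff _)

lemma partialDeriv_polyFun (i : Fin 2) (p : MvPolynomial (Fin 2) ℝ) :
    partialDeriv i (polyFun p) = polyFun (MvPolynomial.pderiv i p) := by
  ext x
  unfold partialDeriv
  rw [(hasFDerivAt_polyFun p x).fderiv]
  fin_cases i <;> simp

/-- The iterated partial derivative of order `κ` of a polynomial. -/
def polyDeriv (κ : ℕ × ℕ) (p : MvPolynomial (Fin 2) ℝ) : MvPolynomial (Fin 2) ℝ :=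
  (MvPolynomial.pderiv 1)^[κ.2] ((MvPolynomial.pderiv 0)^[κ.1] p)

lemma totalDegree_polyDeriv_le (κ : ℕ × ℕ) (p : MvPolynomial (Fin 2) ℝ) :
    (polyDeriv κ p).totalDegree ≤ p.totalDegree - (κ.1 + κ.2) := by
  have key (i : Fin 2) (n : ℕ) (p : MvPolynomial (Fin 2) ℝ) :
      ((MvPolynomial.pderiv i)^[n] p).totalDegree ≤ p.totalDegree - n := by
    induction n with
    | zero => simp
    | succ n ih =>
      rw [Function.iterate_succ_apply']
      have := totalDegree_pderiv_le i ((MvPolynomial.pderiv i)^[n] p)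
      omega
  have h1 := key 0 κ.1 p
  have h2 := key 1 κ.2 ((MvPolynomial.pderiv 0)^[κ.1] p)
  unfold polyDeriv
  omega

lemma polyDeriv_eq_zero {κ : ℕ × ℕ} {p : MvPolynomial (Fin 2) ℝ}
    (h : p.totalDegree < κ.1 + κ.2) : polyDeriv κ p = 0 := by
  have key (i : Fin 2) (p : MvPolynomial (Fin 2) ℝ) (hp : p.totalDegree = 0) :
      MvPolynomial.pderiv i p = 0 := by
    rw [MvPolynomial.totalDegree_eq_zero_iff_eq_C] at hp
    rw [hp, MvPolynomial.pderiv_C]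
  rcases κ with ⟨a, _ | c⟩
  · rcases a with _ | a
    · simp at h
    · have h1 := totalDegree_polyDeriv_le (a, 0) p
      unfold polyDeriv at h1 ⊢
      simp only [Function.iterate_zero, id_eq, Function.iterate_succ_apply'] at h1 ⊢
      simp only at h
      exact key 0 _ (by omega)
  · have h1 := totalDegree_polyDeriv_le (a, c) p
    unfold polyDeriv at h1 ⊢
    simp only [Function.iterate_succ_apply'] at h1 ⊢
    simp only at h
    exact key 1 _ (by omega)

lemma polyDeriv_add (κ : ℕ × ℕ) (p q : MvPolynomial (Fin 2) ℝ) :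
    polyDeriv κ (p + q) = polyDeriv κ p + polyDeriv κ q := by
  simp only [polyDeriv, iterate_map_add]

lemma polyDeriv_smul (κ : ℕ × ℕ) (c : ℝ) (p : MvPolynomial (Fin 2) ℝ) :
    polyDeriv κ (c • p) = c • polyDeriv κ p := by
  have key (i : Fin 2) (n : ℕ) (p : MvPolynomial (Fin 2) ℝ) :
      (MvPolynomial.pderiv i)^[n] (c • p) = c • (MvPolynomial.pderiv i)^[n] p := by
    induction n with
    | zero => rfl
    | succ n ih =>
      rw [Function.iterate_succ_apply', Function.iterate_succ_apply', ih, Derivation.map_smul]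
  simp only [polyDeriv, key]

lemma polyFun_add (p q : MvPolynomial (Fin 2) ℝ) (x : Plane) :
    polyFun (p + q) x = polyFun p x + polyFun q x := by simp [polyFun]

lemma polyFun_sub (p q : MvPolynomial (Fin 2) ℝ) (x : Plane) :
    polyFun (p - q) x = polyFun p x - polyFun q x := by simp [polyFun]

lemma polyFun_smul (c : ℝ) (p : MvPolynomial (Fin 2) ℝ) (x : Plane) :
    polyFun (c • p) x = c * polyFun p x := by simp [polyFun]

lemma polyFun_zero (x : Plane) : polyFun 0 x = 0 := by simp [polyFun]

lemma isWeakDeriv_polyFun (U : Set Plane) (κ : ℕ × ℕ) (p : MvPolynomial (Fin 2) ℝ) :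
    IsWeakDeriv U κ (polyFun p) (polyFun (polyDeriv κ p)) := by
  have hl (p : MvPolynomial (Fin 2) ℝ) : LocallyIntegrableOn (polyFun p) U :=
    ((contDiff_polyFun p).continuous.locallyIntegrable (μ := volume)).locallyIntegrableOn _
  refine ⟨hl _, hl _, fun φ h1 h2 h3 => ?_⟩
  have hφ : IsTest U φ := ⟨h1, h2, h3⟩
  have key (i : Fin 2) (n : ℕ) (p : MvPolynomial (Fin 2) ℝ) {ψ : Plane → ℝ} (hψ : IsTest U ψ) :
      ∫ x in U, polyFun p x * (partialDeriv i)^[n] ψ x =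
        (-1) ^ n * ∫ x in U, polyFun ((MvPolynomial.pderiv i)^[n] p) x * ψ x := by
    induction n generalizing p with
    | zero => simp
    | succ n ih =>
      rw [Function.iterate_succ_apply', setIntegral_mul_partialDeriv (hψ.iterate i n)
        (contDiff_polyFun p), partialDeriv_polyFun, ih, Function.iterate_succ_apply]
      ring
  unfold multiDeriv polyDeriv
  -- The outermost derivative of the test function moves first, so the polynomial receives the
  -- derivatives in the reverse order; `polyDeriv` is defined accordingly.
  rw [key 0 κ.1 p (hφ.iterate 1 κ.2), key 1 κ.2 _ hφ]
  ring

lemma memLp_polyFun {U : Set Plane} (hU : Bornology.IsBounded U) (p : MvPolynomial (Fin 2) ℝ) :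
    MemLp (polyFun p) 2 (volume.restrict U) := by
  have hK : IsCompact (closure U) := hU.isCompact_closure
  have hfin : IsFiniteMeasure (volume.restrict (closure U)) := ⟨by
    rw [Measure.restrict_apply_univ]; exact hK.measure_lt_top⟩
  obtain ⟨M, hM⟩ := hK.exists_bound_of_continuousOn (contDiff_polyFun p).continuous.continuousOn
  have : MemLp (polyFun p) 2 (volume.restrict (closure U)) := by
    refine MemLp.of_bound (contDiff_polyFun p).continuous.aestronglyMeasurable M ?_
    filter_upwards [ae_restrict_mem isClosed_closure.measurableSet] with x hx using hM x hx
  exact this.mono_measure (Measure.restrict_mono subset_closure le_rfl)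

lemma memSobolev_polyFun {U : Set Plane} (hU : Bornology.IsBounded U) (s : ℕ)
    (p : MvPolynomial (Fin 2) ℝ) : MemSobolev U s (polyFun p) :=
  ⟨memLp_polyFun hU p, fun κ _ => ⟨_, isWeakDeriv_polyFun U κ p, memLp_polyFun hU _⟩⟩

lemma MemSobolev.sub {U : Set Plane} {s : ℕ} {v w : Plane → ℝ} (hv : MemSobolev U s v)
    (hw : MemSobolev U s w) : MemSobolev U s (fun x => v x - w x) := by
  refine ⟨hv.1.sub hw.1, fun κ hκ => ?_⟩
  obtain ⟨v', h1, h2⟩ := hv.2 κ hκ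
  obtain ⟨w', h3, h4⟩ := hw.2 κ hκ
  exact ⟨_, h1.sub h3, h2.sub h4⟩

lemma sobolevSeminorm_sub_le {U : Set Plane} (hU : IsOpen U) {s m : ℕ} (hm : m ≤ s)
    {v w : Plane → ℝ} (hv : MemSobolev U s v) (hw : MemSobolev U s w) :
    sobolevSeminorm U m (fun x => v x - w x) ≤ sobolevSeminorm U m v + sobolevSeminorm U m w := by
  unfold sobolevSeminorm
  rw [← Finset.sum_add_distrib]
  refine Finset.sum_le_sum fun κ hκ => ?_
  rw [Finset.HasAntidiagonal.mem_antidiagonal] at hκ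
  have h1 := hv.isWeakDeriv (hκ.trans_le hm)
  have h2 := hw.isWeakDeriv (hκ.trans_le hm)
  rw [lpNorm_congr_ae ((h1.sub h2).weakDeriv_ae_eq hU)]
  exact lpNorm_sub_le (hv.memLp_weakDeriv hU (hκ.trans_le hm)) (by norm_num)

lemma sobolevSeminorm_polyFun {U : Set Plane} (hU : IsOpen U) (m : ℕ)
    (p : MvPolynomial (Fin 2) ℝ) : sobolevSeminorm U m (polyFun p) =
      ∑ κ ∈ Finset.HasAntidiagonal.antidiagonal m,
        lpNorm (polyFun (polyDeriv κ p)) 2 (volume.restrict U) :=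
  Finset.sum_congr rfl fun κ _ => lpNorm_congr_ae ((isWeakDeriv_polyFun U κ p).weakDeriv_ae_eq hU)

lemma sobolevSeminorm_polyFun_eq_zero {U : Set Plane} (hU : IsOpen U) {m : ℕ}
    {p : MvPolynomial (Fin 2) ℝ} (h : p.totalDegree < m) : sobolevSeminorm U m (polyFun p) = 0 := by
  rw [sobolevSeminorm_polyFun hU]
  refine Finset.sum_eq_zero fun κ hκ => ?_
  rw [Finset.HasAntidiagonal.mem_antidiagonal] at hκ
  rw [polyDeriv_eq_zero (hκ ▸ h)]
  have : polyFun 0 = 0 := funext polyFun_zero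
  rw [this]
  simp

/-- A polynomial whose `L²` norm on a nonempty open set vanishes is zero. -/
lemma eq_zero_of_lpNorm_polyFun {U : Set Plane} (hU : IsOpen U) (hUn : U.Nonempty)
    {p : MvPolynomial (Fin 2) ℝ} (hp : MemLp (polyFun p) 2 (volume.restrict U))
    (h : lpNorm (polyFun p) 2 (volume.restrict U) = 0) : p = 0 := by
  rw [lpNorm_eq_zero hp (by norm_num)] at h
  have hon : Set.EqOn (polyFun p) 0 U :=
    Measure.eqOn_open_of_ae_eq h hU (contDiff_polyFun p).continuous.continuousOn continuousOn_const
  obtain ⟨x, hx⟩ := hUn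
  have hU' : IsOpen ((WithLp.toLp 2 : (Fin 2 → ℝ) → Plane) ⁻¹' U) :=
    hU.preimage (PiLp.continuous_toLp 2 _)
  obtain ⟨r, hr, hball⟩ := Metric.isOpen_iff.1 hU' x.ofLp hx
  -- A ball for the supremum norm is a product of intervals, and a polynomial vanishing on a product
  -- of infinite sets is zero.
  refine MvPolynomial.funext_set (fun i => Metric.ball (x i) r) (fun i => ?_) fun y hy => ?_
  · rw [Real.ball_eq_Ioo]
    exact Set.Ioo_infinite (by linarith)
  · have : y ∈ Metric.ball x.ofLp r := by
      rw [ball_pi _ hr]; exact hy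
    have h2 := hon (hball this)
    simpa [polyFun] using h2

/-! ### Inverse estimates and polynomial approximation -/

/-- The map `Ψ ∘ Φ⁻¹` on the finite-dimensional range of `Φ` is automatically bounded. -/
lemma exists_norm_le_of_injective {V E F : Type*} [AddCommGroup V] [Module ℝ V]
    [FiniteDimensional ℝ V] [NormedAddCommGroup E] [NormedSpace ℝ E] [NormedAddCommGroup F]
    [NormedSpace ℝ F] (Φ : V →ₗ[ℝ] E) (hΦ : Function.Injective Φ) (Ψ : V →ₗ[ℝ] F) :
    ∃ K : ℝ, 0 ≤ K ∧ ∀ v, ‖Ψ v‖ ≤ K * ‖Φ v‖ := by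
  set e := LinearEquiv.ofInjective Φ hΦ
  set L := (Ψ ∘ₗ (e.symm : LinearMap.range Φ →ₗ[ℝ] V)).toContinuousLinearMap
  refine ⟨‖L‖, L.opNorm_nonneg, fun v => ?_⟩
  have := L.le_opNorm (e v)
  simpa [L, e] using this

/-- Polynomials as elements of `L²(U)`. -/
def polyLp {U : Set Plane} (hU : Bornology.IsBounded U) :
    MvPolynomial (Fin 2) ℝ →ₗ[ℝ] Lp ℝ 2 (volume.restrict U) where
  toFun p := (memLp_polyFun hU p).toLp
  map_add' p q := by
    rw [← MemLp.toLp_add]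
    exact MemLp.toLp_congr _ _ (ae_of_all _ fun x => polyFun_add p q x)
  map_smul' c p := by
    rw [RingHom.id_apply, ← MemLp.toLp_const_smul]
    exact MemLp.toLp_congr _ _ (ae_of_all _ fun x => polyFun_smul c p x)

lemma norm_polyLp {U : Set Plane} (hU : Bornology.IsBounded U) (p : MvPolynomial (Fin 2) ℝ) :
    ‖polyLp hU p‖ = lpNorm (polyFun p) 2 (volume.restrict U) := by
  rw [← toReal_eLpNorm (memLp_polyFun hU p).1]
  exact Lp.norm_toLp _ (memLp_polyFun hU p)

lemma eq_zero_of_lpNorm_closedBall {x : Plane} {r : ℝ} (hr : 0 < r) {p : MvPolynomial (Fin 2) ℝ}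
    (h : lpNorm (polyFun p) 2 (volume.restrict (Metric.closedBall x r)) = 0) : p = 0 := by
  have hm : volume.restrict (Metric.ball x r) ≤ volume.restrict (Metric.closedBall x r) :=
    Measure.restrict_mono Metric.ball_subset_closedBall le_rfl
  refine eq_zero_of_lpNorm_polyFun Metric.isOpen_ball ⟨x, Metric.mem_ball_self hr⟩
    (memLp_polyFun Metric.isBounded_ball p) (le_antisymm ?_ lpNorm_nonneg)
  rw [← h]
  exact lpNorm_restrict_le (memLp_polyFun Metric.isBounded_closedBall p) hm

/-- On the finite-dimensional space of polynomials of degree at most `l`, the norm of `L²` on the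
small disc is a norm. Only `l` and `ρ` enter, which makes the constant uniform over all domains
after scaling. -/
lemma exists_inverse_const_unit (l : ℕ) {ρ : ℝ} (hρ : 0 < ρ) : ∃ K : ℝ, 0 ≤ K ∧
    ∀ p : MvPolynomial (Fin 2) ℝ, p.totalDegree ≤ l → ∀ i,
      lpNorm (polyFun (MvPolynomial.pderiv i p)) 2 (volume.restrict (Metric.closedBall 0 1)) ≤
        K * lpNorm (polyFun p) 2 (volume.restrict (Metric.closedBall 0 ρ)) := by
  have hb (r : ℝ) : Bornology.IsBounded (Metric.closedBall (0 : Plane) r) :=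
    Metric.isBounded_closedBall
  set V := MvPolynomial.restrictTotalDegree (Fin 2) ℝ l
  set Φ := polyLp (hb ρ) ∘ₗ V.subtype
  have hΦ : Function.Injective Φ := by
    rw [injective_iff_map_eq_zero]
    intro p hp
    have h0 : ‖Φ p‖ = 0 := by rw [hp, norm_zero]
    have := eq_zero_of_lpNorm_closedBall hρ ((norm_polyLp (hb ρ) p).symm.trans h0)
    exact Subtype.ext this
  have h (i : Fin 2) := exists_norm_le_of_injective Φ hΦ (polyLp (hb 1) ∘ₗ
    (MvPolynomial.pderiv i : Derivation ℝ _ _).toLinearMap ∘ₗ V.subtype)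
  choose K hK hK' using h
  refine ⟨K 0 + K 1, add_nonneg (hK 0) (hK 1), fun p hp i => ?_⟩
  have h1 := hK' i ⟨p, (MvPolynomial.mem_restrictTotalDegree _ _ _).2 hp⟩
  have e1 := norm_polyLp (hb 1) (MvPolynomial.pderiv i p)
  have e2 := norm_polyLp (hb ρ) p
  rw [← e1, ← e2]
  refine h1.trans (mul_le_mul_of_nonneg_right ?_ (norm_nonneg _))
  fin_cases i
  · simpa using hK 1
  · simpa using hK 0

/-- The polynomial `p (x + d y)` in the variable `y`. -/
def polyScale (x : Plane) (d : ℝ) (p : MvPolynomial (Fin 2) ℝ) : MvPolynomial (Fin 2) ℝ :=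
  MvPolynomial.bind₁ (fun i => MvPolynomial.C (x i) + MvPolynomial.C d * MvPolynomial.X i) p

lemma polyFun_polyScale (x : Plane) (d : ℝ) (p : MvPolynomial (Fin 2) ℝ) (y : Plane) :
    polyFun (polyScale x d p) y = polyFun p (x + d • y) := by
  unfold polyFun polyScale
  rw [← MvPolynomial.coe_aeval_eq_eval, ← MvPolynomial.coe_aeval_eq_eval]
  simp only [RingHom.coe_coe, MvPolynomial.aeval_bind₁]
  congr 2
  ext i
  simp

lemma totalDegree_polyScale_le (x : Plane) (d : ℝ) (p : MvPolynomial (Fin 2) ℝ) :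
    (polyScale x d p).totalDegree ≤ p.totalDegree := by
  refine totalDegree_bind₁_le _ (fun i => ?_) p
  refine (MvPolynomial.totalDegree_add _ _).trans (max_le (by simp) ?_)
  refine (MvPolynomial.totalDegree_mul _ _).trans ?_
  simp

lemma pderiv_polyScale (x : Plane) (d : ℝ) (p : MvPolynomial (Fin 2) ℝ) (i : Fin 2) (y : Plane) :
    polyFun (MvPolynomial.pderiv i (polyScale x d p)) y =
      d * polyFun (polyScale x d (MvPolynomial.pderiv i p)) y := by
  rw [polyFun_polyScale, ← partialDeriv_polyFun, ← partialDeriv_polyFun]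
  have e : polyFun (polyScale x d p) = fun y => polyFun p (x + d • y) :=
    funext (polyFun_polyScale x d p)
  rw [e]
  unfold partialDeriv
  have h1 : HasFDerivAt (fun y : Plane => x + d • y) (d • ContinuousLinearMap.id ℝ Plane) y :=
    ((hasFDerivAt_id y).const_smul d).const_add x
  have h2 := (contDiff_polyFun p).differentiable (by simp) (x + d • y)
  have h3 := h2.hasFDerivAt.comp y h1
  have h4 : fderiv ℝ (fun y => polyFun p (x + d • y)) y = _ := h3.fderiv
  rw [h4]
  simp

/-- The Jacobian of the scaling in the plane is `d ^ 2`, hence a factor `d` in the norm. -/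
lemma lpNorm_polyFun_closedBall (x : Plane) {d r : ℝ} (hd : 0 < d) (hr : 0 ≤ r)
    (p : MvPolynomial (Fin 2) ℝ) :
    lpNorm (polyFun p) 2 (volume.restrict (Metric.closedBall x (r * d))) =
      d * lpNorm (polyFun (polyScale x d p)) 2 (volume.restrict (Metric.closedBall 0 r)) := by
  have hb (x : Plane) (r : ℝ) : Bornology.IsBounded (Metric.closedBall x r) :=
    Metric.isBounded_closedBall
  refine (pow_left_inj₀ lpNorm_nonneg (mul_nonneg hd.le lpNorm_nonneg) two_ne_zero).1 ?_
  rw [mul_pow, lpNorm_sq_eq_integral (memLp_polyFun (hb _ _) _),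
    lpNorm_sq_eq_integral (memLp_polyFun (hb _ _) _)]
  simp only [polyFun_polyScale]
  have h1 := Measure.setIntegral_comp_smul_of_pos (volume : Measure Plane)
    (fun z => polyFun p (x + z) ^ 2) (Metric.closedBall 0 r) hd
  rw [h1, smul_closedBall d 0 hr, smul_zero, Real.norm_of_nonneg hd.le]
  have h2 := (measurePreserving_add_left (volume : Measure Plane) x).setIntegral_preimage_emb
    (measurableEmbedding_addLeft x) (fun z => polyFun p z ^ 2) (Metric.closedBall x (r * d))
  have h3 : (fun z => x + z) ⁻¹' Metric.closedBall x (r * d) = Metric.closedBall 0 (d * r) := by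
    ext z
    simp [mul_comm]
  rw [← h2, h3]
  simp only [finrank_euclideanSpace, Fintype.card_fin, smul_eq_mul]
  field_simp

/-- The inverse estimate. -/
lemma exists_inverse_const (l : ℕ) {ρ : ℝ} (hρ : 0 < ρ) : ∃ K : ℝ, 0 ≤ K ∧
    ∀ (T : Set Plane) (C : ℝ), IsAdmissible T C ρ →
    ∀ p : MvPolynomial (Fin 2) ℝ, p.totalDegree ≤ l → ∀ i,
      Metric.diam T * lpNorm (polyFun (MvPolynomial.pderiv i p)) 2 (volume.restrict T) ≤
        K * lpNorm (polyFun p) 2 (volume.restrict T) := by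
  obtain ⟨K, hK, hK'⟩ := exists_inverse_const_unit l hρ
  refine ⟨K, hK, fun T C h p hp i => ?_⟩
  set d := Metric.diam T
  have hd : 0 < d := h.diam_pos
  obtain ⟨x, hx⟩ := h.exists_closedBall_subset
  have hxT : x ∈ T := hx (Metric.mem_closedBall_self (by positivity))
  -- `T` lies between two discs about the same point, of radii `ρ * d` and `d`. The derivative is
  -- estimated on the larger, the polynomial on the smaller.
  have hsub : T ⊆ Metric.closedBall x (1 * d) := fun y hy => by
    rw [one_mul]
    exact Metric.dist_le_diam_of_mem h.isBounded hy hxT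
  have h1 := lpNorm_restrict_le (memLp_polyFun Metric.isBounded_closedBall
    (MvPolynomial.pderiv i p)) (Measure.restrict_mono (μ := volume) hsub le_rfl)
  have h2 := lpNorm_restrict_le (memLp_polyFun h.isBounded p)
    (Measure.restrict_mono (μ := volume) hx le_rfl)
  rw [lpNorm_polyFun_closedBall x hd zero_le_one] at h1
  rw [lpNorm_polyFun_closedBall x hd hρ.le] at h2
  have h3 := hK' (polyScale x d p) ((totalDegree_polyScale_le x d p).trans hp) i
  have e : polyFun (MvPolynomial.pderiv i (polyScale x d p)) =
      fun y => d * polyFun (polyScale x d (MvPolynomial.pderiv i p)) y :=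
    funext (pderiv_polyScale x d p i)
  rw [e, lpNorm_const_mul, abs_of_pos hd] at h3
  calc _ ≤ d * (K * lpNorm (polyFun (polyScale x d p)) 2
        (volume.restrict (Metric.closedBall 0 ρ))) := by gcongr; exact h1.trans h3
    _ = K * (d * lpNorm (polyFun (polyScale x d p)) 2
        (volume.restrict (Metric.closedBall 0 ρ))) := by ring
    _ ≤ _ := by gcongr

/-- Each of the `m + 2` derivatives of order `m + 1` is a first derivative of one of order `m`, to
which the inverse estimate applies. -/
lemma exists_inverse_const_sobolev (l : ℕ) {ρ : ℝ} (hρ : 0 < ρ) : ∃ K : ℝ, 0 ≤ K ∧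
    ∀ (T : Set Plane) (C : ℝ), IsAdmissible T C ρ →
    ∀ p : MvPolynomial (Fin 2) ℝ, p.totalDegree ≤ l → ∀ m : ℕ,
      Metric.diam T * sobolevSeminorm T (m + 1) (polyFun p) ≤
        (m + 2) * K * sobolevSeminorm T m (polyFun p) := by
  obtain ⟨K, hK, hK'⟩ := exists_inverse_const l hρ
  refine ⟨K, hK, fun T C h p hp m => ?_⟩
  have key (κ : ℕ × ℕ) (hκ : κ.1 + κ.2 = m + 1) : Metric.diam T *
      lpNorm (polyFun (polyDeriv κ p)) 2 (volume.restrict T) ≤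
      K * sobolevSeminorm T m (polyFun p) := by
    have h1 (κ : ℕ × ℕ) (hκ : κ.1 + κ.2 = m) (i : Fin 2) : Metric.diam T *
        lpNorm (polyFun (MvPolynomial.pderiv i (polyDeriv κ p))) 2 (volume.restrict T) ≤
        K * sobolevSeminorm T m (polyFun p) := by
      refine (hK' T C h (polyDeriv κ p)
        ((totalDegree_polyDeriv_le κ p).trans ((Nat.sub_le _ _).trans hp)) i).trans ?_
      refine mul_le_mul_of_nonneg_left ?_ hK
      rw [sobolevSeminorm_polyFun h.isOpen]
      exact Finset.single_le_sum (f := fun κ => lpNorm (polyFun (polyDeriv κ p)) 2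
        (volume.restrict T)) (fun _ _ => lpNorm_nonneg)
        (Finset.HasAntidiagonal.mem_antidiagonal.2 hκ)
    -- The derivative applied last is split off: the one in the second variable if there is any,
    -- else one in the first.
    rcases κ with ⟨a, _ | c⟩
    · rcases a with _ | a
      · simp at hκ
      · have h2 := h1 (a, 0) (by simpa using hκ) 0
        simp only [polyDeriv, Function.iterate_zero, id_eq, Function.iterate_succ_apply'] at h2 ⊢
        exact h2
    · have h2 := h1 (a, c) (by simp only at hκ ⊢; omega) 1
      simp only [polyDeriv, Function.iterate_succ_apply'] at h2 ⊢
      exact h2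
  rw [sobolevSeminorm_polyFun h.isOpen, Finset.mul_sum]
  refine (Finset.sum_le_sum fun κ hκ =>
    key κ (Finset.HasAntidiagonal.mem_antidiagonal.1 hκ)).trans (le_of_eq ?_)
  rw [Finset.sum_const, Finset.Nat.card_antidiagonal, nsmul_eq_mul]
  push_cast
  ring

namespace IsAdmissible

variable {T : Set Plane} {C ρ : ℝ}

lemma nonempty (h : IsAdmissible T C ρ) : T.Nonempty := by
  by_contra hcon
  have := h.diam_pos
  rw [Set.not_nonempty_iff_eq_empty.1 hcon, Metric.diam_empty] at this
  exact lt_irrefl _ this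

/-- If the derivatives of order less than `s` have zero mean value, then the lower order seminorms
are controlled by the seminorm of order `s`. -/
lemma sobolevSeminorm_le_pow (h : IsAdmissible T C ρ) (hC : 0 ≤ C) {s : ℕ}
    {v : Plane → ℝ} (hv : MemSobolev T s v)
    (h0 : ∀ κ : ℕ × ℕ, κ.1 + κ.2 < s → ∫ x in T, weakDeriv T κ v x = 0) (k : ℕ) (hk : k ≤ s) :
    sobolevSeminorm T (s - k) v ≤
      (2 * (s + 1) * C * Metric.diam T) ^ k * sobolevSeminorm T s v := by
  have hd := h.diam_pos
  induction k with
  | zero => simp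
  | succ k ih =>
    have h1 := h.sobolevSeminorm_le hC (m := s - (k + 1)) (by omega) hv fun κ hκ =>
      h0 κ (by omega)
    rw [show s - (k + 1) + 1 = s - k by omega] at h1
    have h2 : (((s - (k + 1) : ℕ) : ℝ)) ≤ s := by exact_mod_cast Nat.sub_le _ _
    have := sobolevSeminorm_nonneg T (s - k) v
    calc _ ≤ _ := h1
      _ ≤ 2 * (s + 1) * C * Metric.diam T * sobolevSeminorm T (s - k) v := by gcongr
      _ ≤ 2 * (s + 1) * C * Metric.diam T *
          ((2 * (s + 1) * C * Metric.diam T) ^ k * sobolevSeminorm T s v) := by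
        gcongr
        exact ih (by omega)
      _ = _ := by ring

lemma integral_polyFun_linear (h : IsAdmissible T C ρ) (p q : MvPolynomial (Fin 2) ℝ) :
    ∫ x in T, polyFun (p + q) x = (∫ x in T, polyFun p x) + ∫ x in T, polyFun q x := by
  have := h.isFiniteMeasure
  simp only [polyFun_add]
  exact integral_add ((memLp_polyFun h.isBounded p).integrable (by norm_num))
    ((memLp_polyFun h.isBounded q).integrable (by norm_num))

lemma eq_zero_of_sobolevSeminorm (h : IsAdmissible T C ρ) {p : MvPolynomial (Fin 2) ℝ}
    (hp : sobolevSeminorm T 0 (polyFun p) ≤ 0) : p = 0 := by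
  rw [sobolevSeminorm_polyFun h.isOpen] at hp
  simp only [Finset.HasAntidiagonal.antidiagonal_zero, Finset.sum_singleton] at hp
  exact eq_zero_of_lpNorm_polyFun h.isOpen h.nonempty (memLp_polyFun h.isBounded p)
    (le_antisymm hp lpNorm_nonneg)

/-- Polynomials of degree at most `m` with prescribed integrals of the derivatives of order at
most `m`. -/
lemma exists_poly_integral_eq (h : IsAdmissible T C ρ) (hC : 0 ≤ C) (m : ℕ) (a : ℕ × ℕ → ℝ) :
    ∃ q : MvPolynomial (Fin 2) ℝ, q.totalDegree ≤ m ∧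
      ∀ κ : ℕ × ℕ, κ.1 + κ.2 ≤ m → ∫ x in T, polyFun (polyDeriv κ q) x = a κ := by
  set S : Set (Fin 2 →₀ ℕ) := {n | (n.sum fun _ e => e) ≤ m}
  set V := MvPolynomial.restrictTotalDegree (Fin 2) ℝ m
  have B : Module.Basis S ℝ V := MvPolynomial.basisRestrictSupport ℝ S
  have hS : Finite S := Module.Finite.finite_basis B
  have := Fintype.ofFinite S
  set L : V →ₗ[ℝ] (S → ℝ) :=
    { toFun := fun q n => ∫ x in T, polyFun (polyDeriv (n.1 0, n.1 1) q) x
      map_add' := fun p q => by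
        ext n
        simp only [Submodule.coe_add, polyDeriv_add, h.integral_polyFun_linear, Pi.add_apply]
      map_smul' := fun c p => by
        ext n
        simp only [Submodule.coe_smul, polyDeriv_smul, polyFun_smul, integral_const_mul,
          RingHom.id_apply, Pi.smul_apply, smul_eq_mul] }
  have hκ (κ : ℕ × ℕ) (hκ : κ.1 + κ.2 ≤ m) :
      ∃ n : S, (n.1 0, n.1 1) = κ := by
    refine ⟨⟨Finsupp.equivFunOnFinite.symm ![κ.1, κ.2], ?_⟩, ?_⟩
    · change (Finsupp.sum _ fun _ e => e) ≤ m
      rw [Finsupp.sum_fintype _ _ fun _ => rfl]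
      simpa using hκ
    · simp
  -- If all these integrals vanish, iterated Poincaré bounds the `L²` norm by the seminorm of order
  -- `m + 1`, which is zero for degree at most `m`.
  have hinj : Function.Injective L := by
    rw [injective_iff_map_eq_zero]
    intro q hq
    have hdeg := (MvPolynomial.mem_restrictTotalDegree _ _ _).1 q.2
    have h0 (κ : ℕ × ℕ) (hκm : κ.1 + κ.2 < m + 1) :
        ∫ x in T, weakDeriv T κ (polyFun q) x = 0 := by
      obtain ⟨n, hn⟩ := hκ κ (by omega)
      have := congrFun hq n
      rw [integral_congr_ae ((isWeakDeriv_polyFun T κ q).weakDeriv_ae_eq h.isOpen), ← hn]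
      exact this
    have h1 := h.sobolevSeminorm_le_pow hC (memSobolev_polyFun h.isBounded (m + 1) q.1) h0
      (m + 1) le_rfl
    rw [sobolevSeminorm_polyFun_eq_zero h.isOpen (Nat.lt_succ_of_le hdeg), mul_zero,
      Nat.sub_self] at h1
    exact Subtype.ext (h.eq_zero_of_sobolevSeminorm h1)
  -- There are as many conditions as monomials, so injectivity gives solvability.
  have hfin : Module.finrank ℝ V = Module.finrank ℝ (S → ℝ) := by
    rw [Module.finrank_eq_card_basis B, Module.finrank_fintype_fun_eq_card]
  obtain ⟨q, hq⟩ := (LinearMap.injective_iff_surjective_of_finrank_eq_finrank hfin).1 hinj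
    fun n => a (n.1 0, n.1 1)
  refine ⟨q, (MvPolynomial.mem_restrictTotalDegree _ _ _).1 q.2, fun κ hκm => ?_⟩
  obtain ⟨n, hn⟩ := hκ κ hκm
  have := congrFun hq n
  rw [← hn]
  exact this

/-- Polynomial approximation in Sobolev spaces. -/
lemma exists_poly_approx (h : IsAdmissible T C ρ) (hC : 0 ≤ C) {s : ℕ} (hs : 0 < s)
    {v : Plane → ℝ} (hv : MemSobolev T s v) : ∃ q : MvPolynomial (Fin 2) ℝ, q.totalDegree < s ∧
      ∀ m ≤ s, sobolevSeminorm T m (fun x => v x - polyFun q x) ≤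
        (2 * (s + 1) * C * Metric.diam T) ^ (s - m) * sobolevSeminorm T s v := by
  have hfin := h.isFiniteMeasure
  obtain ⟨q, hq, hint⟩ := h.exists_poly_integral_eq hC (s - 1)
    fun κ => ∫ x in T, weakDeriv T κ v x
  refine ⟨q, by omega, fun m hm => ?_⟩
  have hpol := memSobolev_polyFun h.isBounded s q
  have h0 (κ : ℕ × ℕ) (hκ : κ.1 + κ.2 < s) :
      ∫ x in T, weakDeriv T κ (fun x => v x - polyFun q x) x = 0 := by
    rw [integral_congr_ae (((hv.isWeakDeriv hκ.le).sub
      (isWeakDeriv_polyFun T κ q)).weakDeriv_ae_eq h.isOpen),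
      integral_sub ((hv.memLp_weakDeriv h.isOpen hκ.le).integrable (by norm_num))
      ((memLp_polyFun h.isBounded _).integrable (by norm_num)), hint κ (by omega), sub_self]
  have h1 := h.sobolevSeminorm_le_pow hC (hv.sub hpol) h0 (s - m) (Nat.sub_le _ _)
  rw [Nat.sub_sub_self hm] at h1
  -- As `q` has degree less than `s`, subtracting it does not increase the seminorm of order `s`.
  have h2 := sobolevSeminorm_sub_le h.isOpen le_rfl hv hpol
  rw [sobolevSeminorm_polyFun_eq_zero (p := q) h.isOpen (by omega), add_zero] at h2
  have := h.diam_pos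
  refine h1.trans ?_
  gcongr

end IsAdmissible

/-! ### The energy form -/

/-- The form `(A U, V)` for matrix fields `U` and `V`. -/
def fieldForm (A : Tensor4) (μ : Measure Plane) (U V : Fin 2 → Fin 2 → Plane → ℝ) : ℝ :=
  ∑ i, ∑ j, ∑ k, ∑ l, A i j k l * ∫ x, U k l x * V i j x ∂μ

section fieldForm

variable {A : Tensor4} {μ : Measure Plane} {U V W : Fin 2 → Fin 2 → Plane → ℝ}

lemma fieldForm_eq_integral (A : Tensor4) (hU : ∀ i j, MemLp (U i j) 2 μ)
    (hV : ∀ i j, MemLp (V i j) 2 μ) : fieldForm A μ U V =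
      ∫ x, ∑ i, ∑ j, ∑ k, ∑ l, A i j k l * U k l x * V i j x ∂μ := by
  have hi (i j k l : Fin 2) : Integrable (fun x => A i j k l * U k l x * V i j x) μ := by
    simp only [mul_assoc]
    exact ((hU k l).integrable_mul (hV i j)).const_mul _
  unfold fieldForm
  rw [integral_finsetSum _ fun i _ => integrable_finsetSum _ fun j _ => integrable_finsetSum _
    fun k _ => integrable_finsetSum _ fun l _ => hi i j k l]
  refine Finset.sum_congr rfl fun i _ => ?_
  rw [integral_finsetSum _ fun j _ => integrable_finsetSum _
    fun k _ => integrable_finsetSum _ fun l _ => hi i j k l]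
  refine Finset.sum_congr rfl fun j _ => ?_
  rw [integral_finsetSum _ fun k _ => integrable_finsetSum _ fun l _ => hi i j k l]
  refine Finset.sum_congr rfl fun k _ => ?_
  rw [integral_finsetSum _ fun l _ => hi i j k l]
  refine Finset.sum_congr rfl fun l _ => ?_
  rw [← integral_const_mul]
  simp only [mul_assoc]

lemma fieldForm_add_left (A : Tensor4) (hU : ∀ i j, MemLp (U i j) 2 μ)
    (hV : ∀ i j, MemLp (V i j) 2 μ) (hW : ∀ i j, MemLp (W i j) 2 μ) :
    fieldForm A μ (fun i j x => U i j x + V i j x) W = fieldForm A μ U W + fieldForm A μ V W := by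
  have e (i j k l : Fin 2) : ∫ x, (U k l x + V k l x) * W i j x ∂μ =
      (∫ x, U k l x * W i j x ∂μ) + ∫ x, V k l x * W i j x ∂μ := by
    simp only [add_mul]
    exact integral_add ((hU k l).integrable_mul (hW i j)) ((hV k l).integrable_mul (hW i j))
  simp only [fieldForm, e, mul_add, Finset.sum_add_distrib]

lemma fieldForm_smul_left (A : Tensor4) (c : ℝ) (U W : Fin 2 → Fin 2 → Plane → ℝ) :
    fieldForm A μ (fun i j x => c * U i j x) W = c * fieldForm A μ U W := by
  simp only [fieldForm, mul_assoc, integral_const_mul, mul_left_comm _ c, Finset.mul_sum]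

lemma fieldForm_sub_left (A : Tensor4) (hU : ∀ i j, MemLp (U i j) 2 μ)
    (hV : ∀ i j, MemLp (V i j) 2 μ) (hW : ∀ i j, MemLp (W i j) 2 μ) :
    fieldForm A μ (fun i j x => U i j x - V i j x) W = fieldForm A μ U W - fieldForm A μ V W := by
  have e : (fun i j x => U i j x - V i j x) = fun i j x => U i j x + (-1) * V i j x := by
    ext i j x; ring
  rw [e, fieldForm_add_left A hU (fun i j => (hV i j).const_mul (-1)) hW, fieldForm_smul_left]
  ring

lemma fieldForm_symm {α β : ℝ} (hA : IsElastic α β A) (U V : Fin 2 → Fin 2 → Plane → ℝ) :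
    fieldForm A μ U V = fieldForm A μ V U := by
  unfold fieldForm
  have e (i j k l : Fin 2) : A i j k l * ∫ x, U k l x * V i j x ∂μ =
      A k l i j * ∫ x, V i j x * U k l x ∂μ := by
    rw [hA.symm_major]
    simp only [mul_comm]
  simp only [e, Fin.sum_univ_two]
  ring

lemma sum_lpNorm_sq (hU : ∀ i j, MemLp (U i j) 2 μ) :
    ∑ i, ∑ j, lpNorm (U i j) 2 μ ^ 2 = ∫ x, ∑ i, ∑ j, U i j x ^ 2 ∂μ := by
  rw [integral_finsetSum _ fun i _ => integrable_finsetSum _ fun j _ => (hU i j).integrable_sq]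
  refine Finset.sum_congr rfl fun i _ => ?_
  rw [integral_finsetSum _ fun j _ => (hU i j).integrable_sq]
  exact Finset.sum_congr rfl fun j _ => lpNorm_sq_eq_integral (hU i j)

lemma integrable_form (A : Tensor4) (hU : ∀ i j, MemLp (U i j) 2 μ) :
    Integrable (fun x => ∑ i, ∑ j, ∑ k, ∑ l, A i j k l * U k l x * U i j x) μ := by
  refine integrable_finsetSum _ fun i _ => integrable_finsetSum _ fun j _ => integrable_finsetSum _
    fun k _ => integrable_finsetSum _ fun l _ => ?_
  simp only [mul_assoc]
  exact ((hU k l).integrable_mul (hU i j)).const_mul _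

lemma fieldForm_bounds {α β : ℝ} (hA : IsElastic α β A) (hU : ∀ i j, MemLp (U i j) 2 μ)
    (hs : ∀ i j, U i j = U j i) :
    α * ∑ i, ∑ j, lpNorm (U i j) 2 μ ^ 2 ≤ fieldForm A μ U U ∧
      fieldForm A μ U U ≤ β * ∑ i, ∑ j, lpNorm (U i j) 2 μ ^ 2 := by
  have hsq : Integrable (fun x => ∑ i, ∑ j, U i j x ^ 2) μ :=
    integrable_finsetSum _ fun i _ => integrable_finsetSum _ fun j _ => (hU i j).integrable_sq
  have hsym (x : Plane) : (Matrix.of fun i j => U i j x).IsSymm :=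
    Matrix.IsSymm.ext fun i j => by simp [hs i j]
  rw [sum_lpNorm_sq hU, fieldForm_eq_integral A hU hU, ← integral_const_mul, ← integral_const_mul]
  constructor
  · exact integral_mono (hsq.const_mul α) (integrable_form A hU) fun x => hA.lower _ (hsym x)
  · exact integral_mono (integrable_form A hU) (hsq.const_mul β) fun x => hA.upper _ (hsym x)

end fieldForm

lemma hessIndex_comm (i j : Fin 2) : hessIndex i j = hessIndex j i := by
  simp only [hessIndex, add_comm]

lemma hessIndex_order (i j : Fin 2) : (hessIndex i j).1 + (hessIndex i j).2 = 2 := by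
  fin_cases i <;> fin_cases j <;> rfl

/-- It replaces the chosen weak Hessians by arbitrary representatives and freezes the tensor at its
value on `T`, so that algebra can be done in `fieldForm`. -/
lemma energyForm_eq {A : Plane → Tensor4} {A₀ : Tensor4} {T : Set Plane} (hT : IsOpen T)
    (hA : ∀ x ∈ T, A x = A₀) {u v : Plane → ℝ} {U V : Fin 2 → Fin 2 → Plane → ℝ}
    (hu : ∀ i j, IsWeakDeriv T (hessIndex i j) u (U i j))
    (hv : ∀ i j, IsWeakDeriv T (hessIndex i j) v (V i j))
    (hU : ∀ i j, MemLp (U i j) 2 (volume.restrict T))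
    (hV : ∀ i j, MemLp (V i j) 2 (volume.restrict T)) :
    energyForm A T u v = fieldForm A₀ (volume.restrict T) U V := by
  rw [fieldForm_eq_integral A₀ hU hV]
  unfold energyForm
  have h1 : ∀ᵐ x ∂(volume.restrict T), ∀ i j, weakDeriv T (hessIndex i j) u x = U i j x :=
    ae_all_iff.2 fun i => ae_all_iff.2 fun j => (hu i j).weakDeriv_ae_eq hT
  have h2 : ∀ᵐ x ∂(volume.restrict T), ∀ i j, weakDeriv T (hessIndex i j) v x = V i j x :=
    ae_all_iff.2 fun i => ae_all_iff.2 fun j => (hv i j).weakDeriv_ae_eq hT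
  refine integral_congr_ae ?_
  filter_upwards [h1, h2, ae_restrict_mem hT.measurableSet] with x h1 h2 hx
  simp only [hessian, Matrix.of_apply, h1, h2, hA x hx]

/-- The Hessian of a polynomial function. -/
def polyHess (p : MvPolynomial (Fin 2) ℝ) (i j : Fin 2) : Plane → ℝ :=
  polyFun (polyDeriv (hessIndex i j) p)

/-- The Hessian of a function in `H²(T)`. -/
def weakHess (T : Set Plane) (v : Plane → ℝ) (i j : Fin 2) : Plane → ℝ :=
  weakDeriv T (hessIndex i j) v

lemma polyHess_symm (p : MvPolynomial (Fin 2) ℝ) (i j : Fin 2) :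
    polyHess p i j = polyHess p j i := by
  unfold polyHess; rw [hessIndex_comm]

lemma weakHess_symm (T : Set Plane) (v : Plane → ℝ) (i j : Fin 2) :
    weakHess T v i j = weakHess T v j i := by
  unfold weakHess; rw [hessIndex_comm]

lemma polyHess_add (p q : MvPolynomial (Fin 2) ℝ) :
    polyHess (p + q) = fun i j x => polyHess p i j x + polyHess q i j x := by
  ext i j x
  simp only [polyHess, polyDeriv_add, polyFun_add]

lemma polyHess_smul (c : ℝ) (p : MvPolynomial (Fin 2) ℝ) :
    polyHess (c • p) = fun i j x => c * polyHess p i j x := by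
  ext i j x
  simp only [polyHess, polyDeriv_smul, polyFun_smul]

lemma polyHess_sub (p q : MvPolynomial (Fin 2) ℝ) :
    polyHess (p - q) = fun i j x => polyHess p i j x - polyHess q i j x := by
  have e : p - q = p + (-1 : ℝ) • q := by rw [neg_one_smul, sub_eq_add_neg]
  rw [e, polyHess_add, polyHess_smul]
  ext i j x
  ring

lemma polyHess_eq_zero {p : MvPolynomial (Fin 2) ℝ} (hp : p.totalDegree ≤ 1) :
    polyHess p = fun _ _ _ => 0 := by
  ext i j x
  unfold polyHess
  rw [polyDeriv_eq_zero (by rw [hessIndex_order]; omega), polyFun_zero]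

lemma sobolevSeminorm_two_sq_le (T : Set Plane) (v : Plane → ℝ) :
    sobolevSeminorm T 2 v ^ 2 ≤
      3 * ∑ i, ∑ j, lpNorm (weakHess T v i j) 2 (volume.restrict T) ^ 2 := by
  have e : sobolevSeminorm T 2 v = lpNorm (weakHess T v 1 1) 2 (volume.restrict T) +
      (lpNorm (weakHess T v 0 1) 2 (volume.restrict T) +
        lpNorm (weakHess T v 0 0) 2 (volume.restrict T)) := by
    unfold sobolevSeminorm
    rw [Finset.Nat.sum_antidiagonal_eq_sum_range_succ_mk]
    simp only [Finset.sum_range_succ, Finset.sum_range_zero, zero_add, weakHess]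
    simp only [add_assoc]
    rfl
  rw [e]
  simp only [Fin.sum_univ_two, weakHess_symm T v 1 0]
  set a := lpNorm (weakHess T v 1 1) 2 (volume.restrict T)
  set b := lpNorm (weakHess T v 0 1) 2 (volume.restrict T)
  set c := lpNorm (weakHess T v 0 0) 2 (volume.restrict T)
  -- The inequality `(a + b + c) ^ 2 ≤ 3 (a ^ 2 + b ^ 2 + c ^ 2)`; the Hessian counts the mixed
  -- derivative twice, which only helps.
  nlinarith [sq_nonneg (a - b), sq_nonneg (a - c), sq_nonneg (b - c), sq_nonneg b]

lemma sum_lpNorm_weakHess_sq_le (T : Set Plane) (v : Plane → ℝ) :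
    ∑ i, ∑ j, lpNorm (weakHess T v i j) 2 (volume.restrict T) ^ 2 ≤
      4 * sobolevSeminorm T 2 v ^ 2 := by
  have h (i j : Fin 2) : lpNorm (weakHess T v i j) 2 (volume.restrict T) ^ 2 ≤
      sobolevSeminorm T 2 v ^ 2 := by
    have := lpNorm_weakDeriv_le T (hessIndex i j) v
    rw [hessIndex_order] at this
    exact pow_le_pow_left₀ lpNorm_nonneg this 2
  calc _ ≤ ∑ _i : Fin 2, ∑ _j : Fin 2, sobolevSeminorm T 2 v ^ 2 :=
        Finset.sum_le_sum fun i _ => Finset.sum_le_sum fun j _ => h i j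
    _ = _ := by simp; ring

lemma sobolevSeminorm_zero {T : Set Plane} (hT : IsOpen T) {v : Plane → ℝ}
    (hv : MemLp v 2 (volume.restrict T)) :
    sobolevSeminorm T 0 v = lpNorm v 2 (volume.restrict T) := by
  unfold sobolevSeminorm
  rw [Finset.HasAntidiagonal.antidiagonal_zero, Finset.sum_singleton]
  exact lpNorm_congr_ae ((isWeakDeriv_zero (locallyIntegrableOn_of_memLp hv)).weakDeriv_ae_eq hT)

namespace IsAdmissible

variable {T : Set Plane} {C ρ : ℝ}

/-- Lower order estimates for functions which are orthogonal to the affine functions. -/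
lemma sobolevSeminorm_le_of_orthogonal (h : IsAdmissible T C ρ) (hC : 0 ≤ C) {K : ℝ} (hK : 0 ≤ K)
    (hinv : ∀ p : MvPolynomial (Fin 2) ℝ, p.totalDegree ≤ 1 → Metric.diam T *
      sobolevSeminorm T 1 (polyFun p) ≤ K * sobolevSeminorm T 0 (polyFun p))
    {u : Plane → ℝ} (hu : MemSobolev T 2 u) (horth : ∀ q : MvPolynomial (Fin 2) ℝ,
      q.totalDegree ≤ 1 → ∫ x in T, u x * polyFun q x = 0) :
    sobolevSeminorm T 0 u ≤ (6 * C) ^ 2 * Metric.diam T ^ 2 * sobolevSeminorm T 2 u ∧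
      sobolevSeminorm T 1 u ≤
        (6 * C + K * (6 * C) ^ 2) * Metric.diam T * sobolevSeminorm T 2 u := by
  have hd := h.diam_pos
  set d := Metric.diam T
  obtain ⟨q, hq, happ⟩ := h.exists_poly_approx hC two_pos hu
  have hq1 : q.totalDegree ≤ 1 := by omega
  have hpol := memLp_polyFun h.isBounded q
  have hsub : MemLp (fun x => u x - polyFun q x) 2 (volume.restrict T) := hu.1.sub hpol
  have h0 := happ 0 (by norm_num)
  have h1 := happ 1 (by norm_num)
  push_cast at h0 h1
  norm_num at h0 h1
  rw [sobolevSeminorm_zero h.isOpen hsub] at h0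
  -- Pythagoras: `u` is orthogonal to the affine `q`. Hence the error `u - q` dominates both `u` and
  -- `q` in `L²`. The factor 6 below is `2 * (s + 1)` for `s = 2`.
  have hpy : lpNorm (fun x => u x - polyFun q x) 2 (volume.restrict T) ^ 2 =
      lpNorm u 2 (volume.restrict T) ^ 2 + lpNorm (polyFun q) 2 (volume.restrict T) ^ 2 := by
    rw [lpNorm_sq_eq_integral hsub, lpNorm_sq_eq_integral hu.1, lpNorm_sq_eq_integral hpol,
      ← integral_add hu.1.integrable_sq hpol.integrable_sq]
    have e : (fun x => (u x - polyFun q x) ^ 2) =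
        fun x => (u x ^ 2 + polyFun q x ^ 2) - 2 * (u x * polyFun q x) := by ext x; ring
    rw [e, integral_sub, integral_const_mul, horth q hq1, mul_zero, sub_zero]
    · exact hu.1.integrable_sq.add hpol.integrable_sq
    · exact (hu.1.integrable_mul hpol).const_mul 2
  have hle1 : lpNorm u 2 (volume.restrict T) ≤
      lpNorm (fun x => u x - polyFun q x) 2 (volume.restrict T) :=
    le_of_sq_le_sq (by rw [hpy]; exact le_add_of_nonneg_right (sq_nonneg _)) lpNorm_nonneg
  have hle2 : lpNorm (polyFun q) 2 (volume.restrict T) ≤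
      lpNorm (fun x => u x - polyFun q x) 2 (volume.restrict T) :=
    le_of_sq_le_sq (by rw [hpy]; exact le_add_of_nonneg_left (sq_nonneg _)) lpNorm_nonneg
  set X := sobolevSeminorm T 2 u
  have hX : 0 ≤ X := sobolevSeminorm_nonneg T 2 u
  have e6 : (6 * C * d) ^ 2 * X = (6 * C) ^ 2 * d ^ 2 * X := by ring
  rw [e6] at h0
  refine ⟨?_, ?_⟩
  · rw [sobolevSeminorm_zero h.isOpen hu.1]
    exact hle1.trans h0
  · have hq' := hinv q hq1
    rw [sobolevSeminorm_zero h.isOpen hpol] at hq'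
    have h2 : d * sobolevSeminorm T 1 (polyFun q) ≤ d * (K * (6 * C) ^ 2 * d * X) := by
      calc _ ≤ K * ((6 * C) ^ 2 * d ^ 2 * X) := by
            refine hq'.trans ?_
            gcongr
            exact hle2.trans h0
        _ = _ := by ring
    have h3 := le_of_mul_le_mul_left h2 hd
    have hs := memSobolev_polyFun h.isBounded 2 q
    -- The triangle inequality for `u = (u - q) - (-q)`; the inverse estimate has bounded the
    -- first-order seminorm of `q`.
    have h4 := sobolevSeminorm_sub_le h.isOpen (m := 1) (by norm_num) (hu.sub hs)
      ((memSobolev_polyFun h.isBounded 2 (-q)))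
    have e1 : (fun x => u x - polyFun q x - polyFun (-q) x) = u := by
      ext x; simp [polyFun]
    have e2 : sobolevSeminorm T 1 (polyFun (-q)) ≤ sobolevSeminorm T 1 (polyFun q) := by
      have e3 : polyFun (-q) = fun x => polyFun (0 : MvPolynomial (Fin 2) ℝ) x - polyFun q x := by
        ext x; simp [polyFun]
      rw [e3]
      refine (sobolevSeminorm_sub_le h.isOpen (m := 1) (by norm_num)
        (memSobolev_polyFun h.isBounded 2 0) hs).trans (le_of_eq ?_)
      rw [sobolevSeminorm_polyFun_eq_zero h.isOpen (by simp), zero_add]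
    rw [e1] at h4
    calc _ ≤ 6 * C * d * X + K * (6 * C) ^ 2 * d * X := by linarith
      _ = _ := by ring

end IsAdmissible

/-! ### The energy projection -/

lemma memLp_polyHess {T : Set Plane} (hT : Bornology.IsBounded T) (p : MvPolynomial (Fin 2) ℝ)
    (i j : Fin 2) : MemLp (polyHess p i j) 2 (volume.restrict T) := memLp_polyFun hT _

lemma MemSobolev.memLp_weakHess {T : Set Plane} (hT : IsOpen T) {v : Plane → ℝ}
    (hv : MemSobolev T 2 v) (i j : Fin 2) : MemLp (weakHess T v i j) 2 (volume.restrict T) :=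
  hv.memLp_weakDeriv hT (hessIndex_order i j).le

section energy

variable {A : Plane → Tensor4} {A₀ : Tensor4} {T : Set Plane} {C ρ α β : ℝ}

lemma energyForm_sub_polyFun (hT : IsOpen T) (hb : Bornology.IsBounded T)
    (hA : ∀ x ∈ T, A x = A₀) {v : Plane → ℝ} (hv : MemSobolev T 2 v)
    (p q : MvPolynomial (Fin 2) ℝ) :
    energyForm A T (fun x => polyFun p x - v x) (polyFun q) =
      fieldForm A₀ (volume.restrict T) (polyHess p) (polyHess q) -
        fieldForm A₀ (volume.restrict T) (weakHess T v) (polyHess q) := by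
  rw [← fieldForm_sub_left A₀ (memLp_polyHess hb p) (hv.memLp_weakHess hT) (memLp_polyHess hb q)]
  exact energyForm_eq hT hA
    (fun i j => (isWeakDeriv_polyFun T _ p).sub (hv.isWeakDeriv (hessIndex_order i j).le))
    (fun i j => isWeakDeriv_polyFun T _ q)
    (fun i j => (memLp_polyHess hb p i j).sub (hv.memLp_weakHess hT i j)) (memLp_polyHess hb q)

lemma isEnergyProjection_iff (hT : IsOpen T) (hb : Bornology.IsBounded T)
    (hA : ∀ x ∈ T, A x = A₀) {v : Plane → ℝ} (hv : MemSobolev T 2 v) (l : ℕ)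
    (p : MvPolynomial (Fin 2) ℝ) : IsEnergyProjection A T l v p ↔ p.totalDegree ≤ l ∧
      (∀ q : MvPolynomial (Fin 2) ℝ, q.totalDegree ≤ l →
        fieldForm A₀ (volume.restrict T) (polyHess p) (polyHess q) =
          fieldForm A₀ (volume.restrict T) (weakHess T v) (polyHess q)) ∧
      ∀ q : MvPolynomial (Fin 2) ℝ, q.totalDegree ≤ 1 →
        ∫ x in T, (polyFun p x - v x) * polyFun q x = 0 := by
  unfold IsEnergyProjection IsL2Projection
  simp only [energyForm_sub_polyFun hT hb hA hv, sub_eq_zero (b := fieldForm _ _ _ _), polyFun_zero,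
    zero_sub, neg_mul, integral_neg, neg_eq_zero, MvPolynomial.totalDegree_zero, Nat.zero_le,
    true_and]

lemma sum_lpNorm_polyHess (hT : IsOpen T) (p : MvPolynomial (Fin 2) ℝ) :
    ∑ i, ∑ j, lpNorm (weakHess T (polyFun p) i j) 2 (volume.restrict T) ^ 2 =
      ∑ i, ∑ j, lpNorm (polyHess p i j) 2 (volume.restrict T) ^ 2 :=
  Finset.sum_congr rfl fun i _ => Finset.sum_congr rfl fun j _ => by
    rw [weakHess, polyHess, lpNorm_congr_ae ((isWeakDeriv_polyFun T _ p).weakDeriv_ae_eq hT)]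

/-- The energy of a polynomial controls its second derivatives. -/
lemma sobolevSeminorm_two_le (hT : IsOpen T) (hb : Bornology.IsBounded T) (hE : IsElastic α β A₀)
    (hα : 0 < α) (p : MvPolynomial (Fin 2) ℝ) : sobolevSeminorm T 2 (polyFun p) ^ 2 ≤
      3 / α * fieldForm A₀ (volume.restrict T) (polyHess p) (polyHess p) := by
  have h1 := sobolevSeminorm_two_sq_le T (polyFun p)
  rw [sum_lpNorm_polyHess hT] at h1
  have h2 := (fieldForm_bounds hE (memLp_polyHess hb p) (polyHess_symm p)).1
  calc _ ≤ _ := h1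
    _ = 3 / α * (α * ∑ i, ∑ j, lpNorm (polyHess p i j) 2 (volume.restrict T) ^ 2) := by
      field_simp
    _ ≤ _ := by gcongr

namespace IsAdmissible

variable {l : ℕ}

/-- A polynomial with vanishing energy which is orthogonal to the affine functions vanishes. -/
lemma eq_zero_of_energy (h : IsAdmissible T C ρ) (hC : 0 ≤ C) (hρ : 0 < ρ)
    (hE : IsElastic α β A₀) (hα : 0 < α) {p : MvPolynomial (Fin 2) ℝ}
    (hp : fieldForm A₀ (volume.restrict T) (polyHess p) (polyHess p) ≤ 0)
    (horth : ∀ q : MvPolynomial (Fin 2) ℝ, q.totalDegree ≤ 1 →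
      ∫ x in T, polyFun p x * polyFun q x = 0) : p = 0 := by
  obtain ⟨K, hK, hinv⟩ := exists_inverse_const_sobolev 1 hρ
  have h1 := (h.sobolevSeminorm_le_of_orthogonal hC (K := 2 * K) (by positivity)
    (fun p hp => by simpa using hinv T C h p hp 0) (memSobolev_polyFun h.isBounded 2 p) horth).1
  have h2 := sobolevSeminorm_two_le h.isOpen h.isBounded hE hα p
  have h3 : sobolevSeminorm T 2 (polyFun p) ^ 2 ≤ 0 :=
    h2.trans (mul_nonpos_of_nonneg_of_nonpos (by positivity) hp)
  have h4 : sobolevSeminorm T 2 (polyFun p) = 0 :=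
    pow_eq_zero_iff two_ne_zero |>.1 (le_antisymm h3 (sq_nonneg _))
  rw [h4, mul_zero] at h1
  exact h.eq_zero_of_sobolevSeminorm h1

lemma energyProjection_unique (h : IsAdmissible T C ρ) (hC : 0 ≤ C) (hρ : 0 < ρ)
    (hA : ∀ x ∈ T, A x = A₀) (hE : IsElastic α β A₀) (hα : 0 < α) {v : Plane → ℝ}
    (hv : MemSobolev T 2 v) {p p' : MvPolynomial (Fin 2) ℝ} (hp : IsEnergyProjection A T l v p)
    (hp' : IsEnergyProjection A T l v p') : p = p' := by
  rw [isEnergyProjection_iff h.isOpen h.isBounded hA hv] at hp hp'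
  refine sub_eq_zero.1 (h.eq_zero_of_energy hC hρ hE hα (le_of_eq ?_) fun q hq => ?_)
  · have hd : (p - p').totalDegree ≤ l :=
      (MvPolynomial.totalDegree_sub _ _).trans (max_le hp.1 hp'.1)
    conv_lhs => rw [polyHess_sub p p', ← polyHess_sub p p']
    have := fieldForm_sub_left A₀ (memLp_polyHess h.isBounded p) (memLp_polyHess h.isBounded p')
      (memLp_polyHess h.isBounded (p - p'))
    rw [← polyHess_sub] at this
    rw [this, hp.2.1 _ hd, hp'.2.1 _ hd, sub_self]
  · have hq2 := memLp_polyFun h.isBounded q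
    have e : (fun x => polyFun (p - p') x * polyFun q x) =
        fun x => (polyFun p x - v x) * polyFun q x - (polyFun p' x - v x) * polyFun q x := by
      ext x; rw [polyFun_sub]; ring
    rw [e, integral_sub, hp.2.2 q hq, hp'.2.2 q hq, sub_self]
    · exact ((memLp_polyFun h.isBounded p).sub hv.1).integrable_mul hq2
    · exact ((memLp_polyFun h.isBounded p').sub hv.1).integrable_mul hq2

/-- The energy form is degenerate on affine functions, so the squares of the moments against a basis
of the affine functions are added to it. The sum is definite on the polynomials of degree at most
`l`, hence the linear system is solvable. Affine test functions then show that the moments of `p`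
and `v` agree, and what remains is the energy equation. -/
lemma exists_energyProjection (h : IsAdmissible T C ρ) (hC : 0 ≤ C) (hρ : 0 < ρ)
    (hA : ∀ x ∈ T, A x = A₀) (hE : IsElastic α β A₀) (hα : 0 < α) (hl : 1 ≤ l) {v : Plane → ℝ}
    (hv : MemSobolev T 2 v) : ∃ p, IsEnergyProjection A T l v p := by
  set V := MvPolynomial.restrictTotalDegree (Fin 2) ℝ l
  set V₁ := MvPolynomial.restrictTotalDegree (Fin 2) ℝ 1
  set g := Module.finBasis ℝ V₁
  set μ := volume.restrict T
  have hP := memLp_polyHess h.isBounded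
  have hH := hv.memLp_weakHess h.isOpen
  have hF := memLp_polyFun h.isBounded
  -- moments against the basis of the affine functions
  set m : (Plane → ℝ) → Fin (Module.finrank ℝ V₁) → ℝ :=
    fun f j => ∫ x, f x * polyFun (g j : MvPolynomial (Fin 2) ℝ) x ∂μ
  have m_add (p q : MvPolynomial (Fin 2) ℝ) (j) :
      m (polyFun (p + q)) j = m (polyFun p) j + m (polyFun q) j := by
    simp only [m, polyFun_add, add_mul]
    exact integral_add ((hF p).integrable_mul (hF _)) ((hF q).integrable_mul (hF _))
  have m_smul (c : ℝ) (p : MvPolynomial (Fin 2) ℝ) (j) :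
      m (polyFun (c • p)) j = c * m (polyFun p) j := by
    simp only [m, polyFun_smul, mul_assoc, integral_const_mul]
  have f_add (p q r : MvPolynomial (Fin 2) ℝ) : fieldForm A₀ μ (polyHess (p + q)) (polyHess r) =
      fieldForm A₀ μ (polyHess p) (polyHess r) + fieldForm A₀ μ (polyHess q) (polyHess r) := by
    rw [polyHess_add]; exact fieldForm_add_left A₀ (hP p) (hP q) (hP r)
  have f_smul (c : ℝ) (p : MvPolynomial (Fin 2) ℝ) (W : Fin 2 → Fin 2 → Plane → ℝ) :
      fieldForm A₀ μ (polyHess (c • p)) W = c * fieldForm A₀ μ (polyHess p) W := by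
    rw [polyHess_smul]; exact fieldForm_smul_left A₀ c _ _
  set L : V →ₗ[ℝ] V →ₗ[ℝ] ℝ := LinearMap.mk₂ ℝ
    (fun p q => fieldForm A₀ μ (polyHess p) (polyHess q) +
      ∑ j, m (polyFun p) j * m (polyFun q) j)
    (fun p p' q => by
      simp only [Submodule.coe_add, f_add, m_add, add_mul, Finset.sum_add_distrib]; ring)
    (fun c p q => by
      simp only [Submodule.coe_smul, f_smul, m_smul, smul_eq_mul, mul_add, Finset.mul_sum,
        mul_assoc])
    (fun p q q' => by
      simp only [Submodule.coe_add, fieldForm_symm hE (polyHess (p : MvPolynomial (Fin 2) ℝ)),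
        f_add, m_add, mul_add, Finset.sum_add_distrib]
      ring)
    (fun c p q => by
      simp only [Submodule.coe_smul, fieldForm_symm hE (polyHess (p : MvPolynomial (Fin 2) ℝ)),
        f_smul, m_smul, smul_eq_mul, mul_add, Finset.mul_sum, mul_left_comm c])
  have hLapp (p q : V) : L p q = fieldForm A₀ μ (polyHess p) (polyHess q) +
      ∑ j, m (polyFun p) j * m (polyFun q) j := rfl
  set F : V →ₗ[ℝ] ℝ :=
    { toFun := fun q => fieldForm A₀ μ (polyHess q) (weakHess T v) +
        ∑ j, m v j * m (polyFun q) j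
      map_add' := fun p q => by
        simp only [Submodule.coe_add, polyHess_add, m_add, mul_add, Finset.sum_add_distrib]
        rw [fieldForm_add_left A₀ (hP p) (hP q) hH]
        ring
      map_smul' := fun c p => by
        simp only [Submodule.coe_smul, f_smul, m_smul, smul_eq_mul, mul_add, Finset.mul_sum,
          mul_left_comm c, RingHom.id_apply] }
  have hFapp (q : V) : F q = fieldForm A₀ μ (polyHess q) (weakHess T v) +
        ∑ j, m v j * m (polyFun q) j := rfl
  have m_span {f : Plane → ℝ} (hf : MemLp f 2 μ) (c : Fin (Module.finrank ℝ V₁) → ℝ) :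
      ∫ x, f x * polyFun ((∑ j, c j • g j : V₁) : MvPolynomial (Fin 2) ℝ) x ∂μ =
        ∑ j, c j * m f j := by
    have e (x : Plane) : f x * polyFun ((∑ j, c j • g j : V₁) : MvPolynomial (Fin 2) ℝ) x =
        ∑ j, c j * (f x * polyFun (g j : MvPolynomial (Fin 2) ℝ) x) := by
      have e' : polyFun ((∑ j, c j • g j : V₁) : MvPolynomial (Fin 2) ℝ) x =
          ∑ j, c j * polyFun (g j : MvPolynomial (Fin 2) ℝ) x := by
        simp [polyFun, map_sum]
      rw [e', Finset.mul_sum]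
      exact Finset.sum_congr rfl fun j _ => by ring
    have hi (j) : Integrable (fun x => f x * polyFun (g j : MvPolynomial (Fin 2) ℝ) x) μ :=
      hf.integrable_mul (hF _)
    simp only [e]
    rw [integral_finsetSum _ fun j _ => (hi j).const_mul _]
    simp only [integral_const_mul, m]
  have horth {f : Plane → ℝ} (hf : MemLp f 2 μ) (h0 : ∀ j, m f j = 0)
      (q : MvPolynomial (Fin 2) ℝ) (hq : q.totalDegree ≤ 1) :
      ∫ x, f x * polyFun q x ∂μ = 0 := by
    have hq' := g.sum_repr ⟨q, (MvPolynomial.mem_restrictTotalDegree _ _ _).2 hq⟩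
    have := m_span hf (g.repr ⟨q, (MvPolynomial.mem_restrictTotalDegree _ _ _).2 hq⟩)
    rw [hq'] at this
    simpa [h0] using this
  have hinj : Function.Injective L := by
    rw [injective_iff_map_eq_zero]
    intro p hp
    have h1 : L p p = 0 := by rw [hp]; rfl
    rw [hLapp] at h1
    have h2 : 0 ≤ fieldForm A₀ μ (polyHess p) (polyHess p) := by
      refine le_trans ?_ (fieldForm_bounds hE (hP p) (polyHess_symm _)).1
      exact mul_nonneg hα.le (Finset.sum_nonneg fun i _ => Finset.sum_nonneg fun j _ => sq_nonneg _)
    have h3 : ∀ j ∈ Finset.univ, 0 ≤ m (polyFun p) j * m (polyFun p) j :=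
      fun j _ => mul_self_nonneg _
    have h4 := Finset.sum_nonneg h3
    have h5 : ∑ j, m (polyFun p) j * m (polyFun p) j = 0 := by linarith
    have h6 (j) : m (polyFun p) j = 0 :=
      mul_self_eq_zero.1 ((Finset.sum_eq_zero_iff_of_nonneg h3).1 h5 j (Finset.mem_univ j))
    exact Subtype.ext (h.eq_zero_of_energy hC hρ hE hα (by linarith) (horth (hF _) h6))
  have hsurj : Function.Surjective L :=
    (LinearMap.injective_iff_surjective_of_finrank_eq_finrank
      (Subspace.dual_finrank_eq (K := ℝ) (V := V)).symm).1 hinj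
  obtain ⟨p, hp⟩ := hsurj F
  have hpq (q : V) : fieldForm A₀ μ (polyHess p) (polyHess q) +
      ∑ j, m (polyFun p) j * m (polyFun q) j = fieldForm A₀ μ (polyHess q) (weakHess T v) +
        ∑ j, m v j * m (polyFun q) j := by
    rw [← hLapp, ← hFapp, hp]
  have hm (j) : m (polyFun p) j = m v j := by
    -- The test function `q₁` has the differences of moments as its coefficients. The equation then
    -- says that its `L²` norm is zero, and linear independence yields `c = 0`.
    set c : Fin (Module.finrank ℝ V₁) → ℝ := fun j => m (polyFun p) j - m v j
    set q₁ : V₁ := ∑ j, c j • g j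
    have hdeg : (q₁ : MvPolynomial (Fin 2) ℝ).totalDegree ≤ 1 :=
      (MvPolynomial.mem_restrictTotalDegree _ _ _).1 q₁.2
    have h1 := hpq ⟨q₁, (MvPolynomial.mem_restrictTotalDegree _ _ _).2 (hdeg.trans hl)⟩
    simp only [polyHess_eq_zero hdeg] at h1
    have e1 : fieldForm A₀ μ (polyHess p) (fun _ _ _ => 0) = 0 := by simp [fieldForm]
    have e2 : fieldForm A₀ μ (fun _ _ _ => 0) (weakHess T v) = 0 := by simp [fieldForm]
    rw [e1, e2, zero_add, zero_add, ← sub_eq_zero, ← Finset.sum_sub_distrib] at h1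
    simp only [← sub_mul] at h1
    have h2 := m_span (hF (q₁ : MvPolynomial (Fin 2) ℝ)) c
    have h3 : ∫ x, polyFun (q₁ : MvPolynomial (Fin 2) ℝ) x ^ 2 ∂μ = 0 := by
      simp only [sq]
      exact h2.trans h1
    rw [← lpNorm_sq_eq_integral (hF _)] at h3
    have h4 := eq_zero_of_lpNorm_polyFun h.isOpen h.nonempty (hF _)
      ((pow_eq_zero_iff two_ne_zero).1 h3)
    have h5 : q₁ = 0 := Subtype.ext h4
    have h6 := Fintype.linearIndependent_iff.1 g.linearIndependent c h5 j
    exact sub_eq_zero.1 h6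
  refine ⟨p, (isEnergyProjection_iff h.isOpen h.isBounded hA hv l p).2
    ⟨(MvPolynomial.mem_restrictTotalDegree _ _ _).1 p.2, fun q hq => ?_, ?_⟩⟩
  · have h1 := hpq ⟨q, (MvPolynomial.mem_restrictTotalDegree _ _ _).2 hq⟩
    simp only [hm] at h1
    rw [fieldForm_symm hE (weakHess T v)]
    exact add_right_cancel h1
  · refine horth ((hF _).sub hv.1) fun j => ?_
    have e : m (fun x => polyFun (p : MvPolynomial (Fin 2) ℝ) x - v x) j =
        m (polyFun p) j - m v j := by
      simp only [m, sub_mul]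
      exact integral_sub ((hF _).integrable_mul (hF _)) (hv.1.integrable_mul (hF _))
    exact e.trans (sub_eq_zero.2 (hm j))

/-- Stability of the energy projection. -/
lemma energyProjection_stable (h : IsAdmissible T C ρ) (hA : ∀ x ∈ T, A x = A₀)
    (hE : IsElastic α β A₀) (hα : 0 < α) {v : Plane → ℝ} (hv : MemSobolev T 2 v)
    {p q : MvPolynomial (Fin 2) ℝ} (hp : IsEnergyProjection A T l v p) (hq : q.totalDegree ≤ l) :
    sobolevSeminorm T 2 (polyFun (p - q)) ≤
      √(12 * |β| / α) * sobolevSeminorm T 2 (fun x => v x - polyFun q x) := by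
  rw [isEnergyProjection_iff h.isOpen h.isBounded hA hv] at hp
  have hd : (p - q).totalDegree ≤ l :=
    (MvPolynomial.totalDegree_sub _ _).trans (max_le hp.1 hq)
  set μ := volume.restrict T
  have hP := memLp_polyHess h.isBounded
  have hH := hv.memLp_weakHess h.isOpen
  set Z : Fin 2 → Fin 2 → Plane → ℝ := fun i j x => weakHess T v i j x - polyHess q i j x
  have hZ (i j : Fin 2) : MemLp (Z i j) 2 μ := (hH i j).sub (hP q i j)
  have hZs (i j : Fin 2) : Z i j = Z j i := by
    simp only [Z, weakHess_symm T v i j, polyHess_symm q i j]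
  set E := polyHess (p - q)
  -- Galerkin orthogonality: `p - q` is an admissible test function and the energies of `p` and `v`
  -- against it agree.
  have h1 : fieldForm A₀ μ E E = fieldForm A₀ μ Z E := by
    have e1 := fieldForm_sub_left A₀ (hP p) (hP q) (hP (p - q))
    rw [← polyHess_sub] at e1
    rw [e1, hp.2.1 _ hd]
    exact (fieldForm_sub_left A₀ hH (hP q) (hP (p - q))).symm
  set D : Fin 2 → Fin 2 → Plane → ℝ := fun i j x => Z i j x - E i j x
  have hD (i j : Fin 2) : MemLp (D i j) 2 μ := (hZ i j).sub (hP _ i j)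
  have hDs (i j : Fin 2) : D i j = D j i := by
    simp only [D, hZs i j, E, polyHess_symm (p - q) i j]
  have h2 : 0 ≤ fieldForm A₀ μ D D := by
    refine le_trans ?_ (fieldForm_bounds hE hD hDs).1
    exact mul_nonneg hα.le (Finset.sum_nonneg fun i _ => Finset.sum_nonneg fun j _ => sq_nonneg _)
  -- Pythagoras in the energy form; as the left-hand side is nonnegative, the energy of `p - q` is
  -- at most that of `v - q`.
  have h3 : fieldForm A₀ μ D D = fieldForm A₀ μ Z Z - fieldForm A₀ μ E E := by
    rw [fieldForm_sub_left A₀ hZ (hP (p - q)) hD, fieldForm_symm hE Z,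
      fieldForm_symm hE (polyHess _),
      fieldForm_sub_left A₀ hZ (hP (p - q)) hZ, fieldForm_sub_left A₀ hZ (hP (p - q)) (hP (p - q)),
      fieldForm_symm hE (polyHess _) Z]
    change fieldForm A₀ μ Z Z - fieldForm A₀ μ Z E - (fieldForm A₀ μ Z E - fieldForm A₀ μ E E) = _
    rw [← h1]
    ring
  have h4 := (fieldForm_bounds hE hZ hZs).2
  have h5 := sobolevSeminorm_two_le h.isOpen h.isBounded hE hα (p - q)
  have h6 : ∑ i, ∑ j, lpNorm (Z i j) 2 μ ^ 2 =
      ∑ i, ∑ j, lpNorm (weakHess T (fun x => v x - polyFun q x) i j) 2 μ ^ 2 := by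
    refine Finset.sum_congr rfl fun i _ => Finset.sum_congr rfl fun j _ => ?_
    rw [weakHess, lpNorm_congr_ae (((hv.isWeakDeriv (hessIndex_order i j).le).sub
      (isWeakDeriv_polyFun T _ q)).weakDeriv_ae_eq h.isOpen)]
    rfl
  have h7 := sum_lpNorm_weakHess_sq_le T (fun x => v x - polyFun q x)
  rw [← h6] at h7
  have h8 : 0 ≤ ∑ i, ∑ j, lpNorm (Z i j) 2 μ ^ 2 :=
    Finset.sum_nonneg fun i _ => Finset.sum_nonneg fun j _ => sq_nonneg _
  refine le_of_sq_le_sq ?_ (mul_nonneg (Real.sqrt_nonneg _) (sobolevSeminorm_nonneg _ _ _))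
  -- The factor 12 is the product of the 3 and the 4 relating the second-order seminorm to the norm
  -- of the Hessian. The absolute value of `β` keeps the constant meaningful for every real `β`.
  rw [mul_pow, Real.sq_sqrt (by positivity)]
  calc _ ≤ 3 / α * fieldForm A₀ μ E E := h5
    _ ≤ 3 / α * (|β| * (4 * sobolevSeminorm T 2 (fun x => v x - polyFun q x) ^ 2)) := by
      gcongr
      calc fieldForm A₀ μ E E ≤ fieldForm A₀ μ Z Z := by linarith
        _ ≤ β * ∑ i, ∑ j, lpNorm (Z i j) 2 μ ^ 2 := h4
        _ ≤ |β| * ∑ i, ∑ j, lpNorm (Z i j) 2 μ ^ 2 := by gcongr; exact le_abs_self β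
        _ ≤ _ := by gcongr
    _ = _ := by ring

end IsAdmissible

end energy

/-! ### Error estimates for the energy projection -/

namespace IsAdmissible

variable {A : Plane → Tensor4} {A₀ : Tensor4} {T : Set Plane} {C ρ α β : ℝ} {l : ℕ}

lemma pow_mul_sobolevSeminorm_le {K : ℝ} (hK : 1 ≤ K) (h : IsAdmissible T C ρ)
    {e : MvPolynomial (Fin 2) ℝ} (hinv : ∀ m ≤ l, Metric.diam T *
      sobolevSeminorm T (m + 1) (polyFun e) ≤ K * sobolevSeminorm T m (polyFun e))
    (k : ℕ) (hk : 2 + k ≤ l + 1) :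
    Metric.diam T ^ k * sobolevSeminorm T (2 + k) (polyFun e) ≤
      K ^ k * sobolevSeminorm T 2 (polyFun e) := by
  have hd := h.diam_pos
  induction k with
  | zero => simp
  | succ k ih =>
    calc _ = Metric.diam T ^ k * (Metric.diam T * sobolevSeminorm T (2 + k + 1) (polyFun e)) := by
          rw [← add_assoc]; ring
      _ ≤ Metric.diam T ^ k * (K * sobolevSeminorm T (2 + k) (polyFun e)) := by
          exact mul_le_mul_of_nonneg_left (hinv (2 + k) (by omega)) (by positivity)
      _ = K * (Metric.diam T ^ k * sobolevSeminorm T (2 + k) (polyFun e)) := by ring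
      _ ≤ K * (K ^ k * sobolevSeminorm T 2 (polyFun e)) := by
          exact mul_le_mul_of_nonneg_left (ih (by omega)) (zero_le_one.trans hK)
      _ = _ := by ring

/-- Error estimates for the energy projection in the interior. -/
lemma exists_interior_const (l : ℕ) (hC : 0 ≤ C) (hρ : 0 < ρ) (hα : 0 < α) (β : ℝ) :
    ∃ C₁ : ℝ, 0 ≤ C₁ ∧ ∀ (T : Set Plane), IsAdmissible T C ρ →
      ∀ (A : Plane → Tensor4) (A₀ : Tensor4), (∀ x ∈ T, A x = A₀) → IsElastic α β A₀ →
      ∀ s : ℕ, 2 ≤ s → s ≤ l + 1 → ∀ v : Plane → ℝ, MemSobolev T s v →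
      ∀ p : MvPolynomial (Fin 2) ℝ, IsEnergyProjection A T l v p → ∀ m ≤ s,
        sobolevSeminorm T m (fun x => v x - polyFun p x) ≤
          C₁ * Metric.diam T ^ (s - m) * sobolevSeminorm T s v := by
  obtain ⟨K, hK, hinv⟩ := exists_inverse_const_sobolev l hρ
  -- `Z` bounds the powers of the constant of polynomial approximation for all `s ≤ l + 1`, and `K'`
  -- is one factor valid in all the inverse estimates of order `m ≤ l`; the maxima with 1 make
  -- powers monotone in the exponent. `S` is the stability constant, and `M` the resulting constant
  -- for `m ≥ 2`.
  set Z := max 1 (2 * (l + 2) * C) ^ (l + 1)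
  set K' := max 1 ((l + 2) * K)
  set S := √(12 * |β| / α)
  set M := Z * (1 + K' ^ l * S)
  have hZ : 0 ≤ Z := by positivity
  have hK' : 1 ≤ K' := le_max_left _ _
  have hS : 0 ≤ S := Real.sqrt_nonneg _
  have hM : 0 ≤ M := by positivity
  -- The three summands serve the cases `m ≥ 2`, `m = 0` and `m = 1`.
  refine ⟨M + (6 * C) ^ 2 * M + (6 * C + 2 * K * (6 * C) ^ 2) * M, by positivity, ?_⟩
  intro T h A A₀ hA hE s hs2 hsl v hv p hp
  have hd := h.diam_pos
  set d := Metric.diam T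
  set X := sobolevSeminorm T s v
  have hX : 0 ≤ X := sobolevSeminorm_nonneg _ _ _
  have hp1 := (isEnergyProjection_iff h.isOpen h.isBounded hA (hv.mono hs2) l p).1 hp
  obtain ⟨q, hq, happ⟩ := h.exists_poly_approx hC (by omega) hv
  have hz (m : ℕ) (hm : m ≤ s) : sobolevSeminorm T m (fun x => v x - polyFun q x) ≤
      Z * d ^ (s - m) * X := by
    refine (happ m hm).trans ?_
    rw [mul_pow]
    have h1 : 2 * ((s : ℝ) + 1) * C ≤ max 1 (2 * (l + 2) * C) := by
      refine le_trans ?_ (le_max_right _ _)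
      have : (s : ℝ) ≤ l + 1 := by exact_mod_cast hsl
      gcongr 2 * ?_ * C
      linarith
    gcongr
    calc (2 * ((s : ℝ) + 1) * C) ^ (s - m) ≤ max 1 (2 * (l + 2) * C) ^ (s - m) := by gcongr
      _ ≤ Z := pow_le_pow_right₀ (le_max_left _ _) (by omega)
  have hdeg : (p - q).totalDegree ≤ l :=
    (MvPolynomial.totalDegree_sub _ _).trans (max_le hp1.1 (by omega))
  have he2 : sobolevSeminorm T 2 (polyFun (p - q)) ≤ S * (Z * d ^ (s - 2) * X) := by
    refine (h.energyProjection_stable hA hE hα (hv.mono hs2) hp (by omega)).trans ?_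
    gcongr
    exact hz 2 hs2
  -- The polynomial `p - q` is controlled at order 2 by stability; each further order costs one
  -- inverse estimate and one power of `d`.
  have he (m : ℕ) (hm2 : 2 ≤ m) (hm : m ≤ s) : sobolevSeminorm T m (polyFun (p - q)) ≤
      K' ^ l * S * Z * d ^ (s - m) * X := by
    obtain ⟨k, rfl⟩ := Nat.exists_eq_add_of_le hm2
    have h1 := h.pow_mul_sobolevSeminorm_le hK' (l := l) (e := p - q) (fun m hm => by
      refine (hinv T C h _ hdeg m).trans ?_
      have := sobolevSeminorm_nonneg T m (polyFun (p - q))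
      gcongr
      refine le_trans ?_ (le_max_right _ _)
      have : (m : ℝ) ≤ l := by exact_mod_cast hm
      gcongr) k (by omega)
    have h2 : d ^ k * sobolevSeminorm T (2 + k) (polyFun (p - q)) ≤
        d ^ k * (K' ^ l * S * Z * d ^ (s - (2 + k)) * X) := by
      calc _ ≤ K' ^ k * (S * (Z * d ^ (s - 2) * X)) := by
            refine h1.trans ?_
            gcongr
        _ ≤ K' ^ l * (S * (Z * d ^ (s - 2) * X)) := by
            gcongr
            omega
        _ = _ := by
            rw [show s - 2 = k + (s - (2 + k)) by omega, pow_add]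
            ring
    exact le_of_mul_le_mul_left h2 (by positivity)
  have hu := hv.sub (memSobolev_polyFun h.isBounded s p)
  have hge2 (m : ℕ) (hm2 : 2 ≤ m) (hm : m ≤ s) :
      sobolevSeminorm T m (fun x => v x - polyFun p x) ≤ M * d ^ (s - m) * X := by
    have e : (fun x => v x - polyFun p x) =
        fun x => (v x - polyFun q x) - polyFun (p - q) x := by
      ext x; rw [polyFun_sub]; ring
    rw [e]
    refine (sobolevSeminorm_sub_le h.isOpen hm (hv.sub (memSobolev_polyFun h.isBounded s q))
      (memSobolev_polyFun h.isBounded s (p - q))).trans ?_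
    calc _ ≤ Z * d ^ (s - m) * X + K' ^ l * S * Z * d ^ (s - m) * X :=
          add_le_add (hz m hm) (he m hm2 hm)
      _ = _ := by simp only [M]; ring
  have horth (q : MvPolynomial (Fin 2) ℝ) (hq : q.totalDegree ≤ 1) :
      ∫ x in T, (v x - polyFun p x) * polyFun q x = 0 := by
    have := hp1.2.2 q hq
    rw [← neg_eq_zero, ← integral_neg] at this
    rw [← this]
    refine integral_congr_ae (ae_of_all _ fun x => ?_)
    simp only
    ring
  intro m hm
  by_cases hm2 : 2 ≤ m
  · refine (hge2 m hm2 hm).trans ?_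
    gcongr
    have : 0 ≤ (6 * C) ^ 2 * M := by positivity
    have : 0 ≤ (6 * C + 2 * K * (6 * C) ^ 2) * M := by positivity
    linarith
  · have hl : 1 ≤ l := by omega
    have hlow := h.sobolevSeminorm_le_of_orthogonal hC (K := 2 * K) (by positivity)
      (fun p hp => by simpa using hinv T C h p (hp.trans hl) 0) (hu.mono hs2) horth
    have h2 := hge2 2 le_rfl hs2
    have hm' : m = 0 ∨ m = 1 := by omega
    rcases hm' with rfl | rfl
    · calc _ ≤ (6 * C) ^ 2 * d ^ 2 * (M * d ^ (s - 2) * X) := by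
            refine hlow.1.trans ?_
            gcongr
        _ = (6 * C) ^ 2 * M * d ^ (s - 0) * X := by
            rw [show s - 0 = 2 + (s - 2) by omega, pow_add]
            ring
        _ ≤ _ := by
            gcongr
            have : 0 ≤ (6 * C + 2 * K * (6 * C) ^ 2) * M := by positivity
            linarith
    · calc _ ≤ (6 * C + 2 * K * (6 * C) ^ 2) * d * (M * d ^ (s - 2) * X) := by
            refine hlow.2.trans ?_
            gcongr
        _ = (6 * C + 2 * K * (6 * C) ^ 2) * M * d ^ (s - 1) * X := by
            rw [show s - 1 = 1 + (s - 2) by omega, pow_add]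
            ring
        _ ≤ _ := by
            gcongr
            have : 0 ≤ (6 * C) ^ 2 * M := by positivity
            linarith

/-- Existence, uniqueness and error estimates for the energy projection on an admissible domain. -/
theorem exists_energyProjection_const (l : ℕ) (hl : 2 ≤ l) (hC : 0 ≤ C) (hρ : 0 < ρ)
    (hα : 0 < α) (β : ℝ) : ∃ C₂ : ℝ, 0 < C₂ ∧ ∀ (T : Set Plane), IsAdmissible T C ρ →
      ∀ (A : Plane → Tensor4) (A₀ : Tensor4), (∀ x ∈ T, A x = A₀) → IsElastic α β A₀ →
      (∀ v : Plane → ℝ, MemSobolev T 2 v →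
        ∃! p : MvPolynomial (Fin 2) ℝ, IsEnergyProjection A T l v p) ∧
      ∀ s : ℕ, 2 ≤ s → s ≤ l + 1 → ∀ v : Plane → ℝ, MemSobolev T s v →
      ∀ p : MvPolynomial (Fin 2) ℝ, IsEnergyProjection A T l v p →
        MemSobolev T s (fun x => v x - polyFun p x) ∧
        (∀ m : ℕ, m ≤ s → sobolevSeminorm T m (fun x => v x - polyFun p x) ≤
          C₂ * Metric.diam T ^ (s - m) * sobolevSeminorm T s v) ∧
        (∀ m : ℕ, m < s →
          (∀ κ ∈ Finset.HasAntidiagonal.antidiagonal m,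
            HasTrace T (weakDeriv T κ (fun x => v x - polyFun p x))) ∧
          boundarySeminorm T m (fun x => v x - polyFun p x) ≤
            C₂ * Metric.diam T ^ ((s : ℝ) - (m : ℝ) - 1 / 2) * sobolevSeminorm T s v) := by
  obtain ⟨C₁, hC₁, hint⟩ := exists_interior_const l hC hρ hα β
  -- `C₁` covers the interior estimates. The trace inequality adds the errors of orders `m` and `m +
  -- 1`, each with constant `C₁`, and the final 1 ensures positivity.
  refine ⟨C₁ + 2 * (l + 1) * C * (2 * C₁) + 1, by positivity, fun T h A A₀ hA hE => ⟨?_, ?_⟩⟩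
  · intro v hv
    obtain ⟨p, hp⟩ := h.exists_energyProjection (l := l) hC hρ hA hE hα (by omega) hv
    exact ⟨p, hp, fun p' hp' => h.energyProjection_unique hC hρ hA hE hα hv hp' hp⟩
  intro s hs2 hsl v hv p hp
  have hd := h.diam_pos
  have hX := sobolevSeminorm_nonneg T s v
  have hu := hv.sub (memSobolev_polyFun h.isBounded s p)
  have hi := hint T h A A₀ hA hE s hs2 hsl v hv p hp
  refine ⟨hu, fun m hm => ?_, fun m hm => ?_⟩
  · refine (hi m hm).trans ?_
    gcongr
    have : 0 ≤ 2 * (l + 1) * C * (2 * C₁) := by positivity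
    linarith
  · obtain ⟨h1, h2⟩ := h.boundarySeminorm_le hC hm hu
    refine ⟨h1, ?_⟩
    have e : Metric.diam T ^ ((s : ℝ) - (m : ℝ) - 1 / 2) =
        Metric.diam T ^ (s - m) / √(Metric.diam T) := by
      rw [Real.rpow_sub hd, ← Nat.cast_sub hm.le, Real.rpow_natCast, Real.sqrt_eq_rpow]
    have hs := Real.sqrt_pos.2 hd
    rw [e, mul_div_assoc', div_mul_eq_mul_div, le_div_iff₀ hs, mul_comm]
    have hm' : (m : ℝ) ≤ l := by exact_mod_cast (by omega : m ≤ l)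
    calc _ ≤ _ := h2
      _ ≤ 2 * (m + 1) * C * (C₁ * Metric.diam T ^ (s - m) * sobolevSeminorm T s v +
          Metric.diam T * (C₁ * Metric.diam T ^ (s - (m + 1)) * sobolevSeminorm T s v)) := by
          gcongr
          · exact hi m hm.le
          · exact hi (m + 1) hm
      _ = 2 * (m + 1) * C * (2 * C₁) * (Metric.diam T ^ (s - m) * sobolevSeminorm T s v) := by
          rw [show s - m = (s - (m + 1)) + 1 by omega, pow_succ]
          ring
      _ ≤ (C₁ + 2 * (l + 1) * C * (2 * C₁) + 1) *
          (Metric.diam T ^ (s - m) * sobolevSeminorm T s v) := by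
          gcongr
          have : 2 * ((m : ℝ) + 1) * C * (2 * C₁) ≤ 2 * (l + 1) * C * (2 * C₁) := by gcongr
          linarith
      _ = _ := by ring

end IsAdmissible

/-! ### Elements of regular polygonal meshes -/

lemma exists_tri_of_card {s : Finset Plane} (hs : s.card = 3)
    (hi : AffineIndependent ℝ ((↑) : s → Plane)) : ∃ b : Tri, Set.range b = s := by
  set e := (Finset.equivFinOfCardEq hs).symm
  have hi' : AffineIndependent ℝ (fun i : Fin 3 => (e i : Plane)) :=
    hi.comp_embedding e.toEmbedding
  have ht : affineSpan ℝ (Set.range fun i : Fin 3 => (e i : Plane)) = ⊤ := by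
    rw [hi'.affineSpan_eq_top_iff_card_eq_finrank_add_one]
    simp
  refine ⟨⟨fun i => (e i : Plane), hi', ht⟩, ?_⟩
  change Set.range (fun i : Fin 3 => (e i : Plane)) = s
  ext x
  constructor
  · rintro ⟨i, rfl⟩
    exact (e i).2
  · intro hx
    exact ⟨e.symm ⟨x, hx⟩, by simp⟩

/-- A set contains closed discs of any radius smaller than its inradius. -/
lemma exists_closedBall_of_lt_inradius {S : Set Plane} (hS : S.Nonempty) {r : ℝ}
    (h : r < inradius S) : ∃ c, Metric.closedBall c r ⊆ S := by
  obtain ⟨x, hx⟩ := hS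
  obtain ⟨r', ⟨-, c, hc⟩, hr⟩ := exists_lt_of_lt_csSup
    (⟨0, le_rfl, x, by simpa using hx⟩ : {r : ℝ | 0 ≤ r ∧ ∃ c : Plane,
      Metric.closedBall c r ⊆ S}.Nonempty) h
  exact ⟨c, (Metric.closedBall_subset_closedBall hr.le).trans hc⟩

lemma Tri.le_area {b : Tri} {c : Plane} {r : ℝ} (hr : 0 ≤ r)
    (h : Metric.closedBall c r ⊆ b.hull) : r ^ 2 * discArea ≤ b.area := by
  have h1 : volume.real (Metric.closedBall c r) ≤ volume.real b.hull :=
    measureReal_mono h b.isCompact_hull.measure_lt_top.ne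
  have h2 : volume b.hull = volume (interior b.hull) := by
    have := congrArg (fun μ => μ Set.univ) b.restrict_hull
    simpa using this
  rw [measureReal_def, volume_closedBall c hr, ENNReal.toReal_ofReal
    (mul_nonneg (sq_nonneg _) discArea_pos.le), measureReal_def, h2] at h1
  exact h1

/-- The areas of the triangles add up to that of `T`, which lies in a disc of radius equal to its
diameter. -/
lemma IsTriangulated.card_mul_le {T : Set Plane} {ι : Type} [Fintype ι] {b : ι → Tri}
    (h : IsTriangulated T b) {c : ℝ} (hb : ∀ j, c * Metric.diam T ^ 2 ≤ (b j).area) :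
    Fintype.card ι * c ≤ discArea := by
  have hd := h.diam_pos
  obtain ⟨x, hx⟩ := h.isConnected.nonempty
  have hsub : T ⊆ Metric.closedBall x (Metric.diam T) := fun y hy =>
    Metric.dist_le_diam_of_mem h.isBounded hy hx
  have h1 : volume.real T ≤ volume.real (Metric.closedBall x (Metric.diam T)) :=
    measureReal_mono hsub measure_closedBall_lt_top.ne
  rw [measureReal_def (s := Metric.closedBall x _), volume_closedBall x hd.le,
    ENNReal.toReal_ofReal (mul_nonneg (sq_nonneg _) discArea_pos.le)] at h1
  obtain ⟨o1, o2⟩ := lpNorm_one_sq h.isBounded.measure_lt_top.ne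
  rw [h.lpNorm_sq o1] at o2
  have h2 : ∑ j, (b j).area = volume.real T := by
    rw [← o2]
    exact Finset.sum_congr rfl fun j _ => (lpNorm_one_sq (b j).volume_ne_top).2.symm
  have h3 : Fintype.card ι * (c * Metric.diam T ^ 2) ≤ ∑ j, (b j).area := by
    rw [← nsmul_eq_mul, ← Finset.card_univ]
    exact Finset.card_nsmul_le_sum _ _ _ fun j _ => hb j
  have h4 : Metric.diam T ^ 2 * (Fintype.card ι * c) ≤ Metric.diam T ^ 2 * discArea := by
    linarith
  exact le_of_mul_le_mul_left h4 (by positivity)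

/-- The lower bound for the relative area of the triangles. -/
def areaConst (ϱ : ℝ) : ℝ := (ϱ ^ 2 / 2) ^ 2 * discArea

/-- The constant in the Poincaré and trace inequalities on the elements of a regular mesh. -/
def meshConst (ϱ : ℝ) : ℝ :=
  max (IsTriangulated.poincareConst (areaConst ϱ) ⌈discArea / areaConst ϱ⌉₊)
    (3 * ⌈discArea / areaConst ϱ⌉₊ / √(areaConst ϱ))

/-- The triangles of the submesh contained in the closure of `T` triangulate it, conformity being
that of the simplicial complex. Regularity bounds their inradii, hence their areas from below and
their number from above. -/
lemma PolygonalMesh.isAdmissible {Ω : Set Plane} {M : PolygonalMesh Ω} {ϱ : ℝ} (hϱ : 0 < ϱ)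
    (hM : M.IsRegular ϱ) {T : Set Plane} (hT : T ∈ M.elements) :
    IsAdmissible T (meshConst ϱ) (ϱ ^ 2 / 4) := by
  obtain ⟨K, hK, hreg, hdiam⟩ := hM
  set ι : Type := {s : Finset Plane // s ∈ K.faces ∧ s.card = 3 ∧
    convexHull ℝ (s : Set Plane) ⊆ closure T}
  have hfin : Finite ι := (hK.finite.subset fun s hs => hs.1 :
    {s : Finset Plane | s ∈ K.faces ∧ s.card = 3 ∧
      convexHull ℝ (s : Set Plane) ⊆ closure T}.Finite).to_subtype
  have := Fintype.ofFinite ι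
  have hex (s : ι) : ∃ b : Tri, Set.range b = (s.1 : Set Plane) :=
    exists_tri_of_card s.2.2.1 (K.indep s.2.1)
  choose b hb using hex
  have hhull (s : ι) : (b s).hull = convexHull ℝ (s.1 : Set Plane) := by
    rw [← hb s]; rfl
  have hmem (s : ι) : (b s).hull ∈ triangles K := ⟨s.1, s.2.1, s.2.2.1, hhull s⟩
  have hsub (s : ι) : (b s).hull ⊆ closure T := by rw [hhull]; exact s.2.2.2
  have hpoly := M.isPolygon T hT
  have htri : IsTriangulated T b :=
    { isOpen := hpoly.isOpen
      isConnected := hpoly.isConnected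
      interior_closure := hpoly.interior_closure
      closure_eq := by
        refine subset_antisymm ?_ (Set.iUnion_subset hsub)
        conv_lhs => rw [hK.element_eq T hT]
        rintro x ⟨S, ⟨⟨s, hs, hc, rfl⟩, hS⟩, hx⟩
        refine Set.mem_iUnion.2 ⟨⟨s, hs, hc, hS⟩, ?_⟩
        rw [hhull]
        exact hx
      inter := fun s t => by
        rw [hhull, hhull, hb, hb]
        exact K.inter_subset_convexHull s.2.1 t.2.1
      inj := fun s t h => by
        rw [hb, hb] at h
        exact Subtype.ext (Finset.coe_injective h) }
  have hd := htri.diam_pos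
  set d := Metric.diam T
  -- The inradius is at least `ϱ` times the diameter of the triangle, hence at least `ϱ ^ 2 * d`.
  -- Being a supremum it is only approached, and half of it leaves room.
  have hball (s : ι) : ∃ c, Metric.closedBall c (ϱ ^ 2 / 2 * d) ⊆ (b s).hull := by
    refine exists_closedBall_of_lt_inradius ⟨_, (b s).vertex_mem 0⟩ ?_
    have h1 := hreg _ (hmem s)
    have h2 := mul_le_mul_of_nonneg_left (hdiam T hT _ (hmem s) (hsub s)) hϱ.le
    have h3 : 0 < ϱ ^ 2 * d := by positivity
    linarith
  have harea (s : ι) : areaConst ϱ * d ^ 2 ≤ (b s).area := by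
    obtain ⟨c, hc⟩ := hball s
    refine le_trans (le_of_eq ?_) (Tri.le_area (by positivity) hc)
    unfold areaConst
    ring
  have hc : 0 < areaConst ϱ := by
    have := discArea_pos
    unfold areaConst
    positivity
  refine htri.isAdmissible hc ?_ harea ?_
  · have h1 := htri.card_mul_le harea
    rw [← le_div_iff₀ hc] at h1
    exact_mod_cast h1.trans (Nat.le_ceil _)
  · obtain ⟨s⟩ := htri.nonempty
    obtain ⟨c, hcb⟩ := hball s
    refine ⟨c, ?_⟩
    -- The open disc lies in the interior of the closure, which is `T`; halving the radius once more
    -- gives a closed disc in `T`, whence `ϱ ^ 2 / 4`.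
    have h1 : Metric.ball c (ϱ ^ 2 / 2 * d) ⊆ T := by
      rw [← hpoly.interior_closure]
      exact interior_maximal ((Metric.ball_subset_closedBall.trans hcb).trans (hsub s))
        Metric.isOpen_ball
    refine (Metric.closedBall_subset_ball ?_).trans h1
    have : 0 < ϱ ^ 2 * d := by positivity
    linarith

lemma meshConst_nonneg (ϱ : ℝ) : 0 ≤ meshConst ϱ :=
  (IsTriangulated.poincareConst_nonneg _ _).trans (le_max_left _ _)

end EnergyProj

end

/-! ### The uniform constant on regular polygonal meshes -/

theorem theorem2p1 (l : ℕ) (hl : 2 ≤ l) (ϱ : ℝ) (hϱ : 0 < ϱ) (α β : ℝ) (hα : 0 < α) :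
    ∃ C : ℝ, 0 < C ∧
      ∀ (Ω : Set EnergyProj.Plane), EnergyProj.IsPolygon Ω →
      ∀ (n : ℕ) (P : Fin n → Set EnergyProj.Plane), EnergyProj.IsPolygonalPartition Ω P →
      ∀ (A : EnergyProj.Plane → EnergyProj.Tensor4), EnergyProj.IsMaterialField α β P A →
      ∀ (M : EnergyProj.PolygonalMesh Ω), M.IsRegular ϱ → M.IsCompliant P →
      ∀ T ∈ M.elements,
        (∀ v : EnergyProj.Plane → ℝ, EnergyProj.MemSobolev T 2 v →
          ∃! p : MvPolynomial (Fin 2) ℝ, EnergyProj.IsEnergyProjection A T l v p) ∧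
        ∀ s : ℕ, 2 ≤ s → s ≤ l + 1 →
        ∀ v : EnergyProj.Plane → ℝ, EnergyProj.MemSobolev T s v →
        ∀ p : MvPolynomial (Fin 2) ℝ, EnergyProj.IsEnergyProjection A T l v p →
          EnergyProj.MemSobolev T s (fun x => v x - EnergyProj.polyFun p x) ∧
          (∀ m : ℕ, m ≤ s →
            EnergyProj.sobolevSeminorm T m (fun x => v x - EnergyProj.polyFun p x) ≤
              C * Metric.diam T ^ (s - m) * EnergyProj.sobolevSeminorm T s v) ∧
          (∀ m : ℕ, m < s →
            (∀ κ ∈ Finset.HasAntidiagonal.antidiagonal m, EnergyProj.HasTrace T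
              (EnergyProj.weakDeriv T κ (fun x => v x - EnergyProj.polyFun p x))) ∧
            EnergyProj.boundarySeminorm T m (fun x => v x - EnergyProj.polyFun p x) ≤
              C * Metric.diam T ^ ((s : ℝ) - (m : ℝ) - 1 / 2) *
                EnergyProj.sobolevSeminorm T s v) := by
  obtain ⟨C, hC, h⟩ := EnergyProj.IsAdmissible.exists_energyProjection_const l hl
    (EnergyProj.meshConst_nonneg ϱ) (by positivity : 0 < ϱ ^ 2 / 4) hα β
  refine ⟨C, hC, fun Ω _ n P _ A hA M hM hcomp T hT => ?_⟩
  have hadm := EnergyProj.PolygonalMesh.isAdmissible hϱ hM hT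
  -- By compliance `T` lies in one member of the partition, so the tensor field equals its value at
  -- any point `x` of `T`.
  obtain ⟨x, hx⟩ := hadm.nonempty
  obtain ⟨i, hi, -⟩ := hcomp T hT
  exact h T hadm A (A x) (fun y hy => hA.const i y (hi hy) x (hi hx)) (hA.elastic i x (hi hx))
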